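/- **Setting.** Let $X_1,\dots,X_n$ be i.i.d. $\mathcal N_p(0,\Sigma_p)$ vectors, where $\Sigma_p=[\sigma_{|i-j|}]_{1\le i,j\le p}$ is the $p\times p$ section of an infinite Toeplitz matrix $\Sigma=(\sigma_j)_{j\ge 0}$ with $\sigma_0=1$ (that is, $X_k$ is a stretch of length $p$ of a stationary Gaussian sequence), and let $\varepsilon_{k,j}$ be i.i.d. Bernoulli variables with parameter $a\in(0,1)$, independent of the $X_k$. One observes $Y_k=(\varepsilon_{k,1}X_{k,1},\dots,\varepsilon_{k,p}X_{k,p})$, $k=1,\dots,n$; $P_{a,\Sigma}$ denotes the law of the sample. For $\alpha>0$ and $\phi>0$ let $$\mathcal T(\alpha)=\Big\{\Sigma \text{ Toeplitz, all finite sections positive definite},\ \sigma_0=1,\ \sum_{j\ge1}\sigma_j^2j^{2\alpha}\le1\Big\},\qquad Q(\mathcal T(\alpha),\phi)=\Big\{\Sigma\in\mathcal T(\alpha):\ \sum_{j\ge1}\sigma_j^2\ge\phi^2\Big\}.$$ For a test $\Delta$ (a measurable $\{0,1\}$-valued function of the sample) of $H_0:\Sigma=I$ against $H_1:\Sigma\in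 Q(\mathcal T(\alpha),\phi)$, the total error probability is $$\gamma(\Delta,Q(\mathcal T(\alpha),\phi))=P_{a,I}(\Delta=1)+\sup_{\Sigma\in Q(\mathcal T(\alpha),\phi)}P_{a,\Sigma}(\Delta=0),$$ and the minimax total error probability is $\gamma=\inf_\Delta\gamma(\Delta,Q(\mathcal T(\alpha),\phi))$. For an integer $m\ge1$ and a real $t$ put $\Delta^T_m(t)=\mathbf 1(\widehat{\mathcal A}_{n,p,m}>t)$, where $$\widehat{\mathcal A}_{n,p,m}=\frac1{n(n-1)(p-m)^2\sqrt{2m}}\sum_{1\le k\ne l\le n}\ \sum_{j=1}^m\ \sum_{m+1\le i_1,i_2\le p}Y_{k,i_1}Y_{k,i_1-j}Y_{l,i_2}Y_{l,i_2-j}.$$ Limits are taken along arbitrary sequences of integers $n\to\infty$ and $p\to\infty$ and of reals $a\in(0,1)$; the quantities $\phi>0$, $m$, $t$ also vary along the sequence, while $\alpha$, $D$, $K$, $\kappa$ are fixed. **Theorem.** *Upper bound.* Let $\alpha>1/4$ and let $m\to\infty$ be such that $m/p\to0$ and $D\le m^\alpha\phi\le K^{-2\alpha}$ for some constants $D>1$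 and $K>0$. Put $B=\frac{K}{\sqrt2}(1-D^{-2})$. If $\phi\to0$ and $a^2np\,\phi^{2+\frac1{2\alpha}}\to\infty$, then for every threshold $t$ with $t\le\kappa\,a^4\phi^{2+\frac1{2\alpha}}$ for a constant $\kappa\le B$ ($\kappa<B$ in the case $D=K^{-2\alpha}$) and with $np\,t/a^2\to\infty$, the test $\Delta^T_m(t)$ is consistent: $\gamma(\Delta^T_m(t),Q(\mathcal T(\alpha),\phi))\to0$. *Lower bound.* If $\alpha>1/2$, $a^2np\to\infty$ and $a^2np\,\phi^{2+\frac1{2\alpha}}\to0$, then $\gamma=\inf_\Delta\gamma(\Delta,Q(\mathcal T(\alpha),\phi))\to1$. *Separation rate.* Consequently, if $\alpha>1/2$, $a^2np\to\infty$ and $(a^2np)^{\frac2{4\alpha+1}}/p\to0$, then $\widetilde\phi=(a^2np)^{-\frac{2\alpha}{4\alpha+1}}$ is the minimax separation rate: for every $\phi>0$ along the sequence, if $\phi/\widetilde\phi\to\infty$ there are tests $\Delta$ with $\gamma(\Delta,Q(\mathcal T(\alpha),\phi))\to0$, and if $\phi/\widetilde\phi\to0$ then $\inf_\Delta\gamma(\Delta,Q(\mathcal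 T(\alpha),\phi))\to1$. -/

import Mathlib

open Filter Topology MeasureTheory ProbabilityTheory
open scoped ENNReal

namespace MissingObs

noncomputable section

/-- The `p × p` section `[σ_{|i-j|}]` of the symmetric infinite Toeplitz matrix with entries
`σ 0, σ 1, σ 2, …` along its diagonals. -/
def toeplitzSection (σ : ℕ → ℝ) (p : ℕ) : Matrix (Fin p) (Fin p) ℝ :=
  Matrix.of fun i j => σ ((i : ℤ) - (j : ℤ)).natAbs

/-- The Sobolev-type ellipsoid `𝒯(α)` of positive definite infinite Toeplitz matrices, a matrix
being given by its sequence of diagonal values: all finite sections are positive definite,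
`σ₀ = 1` and `∑_{j ≥ 1} σ_j² j^{2α} ≤ 1` (convergence of the series included). -/
def toeplitzEllipsoid (α : ℝ) : Set (ℕ → ℝ) :=
  {σ | (∀ p, (toeplitzSection σ p).PosDef) ∧ σ 0 = 1 ∧
    Summable (fun j : ℕ => σ (j + 1) ^ 2 * ((j : ℝ) + 1) ^ (2 * α)) ∧
    ∑' j : ℕ, σ (j + 1) ^ 2 * ((j : ℝ) + 1) ^ (2 * α) ≤ 1}

/-- The alternative `Q(𝒯(α), φ)`: the elements of `𝒯(α)` with `∑_{j ≥ 1} σ_j² ≥ φ²`.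
For `α ≥ 0` the series converges for every element of `𝒯(α)`. -/
def toeplitzAlternative (α φ : ℝ) : Set (ℕ → ℝ) :=
  {σ | σ ∈ toeplitzEllipsoid α ∧ φ ^ 2 ≤ ∑' j : ℕ, σ (j + 1) ^ 2}

/-- The law `P_{a,S}` of one partially observed vector `(ε_1 X_1, …, ε_p X_p)`, where
`X ∼ 𝒩_p(0, S)` and the `ε_j` are i.i.d. Bernoulli with parameter `a`, independent of `X`. -/
def observationLaw {p : ℕ} (a : unitInterval) (S : Matrix (Fin p) (Fin p) ℝ) :
    Measure (Fin p → ℝ) :=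
  ((multivariateGaussian (0 : EuclideanSpace ℝ (Fin p)) S).prod
    (Measure.pi fun _ : Fin p => bernoulliMeasure (1 : ℝ) 0 a)).map
      fun z i => z.2 i * z.1 i

theorem measurable_mask (p : ℕ) :
    Measurable (fun (z : EuclideanSpace ℝ (Fin p) × (Fin p → ℝ)) (i : Fin p) =>
      z.2 i * z.1 i) := by
  fun_prop

instance {p : ℕ} (a : unitInterval) (S : Matrix (Fin p) (Fin p) ℝ) :
    IsProbabilityMeasure (observationLaw a S) :=
  Measure.isProbabilityMeasure_map (measurable_mask p).aemeasurable

/-- A data set: `n` vectors of dimension `p`. -/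
abbrev Sample (n p : ℕ) : Type := Fin n → Fin p → ℝ

/-- The law of the sample `(Y_1, …, Y_n)` of i.i.d. partially observed vectors. -/
def sampleLaw (n : ℕ) {p : ℕ} (a : unitInterval) (S : Matrix (Fin p) (Fin p) ℝ) :
    Measure (Sample n p) :=
  Measure.pi fun _ : Fin n => observationLaw a S

instance (n : ℕ) {p : ℕ} (a : unitInterval) (S : Matrix (Fin p) (Fin p) ℝ) :
    IsProbabilityMeasure (sampleLaw n a S) := by
  unfold sampleLaw; infer_instance

/-- The total error probability `γ(Δ, Q(𝒯(α), φ))` of a test `Δ` of `Σ = I`: the sum of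
`P_I(Δ = 1)` and of the supremum of `P_Σ(Δ = 0)` over the alternative. -/
def totalError {n p : ℕ} (a : unitInterval) (α φ : ℝ) (Δ : Sample n p → Fin 2) : ℝ≥0∞ :=
  sampleLaw n a (1 : Matrix (Fin p) (Fin p) ℝ) {y | Δ y = 1} +
    ⨆ σ ∈ toeplitzAlternative α φ, sampleLaw n a (toeplitzSection σ p) {y | Δ y = 0}

/-- The minimax total error probability: the infimum of `γ(Δ, Q(𝒯(α), φ))` over all
(measurable) tests `Δ`. -/
def minimaxError (n p : ℕ) (a : unitInterval) (α φ : ℝ) : ℝ≥0∞ :=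
  ⨅ (Δ : Sample n p → Fin 2) (_ : Measurable Δ), totalError a α φ Δ

/-- `S_{k,j} = ∑_{i = m+1}^{p} Y_{k,i} Y_{k,i-j}` for a single vector `y = Y_k` and `j ≤ m`
(coordinates are numbered from `0` in the code). -/
def diagonalSum {p : ℕ} (m j : ℕ) (y : Fin p → ℝ) : ℝ :=
  ∑ i ∈ Finset.univ.filter (fun i : Fin p => m ≤ (i : ℕ)),
    y i * y ⟨(i : ℕ) - j, (Nat.sub_le _ _).trans_lt i.isLt⟩

/-- The statistic `Â_{n,p,m}`; the double sum over `i₁, i₂` is written as the product of the sums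
over `i₁` and over `i₂`. -/
def statistic {n p : ℕ} (m : ℕ) (y : Sample n p) : ℝ :=
  1 / ((n : ℝ) * ((n : ℝ) - 1) * ((p : ℝ) - (m : ℝ)) ^ 2) * (1 / √(2 * (m : ℝ))) *
    ∑ k : Fin n, ∑ l ∈ Finset.univ.filter (fun l : Fin n => k ≠ l), ∑ j ∈ Finset.Icc 1 m,
      diagonalSum m j (y k) * diagonalSum m j (y l)

open Classical in
/-- The test `Δ^T_m(t) = 𝟙(Â_{n,p,m} > t)`. -/
def toeplitzTest {n p : ℕ} (m : ℕ) (t : ℝ) (y : Sample n p) : Fin 2 :=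
  if statistic m y > t then 1 else 0

/-- The constant `B = K (1 - D⁻²) / √2`. -/
def thresholdConst (D K : ℝ) : ℝ := K / √2 * (1 - (D ^ 2)⁻¹)

/-- `ρ` is a minimax separation rate over `𝒯(α)` along the sequences `n, p, a`: there are tests
with total error tending to `0` when `φ / ρ → ∞`, and the minimax total error tends to `1` when
`φ / ρ → 0`. -/
def IsMinimaxSeparationRate (n p : ℕ → ℕ) (a : ℕ → unitInterval) (α : ℝ) (ρ : ℕ → ℝ) : Prop :=
  ∀ φ : ℕ → ℝ, (∀ N, 0 < φ N) →
    (Tendsto (fun N => φ N / ρ N) atTop atTop →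
      ∃ Δ : (N : ℕ) → Sample (n N) (p N) → Fin 2, (∀ N, Measurable (Δ N)) ∧
        Tendsto (fun N => totalError (a N) α (φ N) (Δ N)) atTop (𝓝 0)) ∧
    (Tendsto (fun N => φ N / ρ N) atTop (𝓝 0) →
      Tendsto (fun N => minimaxError (n N) (p N) (a N) α (φ N)) atTop (𝓝 1))

end

end MissingObs

open MissingObs

/-!
**Upper bound.** Up to its normalization the statistic is a quadratic `U`-statistic
`∑_{k ≠ l} ⟨T(Y_k), T(Y_l)⟩` in the vector `T = (S_1, …, S_m)` of diagonal sums, whose mean is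
`(p - m) a² (σ_1, …, σ_m)`. Its Hoeffding decomposition bounds its variance by the Frobenius norm
of the covariance matrix of `T` (`ustat_chebyshev`). By Isserlis' formula and the independence of
the masks, the entry `(j, j')` of this matrix is at most `a² p` times autocorrelations of `|σ|` at
the lags `j - j'` and `j + j'` (`abs_cov_diagonalSum_le`), and these autocorrelations are square
summable uniformly over `𝒯(α)` as soon as `α > 1/4` (`exists_sum_absConv_sq_le`), so the squared
Frobenius norm is `O(a⁴ p² m)`. Chebyshev's inequality then bounds both error probabilities
(`exists_type_one_le`, `exists_type_two_le`). The normalized energy of the first `m` diagonals is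
bounded from below by a function of `u = m^α φ` (`energy_lower_bound`), which on the allowed range
of `u` is at least `B` and equals `B` only if `D = K^{-2α}`; by compactness the mean of the
statistic exceeds the threshold by a fixed proportion (`exists_threshold_slack`).

**Lower bound.** The prior is uniform over sequences `σ_j = ± φ / √m`, `1 ≤ j ≤ m`, with
`m = ⌊φ^{-1/α}⌋`. Conditionally on the masks, an unobserved coordinate may be replaced by
independent noise (`map_mask_multivariateGaussian`), so the likelihood ratio is the one of
`𝒩(0, 1 + zAz)`, `z` being the diagonal matrix of the mask, and the inner product of two such
ratios is a product of determinants `det (1 - A B)^{-1/2}`. Expanding the logarithm, the exponent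
is `tr (A B) / 2`, which is linear in the products `u_j v_j` of the signs and hence sub-Gaussian
after averaging (`sum_exp_signs_le`), plus a remainder controlled by the squared operator norm `D`
(`lintegral_gaussianRatio_mul_le`). The worst case bound `D ≤ 4 m φ²` would require
`α ≥ 3/4`; for most signs the autocorrelations of the sequence are so small that Schur's test gives
`D = O(φ)` (`card_goodSigns_ge`, `opSqBound_signMat_of_good`), which suffices for every `α > 1/2`. The prior is restricted to these good signs; this also makes the matrices positive
definite. Finally the number of pairs of observed coordinates at a given distance is at most of the
order `a² n p` with high probability (`masksLaw_counts_ge`), and on that event the second moment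
of the mixture tends to `1`, so that no test can do asymptotically better than a total error of `1`
(`le_totalError`).

**Separation rate.** The rate `ρ` solves `a² n p ρ^{2 + 1/(2α)} = 1`. Above it, the test with
`m ≍ φ^{-1/α}` is consistent; since the total error decreases with `φ`, one may first replace `φ`
by `min φ √ρ`, which tends to `0` (`exists_consistent_test`).
-/

namespace MissingObs

/-! ### Gaussian moments -/

/-- Tonelli's theorem for a product of functions of the coordinates. -/
theorem lintegral_fin_pi_prod {n : ℕ} {E : Type*} {mE : MeasurableSpace E}
    (μ : Fin n → Measure E) [∀ i, SigmaFinite (μ i)] (f : Fin n → E → ℝ≥0∞)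
    (hf : ∀ i, Measurable (f i)) :
    ∫⁻ x, ∏ i, f i (x i) ∂(Measure.pi μ) = ∏ i, ∫⁻ x, f i x ∂(μ i) := by
  induction n with
  | zero => simp
  | succ n ih =>
    rw [← ((measurePreserving_piFinSuccAbove μ 0).symm).lintegral_comp_emb
      (MeasurableEquiv.measurableEmbedding _), Fin.prod_univ_succ]
    simp_rw [MeasurableEquiv.piFinSuccAbove_symm_apply, Fin.insertNthEquiv,
      Fin.prod_univ_succ, Equiv.coe_fn_mk, Fin.insertNth_zero, Fin.cons_succ, Fin.cons_zero]
    simp only [cast_eq, Fin.succAbove_zero]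
    rw [lintegral_prod_mul (μ := μ 0) (ν := Measure.pi fun i : Fin n => μ i.succ)
      (f := f 0) (g := fun x => ∏ i : Fin n, f i.succ (x i)) (hf 0).aemeasurable]
    · rw [ih (fun i => μ i.succ) (fun i => f i.succ) fun i => hf _]
    · exact (Finset.measurable_prod _ fun i _ =>
        (hf _).comp (measurable_pi_apply i)).aemeasurable

/-- The fourth derivative at `0` of `t ↦ exp (v t² / 2)`, written in the form in which the moment
generating function of a Gaussian with mean `0` is stated. -/
theorem iteratedDeriv_four_exp_sq (v : ℝ) :
    iteratedDeriv 4 (fun t : ℝ => Real.exp (0 * t + v * t ^ 2 / 2)) 0 = 3 * v ^ 2 := by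
  -- differentiation preserves the shape `P(t) exp (v t² / 2)`
  have key : ∀ (P P' : ℝ → ℝ), (∀ t, HasDerivAt P (P' t) t) →
      deriv (fun t : ℝ => P t * Real.exp (0 * t + v * t ^ 2 / 2)) =
        fun t => (P' t + P t * (v * t)) * Real.exp (0 * t + v * t ^ 2 / 2) := by
    intro P P' h
    funext t
    have h1 : HasDerivAt (fun t : ℝ => 0 * t + v * t ^ 2 / 2) (v * t) t := by
      have := (((hasDerivAt_id t).const_mul 0).add
        ((((hasDerivAt_id t).pow 2).const_mul v).div_const 2))
      refine this.congr_deriv ?_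
      simp; ring
    have h2 := ((h t).mul h1.exp).deriv
    simp only [Pi.mul_def] at h2
    rw [h2]; ring
  rw [iteratedDeriv_eq_iterate]
  simp only [Function.iterate_succ, Function.iterate_zero, Function.comp_apply, id]
  have e0 : (fun t : ℝ => Real.exp (0 * t + v * t ^ 2 / 2)) =
      fun t => (fun _ => (1:ℝ)) t * Real.exp (0 * t + v * t ^ 2 / 2) := by
    funext t; simp
  rw [e0, key _ (fun _ => 0) (fun t => hasDerivAt_const t 1)]
  rw [key (fun t => 0 + 1 * (v * t)) (fun _ => v) (fun t => by
    refine (((hasDerivAt_id t).const_mul v).const_mul 1 |>.const_add 0).congr_deriv ?_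
    simp)]
  rw [key (fun t => v + (0 + 1 * (v * t)) * (v * t)) (fun t => 2 * v ^ 2 * t) (fun t => by
    have := ((((hasDerivAt_id t).pow 2).const_mul (v ^ 2)).const_add v)
    refine (this.congr_deriv ?_).congr_of_eventuallyEq (Eventually.of_forall fun s => ?_)
    · simp; ring
    · simp; ring)]
  rw [key (fun t => 2 * v ^ 2 * t + (v + (0 + 1 * (v * t)) * (v * t)) * (v * t))
    (fun t => 3 * v ^ 2 + 3 * v ^ 3 * t ^ 2) (fun t => by
    have := ((((hasDerivAt_id t).pow 3).const_mul (v ^ 3)).add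
      (((hasDerivAt_id t)).const_mul (3 * v ^ 2)))
    refine (this.congr_deriv ?_).congr_of_eventuallyEq (Eventually.of_forall fun s => ?_)
    · simp; ring
    · simp; ring)]
  simp

theorem integral_pow_four_gaussianReal (v : NNReal) :
    ∫ x, x ^ 4 ∂(gaussianReal 0 v) = 3 * (v : ℝ) ^ 2 := by
  have h := iteratedDeriv_mgf_zero (X := id) (μ := gaussianReal 0 v) (by simp) 4
  rw [mgf_id_gaussianReal, iteratedDeriv_four_exp_sq] at h
  rw [h]; rfl

/-- The fourth moment of a linear functional of a centred Gaussian vector. -/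
theorem integral_inner_pow_four {p : ℕ} {S : Matrix (Fin p) (Fin p) ℝ} (hS : S.PosSemidef)
    (c : Fin p → ℝ) :
    ∫ x, (∑ i, c i * x i) ^ 4 ∂(multivariateGaussian (0 : EuclideanSpace ℝ (Fin p)) S) =
      3 * (∑ i, ∑ j, c i * c j * S i j) ^ 2 := by
  set P := multivariateGaussian (0 : EuclideanSpace ℝ (Fin p)) S
  let L : EuclideanSpace ℝ (Fin p) →L[ℝ] ℝ := ∑ i, c i • EuclideanSpace.proj i
  have hL : ∀ x, L x = ∑ i, c i * x i := fun x => by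
    simp [L]
  have hm : P.map L = gaussianReal 0 (Var[L; P]).toNNReal := by
    rw [IsGaussian.map_eq_gaussianReal, ContinuousLinearMap.integral_comp_id_comm]
    · simp [P]
    · exact IsGaussian.integrable_id
  have hv : Var[L; P] = ∑ i, ∑ j, c i * c j * S i j := by
    have hmem : ∀ i, MemLp (fun x : EuclideanSpace ℝ (Fin p) => c i * x i) 2 P := fun i => by
      have : MemLp (EuclideanSpace.proj (𝕜 := ℝ) i : EuclideanSpace ℝ (Fin p) →L[ℝ] ℝ) 2 P :=
        IsGaussian.memLp_dual P _ 2 (by simp)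
      exact this.const_mul (c i)
    have h1 : (L : EuclideanSpace ℝ (Fin p) → ℝ) = fun x => ∑ i, c i * x i := funext hL
    rw [h1, ← covariance_self (Finset.aemeasurable_fun_sum _ fun i _ =>
      (hmem i).aestronglyMeasurable.aemeasurable)]
    rw [covariance_fun_sum_fun_sum hmem hmem]
    refine Finset.sum_congr rfl fun i _ => Finset.sum_congr rfl fun j _ => ?_
    rw [covariance_const_mul_left, covariance_const_mul_right,
      covariance_eval_multivariateGaussian hS]
    ring
  have h2 : ∫ x, (∑ i, c i * x i) ^ 4 ∂P = ∫ y, y ^ 4 ∂(P.map L) := by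
    rw [integral_map (by fun_prop) (by fun_prop)]
    simp_rw [hL]
  rw [h2, hm, integral_pow_four_gaussianReal, Real.coe_toNNReal _ (variance_nonneg _ _), hv]

theorem integrable_pow_four_multivariateGaussian {p : ℕ} (S : Matrix (Fin p) (Fin p) ℝ)
    (c : Fin p → ℝ) :
    Integrable (fun x : EuclideanSpace ℝ (Fin p) => (∑ i, c i * x i) ^ 4)
      (multivariateGaussian 0 S) := by
  let L : EuclideanSpace ℝ (Fin p) →L[ℝ] ℝ := ∑ i, c i • EuclideanSpace.proj i
  have hL : (L : EuclideanSpace ℝ (Fin p) → ℝ) = fun x => ∑ i, c i * x i := by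
    funext x; simp [L]
  have h : MemLp L 4 (multivariateGaussian (0 : EuclideanSpace ℝ (Fin p)) S) :=
    IsGaussian.memLp_dual _ L 4 (by simp)
  rw [hL] at h
  have h2 := h.integrable_norm_pow (p := 4) (by norm_num)
  refine h2.congr (Eventually.of_forall fun x => ?_)
  have : |∑ i, c i * x i| ^ 4 = (∑ i, c i * x i) ^ 4 :=
    (show Even 4 by decide).pow_abs _
  simpa using this

theorem integral_coord_mul_coord {p : ℕ} {S : Matrix (Fin p) (Fin p) ℝ} (hS : S.PosSemidef)
    (i j : Fin p) :
    ∫ x, x i * x j ∂(multivariateGaussian (0 : EuclideanSpace ℝ (Fin p)) S) = S i j := by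
  have hmem : ∀ i : Fin p, MemLp (fun x : EuclideanSpace ℝ (Fin p) => x i) 2
      (multivariateGaussian (0 : EuclideanSpace ℝ (Fin p)) S) := fun i =>
    IsGaussian.memLp_dual _
      (EuclideanSpace.proj (𝕜 := ℝ) i : EuclideanSpace ℝ (Fin p) →L[ℝ] ℝ) 2 (by simp)
  have hmean : ∀ i : Fin p, ∫ x, x i
      ∂(multivariateGaussian (0 : EuclideanSpace ℝ (Fin p)) S) = 0 := fun i => by
    have := ContinuousLinearMap.integral_comp_id_comm
      (μ := multivariateGaussian (0 : EuclideanSpace ℝ (Fin p)) S) IsGaussian.integrable_id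
      (EuclideanSpace.proj (𝕜 := ℝ) i : EuclideanSpace ℝ (Fin p) →L[ℝ] ℝ)
    simpa using this
  rw [← covariance_eval_multivariateGaussian (μ := 0) hS i j, covariance_eq_sub (hmem i) (hmem j)]
  simp [hmean]

/-- Polarization of a product of four reals into fourth powers. -/
theorem polarization_four (a b c d : ℝ) :
    192 * (a * b * c * d) =
      (a + b + c + d) ^ 4 - (a + b + c - d) ^ 4 - (a + b - c + d) ^ 4 - (a - b + c + d) ^ 4
      + (a + b - c - d) ^ 4 + (a - b + c - d) ^ 4 + (a - b - c + d) ^ 4 - (a - b - c - d) ^ 4 := by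
  ring

/-- Isserlis' formula for the fourth mixed moments of a centred Gaussian vector. -/
theorem integral_four_coords {p : ℕ} {S : Matrix (Fin p) (Fin p) ℝ} (hS : S.PosSemidef)
    (i j k l : Fin p) :
    Integrable (fun x : EuclideanSpace ℝ (Fin p) => x i * x j * x k * x l)
      (multivariateGaussian 0 S) ∧
    ∫ x, x i * x j * x k * x l ∂(multivariateGaussian (0 : EuclideanSpace ℝ (Fin p)) S) =
      S i j * S k l + S i k * S j l + S i l * S j k := by
  set P := multivariateGaussian (0 : EuclideanSpace ℝ (Fin p)) S
  have hsymm : ∀ a b, S a b = S b a := fun a b => by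
    have := hS.1.apply b a
    simpa using this
  -- fourth moments of all linear combinations of the four coordinates, to be polarized
  have key : ∀ s t u : ℝ, Integrable (fun x : EuclideanSpace ℝ (Fin p) =>
        (x i + s * x j + t * x k + u * x l) ^ 4) P ∧
      ∫ x, (x i + s * x j + t * x k + u * x l) ^ 4 ∂P =
        3 * (S i i + s ^ 2 * S j j + t ^ 2 * S k k + u ^ 2 * S l l + 2 * s * S i j + 2 * t * S i k
          + 2 * u * S i l + 2 * s * t * S j k + 2 * s * u * S j l + 2 * t * u * S k l) ^ 2 := by
    intro s t u
    let c : Fin p → ℝ := fun a => (Pi.single i 1 : Fin p → ℝ) a +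
      s * (Pi.single j 1 : Fin p → ℝ) a + t * (Pi.single k 1 : Fin p → ℝ) a +
      u * (Pi.single l 1 : Fin p → ℝ) a
    have hc : ∀ x : Fin p → ℝ, ∑ a, c a * x a = x i + s * x j + t * x k + u * x l := fun x => by
      simp only [c, add_mul, mul_assoc, Finset.sum_add_distrib, ← Finset.mul_sum]
      simp [Pi.single_apply]
    have hq : ∑ a, ∑ b, c a * c b * S a b =
        S i i + s ^ 2 * S j j + t ^ 2 * S k k + u ^ 2 * S l l + 2 * s * S i j + 2 * t * S i k
          + 2 * u * S i l + 2 * s * t * S j k + 2 * s * u * S j l + 2 * t * u * S k l := by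
      simp_rw [mul_assoc, ← Finset.mul_sum, hc (fun b => S _ b)]
      rw [hc fun a => S a i + s * S a j + t * S a k + u * S a l]
      rw [hsymm j i, hsymm k i, hsymm l i, hsymm k j, hsymm l j, hsymm l k]
      ring
    constructor
    · have := integrable_pow_four_multivariateGaussian S c
      exact this.congr (Eventually.of_forall fun x => by simp only [hc fun a => x a])
    · rw [← hq, ← integral_inner_pow_four hS c]
      refine integral_congr_ae (Eventually.of_forall fun x => by simp only [hc fun a => x a])
  have hpol : (fun x : EuclideanSpace ℝ (Fin p) => x i * x j * x k * x l) = fun x => (1 / 192) *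
      ((x i + 1 * x j + 1 * x k + 1 * x l) ^ 4 - (x i + 1 * x j + 1 * x k + (-1) * x l) ^ 4
      - (x i + 1 * x j + (-1) * x k + 1 * x l) ^ 4 - (x i + (-1) * x j + 1 * x k + 1 * x l) ^ 4
      + (x i + 1 * x j + (-1) * x k + (-1) * x l) ^ 4
      + (x i + (-1) * x j + 1 * x k + (-1) * x l) ^ 4
      + (x i + (-1) * x j + (-1) * x k + 1 * x l) ^ 4
      - (x i + (-1) * x j + (-1) * x k + (-1) * x l) ^ 4) := by
    funext x; have := polarization_four (x i) (x j) (x k) (x l); linear_combination this / 192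
  have h1 := key 1 1 1
  have h2 := key 1 1 (-1)
  have h3 := key 1 (-1) 1
  have h4 := key (-1) 1 1
  have h5 := key 1 (-1) (-1)
  have h6 := key (-1) 1 (-1)
  have h7 := key (-1) (-1) 1
  have h8 := key (-1) (-1) (-1)
  have i2 := h1.1.sub h2.1
  have i3 := i2.sub h3.1
  have i4 := i3.sub h4.1
  have i5 := i4.add h5.1
  have i6 := i5.add h6.1
  have i7 := i6.add h7.1
  have i8 := i7.sub h8.1
  constructor
  · rw [hpol]; exact i8.const_mul _
  · rw [hpol, integral_const_mul]
    have e8 := integral_sub i7 h8.1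
    have e7 := integral_add i6 h7.1
    have e6 := integral_add i5 h6.1
    have e5 := integral_add i4 h5.1
    have e4 := integral_sub i3 h4.1
    have e3 := integral_sub i2 h3.1
    have e2 := integral_sub h1.1 h2.1
    simp only [Pi.add_apply, Pi.sub_apply] at e2 e3 e4 e5 e6 e7 e8
    rw [e8, e7, e6, e5, e4, e3, e2, h1.2, h2.2, h3.2, h4.2, h5.2, h6.2, h7.2, h8.2]
    ring

/-! ### Masks -/

/-- The law of a mask: `p` independent Bernoulli variables with parameter `a`. -/
noncomputable def maskLaw (a : unitInterval) (p : ℕ) : Measure (Fin p → ℝ) :=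
  Measure.pi fun _ : Fin p => bernoulliMeasure (1 : ℝ) 0 a

instance (a : unitInterval) (p : ℕ) : IsProbabilityMeasure (maskLaw a p) := by
  unfold maskLaw; infer_instance

theorem ae_bernoulli (a : unitInterval) : ∀ᵐ x ∂(bernoulliMeasure (1 : ℝ) 0 a), x = 0 ∨ x = 1 := by
  rw [bernoulliMeasure_def, ae_add_measure_iff]
  constructor
  · exact Measure.ae_smul_measure (by simp [ae_dirac_eq]) _
  · exact Measure.ae_smul_measure (by simp [ae_dirac_eq]) _

theorem ae_maskLaw (a : unitInterval) (p : ℕ) :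
    ∀ᵐ z ∂(maskLaw a p), ∀ i, z i = 0 ∨ z i = 1 := by
  rw [ae_all_iff]
  intro i
  exact (measurePreserving_eval (fun _ : Fin p => bernoulliMeasure (1 : ℝ) 0 a)
    i).quasiMeasurePreserving.ae (ae_bernoulli a)

theorem integral_bernoulli (a : unitInterval) :
    Integrable (fun x : ℝ => x) (bernoulliMeasure (1 : ℝ) 0 a) ∧
    ∫ x, x ∂(bernoulliMeasure (1 : ℝ) 0 a) = a := by
  have hi : Integrable (fun x : ℝ => x) (bernoulliMeasure (1 : ℝ) 0 a) := by
    refine Integrable.of_bound (by fun_prop) 1 ?_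
    filter_upwards [ae_bernoulli a] with x hx
    rcases hx with rfl | rfl <;> simp
  refine ⟨hi, ?_⟩
  have h1 : Integrable (fun x : ℝ => x) (unitInterval.toNNReal a • Measure.dirac (1:ℝ)) := by
    rw [bernoulliMeasure_def] at hi; exact hi.left_of_add_measure
  have h2 : Integrable (fun x : ℝ => x)
      (unitInterval.toNNReal (unitInterval.symm a) • Measure.dirac (0:ℝ)) := by
    rw [bernoulliMeasure_def] at hi; exact hi.right_of_add_measure
  rw [bernoulliMeasure_def, integral_add_measure h1 h2]
  simp [integral_smul_nnreal_measure, NNReal.smul_def]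

theorem integral_prod_mask (a : unitInterval) (p : ℕ) (s : Finset (Fin p)) :
    ∫ z, ∏ i ∈ s, z i ∂(maskLaw a p) = (a : ℝ) ^ s.card := by
  have h : ∀ z : Fin p → ℝ, ∏ i ∈ s, z i = ∏ i, (if i ∈ s then z i else 1) := fun z => by
    rw [Finset.prod_ite_mem, Finset.univ_inter]
  simp_rw [h]
  rw [maskLaw, integral_fintype_prod_eq_prod (fun i (x : ℝ) => if i ∈ s then x else 1)]
  rw [← Finset.prod_const, ← Finset.univ_inter s, ← Finset.prod_ite_mem]
  refine Finset.prod_congr rfl fun i _ => ?_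
  by_cases hi : i ∈ s
  · simp [hi, (integral_bernoulli a).2]
  · simp [hi]

theorem integrable_prod_mask (a : unitInterval) (p : ℕ) (s : Finset (Fin p)) :
    Integrable (fun z => ∏ i ∈ s, z i) (maskLaw a p) := by
  refine Integrable.of_bound (by fun_prop) 1 ?_
  filter_upwards [ae_maskLaw a p] with z hz
  rw [norm_prod]
  refine Finset.prod_le_one (fun _ _ => norm_nonneg _) fun i _ => ?_
  rcases hz i with h | h <;> simp [h]

/-- Moments of a mask depend only on the number of distinct coordinates, since its entries are
idempotent. -/
theorem integral_four_mask (a : unitInterval) {p : ℕ} (i j k l : Fin p) :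
    Integrable (fun z => z i * z j * z k * z l) (maskLaw a p) ∧
    ∫ z, z i * z j * z k * z l ∂(maskLaw a p) =
      (a : ℝ) ^ (({i, j, k, l} : Finset (Fin p)).card) := by
  have h : (fun z : Fin p → ℝ => ∏ i ∈ ({i, j, k, l} : Finset (Fin p)), z i) =ᵐ[maskLaw a p]
      fun z => z i * z j * z k * z l := by
    filter_upwards [ae_maskLaw a p] with z hz
    -- repeated coordinates may be inserted since `z_b² = z_b`
    have hins : ∀ (b : Fin p) (s : Finset (Fin p)),
        ∏ c ∈ insert b s, z c = z b * ∏ c ∈ s, z c := by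
      intro b s
      by_cases hb : b ∈ s
      · rw [Finset.insert_eq_self.2 hb, ← Finset.mul_prod_erase s _ hb, ← mul_assoc]
        rcases hz b with h | h <;> simp [h]
      · rw [Finset.prod_insert hb]
    rw [hins, hins, hins, Finset.prod_singleton]; ring
  exact ⟨(integrable_prod_mask a p _).congr h,
    by rw [← integral_congr_ae h, integral_prod_mask]⟩

theorem integral_two_mask (a : unitInterval) {p : ℕ} {i j : Fin p} (hij : i ≠ j) :
    Integrable (fun z => z i * z j) (maskLaw a p) ∧
    ∫ z, z i * z j ∂(maskLaw a p) = (a : ℝ) ^ 2 := by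
  have h : (fun z : Fin p → ℝ => ∏ i ∈ ({i, j} : Finset (Fin p)), z i) =
      fun z => z i * z j := by
    funext z; rw [Finset.prod_pair hij]
  rw [← h]
  exact ⟨integrable_prod_mask a p _, by rw [integral_prod_mask, Finset.card_pair hij]⟩

theorem integral_observationLaw {p : ℕ} (a : unitInterval) (S : Matrix (Fin p) (Fin p) ℝ)
    {f : (Fin p → ℝ) → ℝ} (hf : Measurable f) :
    ∫ y, f y ∂(observationLaw a S) =
      ∫ w, f (fun i => w.2 i * w.1 i) ∂((multivariateGaussian (0 : EuclideanSpace ℝ (Fin p)) S).prod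
        (maskLaw a p)) := by
  rw [observationLaw, integral_map (measurable_mask p).aemeasurable hf.aestronglyMeasurable]
  rfl

theorem observation_two_moment {p : ℕ} (a : unitInterval) {S : Matrix (Fin p) (Fin p) ℝ}
    (hS : S.PosSemidef) {i j : Fin p} (hij : i ≠ j) :
    ∫ y, y i * y j ∂(observationLaw a S) = (a : ℝ) ^ 2 * S i j := by
  rw [integral_observationLaw a S (by fun_prop), ← (integral_two_mask a hij).2,
    ← integral_coord_mul_coord hS i j, mul_comm, ← integral_prod_mul]
  refine integral_congr_ae (Eventually.of_forall fun w => ?_)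
  simp only; ring

/-- Fourth mixed moments of a partially observed vector; the exponent of `a` is the number of
distinct coordinates involved. -/
theorem observation_four_moment {p : ℕ} (a : unitInterval) {S : Matrix (Fin p) (Fin p) ℝ}
    (hS : S.PosSemidef) (i j k l : Fin p) :
    Integrable (fun y => y i * y j * y k * y l) (observationLaw a S) ∧
    ∫ y, y i * y j * y k * y l ∂(observationLaw a S) =
      (a : ℝ) ^ (({i, j, k, l} : Finset (Fin p)).card) *
        (S i j * S k l + S i k * S j l + S i l * S j k) := by
  have hc : ∀ w : EuclideanSpace ℝ (Fin p) × (Fin p → ℝ),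
      (w.1 i * w.1 j * w.1 k * w.1 l) * (w.2 i * w.2 j * w.2 k * w.2 l) =
        (w.2 i * w.1 i) * (w.2 j * w.1 j) * (w.2 k * w.1 k) * (w.2 l * w.1 l) := fun w => by ring
  constructor
  · rw [observationLaw, integrable_map_measure (by fun_prop) (measurable_mask p).aemeasurable]
    have := (integral_four_coords hS i j k l).1.mul_prod (integral_four_mask a i j k l).1
    exact this.congr (Eventually.of_forall hc)
  · rw [integral_observationLaw a S (by fun_prop), ← (integral_four_mask a i j k l).2,
      ← (integral_four_coords hS i j k l).2, mul_comm, ← integral_prod_mul]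
    exact integral_congr_ae (Eventually.of_forall fun w => (hc w).symm)

/-! ### Chebyshev's inequality for quadratic `U`-statistics -/

section UStatistic

variable {n : ℕ}

section CoordFactor

variable {Ω : Type*}

/-- The function on `Ω` that is left at coordinate `i` when `f(y_k) f(y_l) g(y_k') g(y_l')` is
written as a product over the coordinates. -/
def coordFactor (f g : Ω → ℝ) (k l k' l' i : Fin n) (x : Ω) : ℝ :=
  (if i = k then f x else 1) * (if i = l then f x else 1) *
    ((if i = k' then g x else 1) * (if i = l' then g x else 1))

theorem prod_coordFactor (f g : Ω → ℝ) (k l k' l' : Fin n) (y : Fin n → Ω) :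
    ∏ i, coordFactor f g k l k' l' i (y i) = f (y k) * f (y l) * (g (y k') * g (y l')) := by
  simp only [coordFactor, Finset.prod_mul_distrib]
  simp [Finset.prod_ite_eq']

end CoordFactor

variable {Ω : Type*} [MeasurableSpace Ω] {P : Measure Ω} [IsProbabilityMeasure P]

theorem integrable_coordFactor {f g : Ω → ℝ} (hf : Integrable f P) (hg : Integrable g P)
    (hfg : Integrable (fun x => f x * g x) P) {k l k' l' : Fin n} (hkl : k ≠ l) (hkl' : k' ≠ l')
    (i : Fin n) : Integrable (coordFactor f g k l k' l' i) P := by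
  have h1 : ∀ c : ℝ, Integrable (fun _ : Ω => c) P := fun c => integrable_const c
  unfold coordFactor
  by_cases a : i = k <;> by_cases b : i = l <;> by_cases c : i = k' <;> by_cases d : i = l' <;>
    simp only [a, b, c, d, if_true, if_false, mul_one] <;>
    first
      | exact absurd (a.symm.trans b) hkl
      | exact absurd (c.symm.trans d) hkl'
      | skip
  all_goals
    subst_vars
    simp_all

/-- Orthogonality of the terms of a degenerate `U`-statistic: the product of two of them is centred
unless they involve the same pair of observations. -/
theorem integral_coordFactor_prod {f g : Ω → ℝ} (hf : Integrable f P) (hg : Integrable g P)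
    (hfg : Integrable (fun x => f x * g x) P) (hf0 : ∫ x, f x ∂P = 0)
    {k l k' l' : Fin n} (hkl : k ≠ l) (hkl' : k' ≠ l') :
    Integrable (fun y : Fin n → Ω => f (y k) * f (y l) * (g (y k') * g (y l')))
      (Measure.pi fun _ => P) ∧
    ∫ y, f (y k) * f (y l) * (g (y k') * g (y l')) ∂(Measure.pi fun _ : Fin n => P) =
      (if k' = k ∧ l' = l then (∫ x, f x * g x ∂P) ^ 2 else 0) +
      (if k' = l ∧ l' = k then (∫ x, f x * g x ∂P) ^ 2 else 0) := by
  simp_rw [← prod_coordFactor]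
  refine ⟨Integrable.fintype_prod (integrable_coordFactor hf hg hfg hkl hkl'), ?_⟩
  rw [integral_fintype_prod_eq_prod]
  have hpair : ∀ (u v : Fin n) (c : ℝ), ∏ i : Fin n, ((if i = u then c else 1) *
      (if i = v then c else 1)) = c ^ 2 := fun u v c => by
    rw [Finset.prod_mul_distrib]; simp [sq]
  by_cases h1 : k' = k ∧ l' = l
  · obtain ⟨rfl, rfl⟩ := h1
    rw [if_pos ⟨rfl, rfl⟩, if_neg (fun h => hkl h.1), add_zero, ← hpair k' l']
    refine Finset.prod_congr rfl fun i _ => ?_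
    unfold coordFactor
    by_cases a : i = k'
    · subst a; simp [hkl]
    · by_cases b : i = l'
      · subst b; simp [a]
      · simp [a, b]
  by_cases h2 : k' = l ∧ l' = k
  · obtain ⟨rfl, rfl⟩ := h2
    rw [if_neg (fun h => hkl' h.1), if_pos ⟨rfl, rfl⟩, zero_add, ← hpair k' l']
    refine Finset.prod_congr rfl fun i _ => ?_
    unfold coordFactor
    by_cases a : i = k'
    · subst a; simp [hkl']
    · by_cases b : i = l'
      · subst b; simp [a]
      · simp [a, b]
  rw [if_neg h1, if_neg h2, add_zero]
  -- some coordinate carries a single factor `f`, whose mean vanishes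
  by_cases a : k = k' ∨ k = l'
  · have b1 : l ≠ k' := by rintro rfl; rcases a with h | h <;> simp_all
    have b2 : l ≠ l' := by rintro rfl; rcases a with h | h <;> simp_all
    refine Finset.prod_eq_zero (Finset.mem_univ l) ?_
    simp [coordFactor, hkl.symm, b1, b2, hf0]
  · push Not at a
    refine Finset.prod_eq_zero (Finset.mem_univ k) ?_
    simp [coordFactor, hkl, a.1, a.2, hf0]

variable {J : Finset ℕ} {ξ : ℕ → Ω → ℝ}

/-- The second moment of a completely degenerate quadratic `U`-statistic is bounded through the
squared Frobenius norm of the covariance matrix. -/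
theorem degenerate_second_moment (hξ : ∀ j, Integrable (ξ j) P)
    (hξ2 : ∀ i j, Integrable (fun x => ξ i x * ξ j x) P) (hξ0 : ∀ j ∈ J, ∫ x, ξ j x ∂P = 0) :
    Integrable (fun y : Fin n → Ω => (∑ k : Fin n, ∑ l ∈ Finset.univ.filter (fun l : Fin n => k ≠ l),
      ∑ j ∈ J, ξ j (y k) * ξ j (y l)) ^ 2) (Measure.pi fun _ => P) ∧
    ∫ y, (∑ k : Fin n, ∑ l ∈ Finset.univ.filter (fun l : Fin n => k ≠ l),
      ∑ j ∈ J, ξ j (y k) * ξ j (y l)) ^ 2 ∂(Measure.pi fun _ : Fin n => P) ≤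
      2 * (n : ℝ) ^ 2 * ∑ i ∈ J, ∑ j ∈ J, (∫ x, ξ i x * ξ j x ∂P) ^ 2 := by
  set I : Finset (Fin n × Fin n) := Finset.univ.filter (fun q => q.1 ≠ q.2) with hI
  have hsum : ∀ y : Fin n → Ω, (∑ k : Fin n, ∑ l ∈ Finset.univ.filter (fun l : Fin n => k ≠ l),
      ∑ j ∈ J, ξ j (y k) * ξ j (y l)) ^ 2 = ∑ q ∈ I, ∑ i ∈ J, ∑ q' ∈ I, ∑ j ∈ J,
        ξ i (y q.1) * ξ i (y q.2) * (ξ j (y q'.1) * ξ j (y q'.2)) := by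
    intro y
    have : ∑ k : Fin n, ∑ l ∈ Finset.univ.filter (fun l : Fin n => k ≠ l),
      ∑ j ∈ J, ξ j (y k) * ξ j (y l) = ∑ q ∈ I, ∑ j ∈ J, ξ j (y q.1) * ξ j (y q.2) := by
      rw [hI, Finset.sum_filter, Fintype.sum_prod_type]
      simp_rw [Finset.sum_filter]
    rw [this, sq]
    simp_rw [Finset.sum_mul, Finset.mul_sum]
  simp_rw [hsum]
  have hterm := fun (i j : ℕ) (hi : i ∈ J) (q q' : Fin n × Fin n) (hq : q ∈ I) (hq' : q' ∈ I) =>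
    integral_coordFactor_prod (hξ i) (hξ j) (hξ2 i j) (hξ0 i hi)
      (Finset.mem_filter.1 hq).2 (Finset.mem_filter.1 hq').2
  have i1 : ∀ q ∈ I, ∀ i ∈ J, ∀ q' ∈ I, Integrable (fun y : Fin n → Ω => ∑ j ∈ J,
      ξ i (y q.1) * ξ i (y q.2) * (ξ j (y q'.1) * ξ j (y q'.2))) (Measure.pi fun _ => P) :=
    fun q hq i hi q' hq' => integrable_finsetSum _ fun j _ => (hterm i j hi q q' hq hq').1
  have i2 : ∀ q ∈ I, ∀ i ∈ J, Integrable (fun y : Fin n → Ω => ∑ q' ∈ I, ∑ j ∈ J,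
      ξ i (y q.1) * ξ i (y q.2) * (ξ j (y q'.1) * ξ j (y q'.2))) (Measure.pi fun _ => P) :=
    fun q hq i hi => integrable_finsetSum _ (i1 q hq i hi)
  have i3 : ∀ q ∈ I, Integrable (fun y : Fin n → Ω => ∑ i ∈ J, ∑ q' ∈ I, ∑ j ∈ J,
      ξ i (y q.1) * ξ i (y q.2) * (ξ j (y q'.1) * ξ j (y q'.2))) (Measure.pi fun _ => P) :=
    fun q hq => integrable_finsetSum _ (i2 q hq)
  refine ⟨integrable_finsetSum _ i3, ?_⟩
  rw [integral_finsetSum _ i3]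
  have hle : ∀ q ∈ I, ∫ y, ∑ i ∈ J, ∑ q' ∈ I, ∑ j ∈ J,
      ξ i (y q.1) * ξ i (y q.2) * (ξ j (y q'.1) * ξ j (y q'.2)) ∂(Measure.pi fun _ : Fin n => P) ≤
      ∑ i ∈ J, ∑ j ∈ J, 2 * (∫ x, ξ i x * ξ j x ∂P) ^ 2 := by
    intro q hq
    rw [integral_finsetSum _ (i2 q hq)]
    refine Finset.sum_le_sum fun i hi => ?_
    rw [integral_finsetSum _ (i1 q hq i hi)]
    have h1 : ∀ q' ∈ I, ∫ y, ∑ j ∈ J, ξ i (y q.1) * ξ i (y q.2) * (ξ j (y q'.1) * ξ j (y q'.2))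
        ∂(Measure.pi fun _ : Fin n => P) = ∑ j ∈ J,
        ((if q' = q then (∫ x, ξ i x * ξ j x ∂P) ^ 2 else 0) +
          (if q' = q.swap then (∫ x, ξ i x * ξ j x ∂P) ^ 2 else 0)) := by
      intro q' hq'
      rw [integral_finsetSum _ fun j _ => (hterm i j hi q q' hq hq').1]
      refine Finset.sum_congr rfl fun j _ => ?_
      rw [(hterm i j hi q q' hq hq').2]
      simp [Prod.ext_iff]
    rw [Finset.sum_congr rfl h1, Finset.sum_comm]
    refine Finset.sum_le_sum fun j _ => ?_
    rw [Finset.sum_add_distrib, Finset.sum_ite_eq', Finset.sum_ite_eq']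
    have := sq_nonneg (∫ x, ξ i x * ξ j x ∂P)
    split_ifs <;> linarith
  refine (Finset.sum_le_sum hle).trans ?_
  rw [Finset.sum_const, nsmul_eq_mul]
  have hcard : (I.card : ℝ) ≤ (n : ℝ) ^ 2 := by
    have h := Finset.card_le_univ I
    simp only [Fintype.card_prod, Fintype.card_fin] at h
    rw [sq]; exact_mod_cast h
  have h2 : ∑ i ∈ J, ∑ j ∈ J, 2 * (∫ x, ξ i x * ξ j x ∂P) ^ 2 =
      2 * ∑ i ∈ J, ∑ j ∈ J, (∫ x, ξ i x * ξ j x ∂P) ^ 2 := by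
    simp_rw [Finset.mul_sum]
  rw [h2]
  have h3 : 0 ≤ ∑ i ∈ J, ∑ j ∈ J, (∫ x, ξ i x * ξ j x ∂P) ^ 2 :=
    Finset.sum_nonneg fun i _ => Finset.sum_nonneg fun j _ => sq_nonneg _
  nlinarith

/-- The second moment of the linear part of the Hoeffding decomposition. -/
theorem linear_second_moment (μ : ℕ → ℝ) (hξ : ∀ j, Integrable (ξ j) P)
    (hξ2 : ∀ i j, Integrable (fun x => ξ i x * ξ j x) P) (hξ0 : ∀ j ∈ J, ∫ x, ξ j x ∂P = 0) :
    Integrable (fun y : Fin n → Ω => (∑ k : Fin n, ∑ j ∈ J, μ j * ξ j (y k)) ^ 2)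
      (Measure.pi fun _ => P) ∧
    ∫ y, (∑ k : Fin n, ∑ j ∈ J, μ j * ξ j (y k)) ^ 2 ∂(Measure.pi fun _ : Fin n => P) =
      n * ∑ i ∈ J, ∑ j ∈ J, μ i * μ j * ∫ x, ξ i x * ξ j x ∂P := by
  set η : Ω → ℝ := fun x => ∑ j ∈ J, μ j * ξ j x with hη
  have hηi : Integrable η P := integrable_finsetSum _ fun j _ => (hξ j).const_mul _
  have hsq : (fun x => η x ^ 2) = fun x => ∑ i ∈ J, ∑ j ∈ J, μ i * μ j * (ξ i x * ξ j x) := by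
    funext x
    simp_rw [hη, sq, Finset.sum_mul, Finset.mul_sum]
    refine Finset.sum_congr rfl fun i _ => Finset.sum_congr rfl fun j _ => by ring
  have hint : ∀ i ∈ J, Integrable (fun x => ∑ j ∈ J, μ i * μ j * (ξ i x * ξ j x)) P := fun i _ =>
    integrable_finsetSum _ fun j _ => (hξ2 i j).const_mul _
  have hη2 : Integrable (fun x => η x ^ 2) P := by
    rw [hsq]; exact integrable_finsetSum _ hint
  have hmem : MemLp η 2 P := (memLp_two_iff_integrable_sq hηi.aestronglyMeasurable).2 hη2
  have hη0 : ∫ x, η x ∂P = 0 := by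
    rw [hη, integral_finsetSum _ fun j _ => (hξ j).const_mul _]
    exact Finset.sum_eq_zero fun j hj => by rw [integral_const_mul, hξ0 j hj, mul_zero]
  have hmemk : ∀ k : Fin n, MemLp (fun y : Fin n → Ω => η (y k)) 2 (Measure.pi fun _ => P) :=
    fun k => hmem.comp_measurePreserving (measurePreserving_eval (fun _ : Fin n => P) k)
  have hsummem : MemLp (fun y : Fin n → Ω => ∑ k, η (y k)) 2 (Measure.pi fun _ => P) :=
    memLp_finsetSum _ fun k _ => hmemk k
  refine ⟨hsummem.integrable_sq, ?_⟩
  have hv := variance_sum_pi (μ := fun _ : Fin n => P) (X := fun _ => η) (fun _ => hmem)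
  have hmean : ∫ y, (∑ k : Fin n, fun y : Fin n → Ω => η (y k)) y ∂(Measure.pi fun _ => P) = 0 := by
    simp only [Finset.sum_apply]
    rw [integral_finsetSum _ fun k _ => (hmemk k).integrable (by norm_num)]
    refine Finset.sum_eq_zero fun k _ => ?_
    rw [integral_comp_eval (μ := fun _ : Fin n => P) (f := η) hηi.aestronglyMeasurable, hη0]
  rw [variance_of_integral_eq_zero ?_ hmean] at hv
  · simp only [Finset.sum_apply] at hv
    rw [hv]
    have : Var[η; P] = ∑ i ∈ J, ∑ j ∈ J, μ i * μ j * ∫ x, ξ i x * ξ j x ∂P := by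
      rw [variance_of_integral_eq_zero hηi.aemeasurable hη0, hsq,
        integral_finsetSum _ hint]
      refine Finset.sum_congr rfl fun i _ => ?_
      rw [integral_finsetSum _ fun j _ => (hξ2 i j).const_mul _]
      simp_rw [integral_const_mul]
    simp [this]
  · have : (∑ k : Fin n, fun y : Fin n → Ω => η (y k)) = fun y => ∑ k, η (y k) := by
      funext y; simp
    rw [this]; exact hsummem.aestronglyMeasurable.aemeasurable

/-- Chebyshev's inequality for the quadratic `U`-statistic `∑_{k ≠ l} ⟨T(y_k), T(y_l)⟩`, via its
Hoeffding decomposition into a degenerate and a linear part. -/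
theorem ustat_chebyshev {T : ℕ → Ω → ℝ} (hT : ∀ j, Integrable (T j) P)
    (hT2 : ∀ i j, Integrable (fun x => T i x * T j x) P) {μ : ℕ → ℝ}
    (hμ : ∀ j ∈ J, ∫ x, T j x ∂P = μ j) {d : ℝ} (hd : 0 < d) :
    (Measure.pi fun _ : Fin n => P).real {y | d ≤ |(∑ k : Fin n,
      ∑ l ∈ Finset.univ.filter (fun l : Fin n => k ≠ l), ∑ j ∈ J, T j (y k) * T j (y l)) -
        n * (n - 1) * ∑ j ∈ J, μ j ^ 2|} ≤
      (4 * (n : ℝ) ^ 2 * ∑ i ∈ J, ∑ j ∈ J, (∫ x, (T i x - μ i) * (T j x - μ j) ∂P) ^ 2 +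
        8 * ((n : ℝ) - 1) ^ 2 * (n * ∑ i ∈ J, ∑ j ∈ J, μ i * μ j *
          ∫ x, (T i x - μ i) * (T j x - μ j) ∂P)) / d ^ 2 := by
  set ξ : ℕ → Ω → ℝ := fun j x => T j x - μ j
  have hξ : ∀ j, Integrable (ξ j) P := fun j => (hT j).sub (integrable_const _)
  have hξ2 : ∀ i j, Integrable (fun x => ξ i x * ξ j x) P := fun i j => by
    have := (((hT2 i j).sub ((hT i).const_mul (μ j))).sub ((hT j).const_mul (μ i))).add
      (integrable_const (μ i * μ j))
    refine this.congr (Eventually.of_forall fun x => ?_)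
    simp [ξ]; ring
  have hξ0 : ∀ j ∈ J, ∫ x, ξ j x ∂P = 0 := fun j hj => by
    simp only [ξ]
    rw [integral_sub (hT j) (integrable_const _), hμ j hj]; simp
  obtain ⟨a1, a2⟩ := degenerate_second_moment (n := n) hξ hξ2 hξ0
  obtain ⟨b1, b2⟩ := linear_second_moment (n := n) μ hξ hξ2 hξ0
  set U1 : (Fin n → Ω) → ℝ := fun y => ∑ k : Fin n,
    ∑ l ∈ Finset.univ.filter (fun l : Fin n => k ≠ l), ∑ j ∈ J, ξ j (y k) * ξ j (y l)
  set U2 : (Fin n → Ω) → ℝ := fun y => ∑ k : Fin n, ∑ j ∈ J, μ j * ξ j (y k)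
  -- the Hoeffding decomposition
  have hdec : ∀ y : Fin n → Ω, (∑ k : Fin n,
      ∑ l ∈ Finset.univ.filter (fun l : Fin n => k ≠ l), ∑ j ∈ J, T j (y k) * T j (y l)) -
        n * (n - 1) * ∑ j ∈ J, μ j ^ 2 = U1 y + 2 * (n - 1) * U2 y := by
    intro y
    have hoff : ∀ (g : Fin n → Fin n → ℝ) (k : Fin n),
        ∑ l ∈ Finset.univ.filter (fun l : Fin n => k ≠ l), g k l = ∑ l, g k l - g k k := by
      intro g k
      rw [Finset.filter_ne, Finset.sum_erase_eq_sub (Finset.mem_univ k)]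
    have hexp : ∀ k l : Fin n, ∑ j ∈ J, T j (y k) * T j (y l) =
        ∑ j ∈ J, ξ j (y k) * ξ j (y l) + ∑ j ∈ J, μ j * ξ j (y k) + ∑ j ∈ J, μ j * ξ j (y l)
          + ∑ j ∈ J, μ j ^ 2 := by
      intro k l
      simp_rw [← Finset.sum_add_distrib]
      refine Finset.sum_congr rfl fun j _ => ?_
      simp only [ξ]; ring
    have h1 : ∀ k, _ = _ := hoff (fun k l => ∑ j ∈ J, T j (y k) * T j (y l))
    have h2 : ∀ k, _ = _ := hoff (fun k l => ∑ j ∈ J, ξ j (y k) * ξ j (y l))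
    simp only [U1, U2]
    rw [Finset.sum_congr rfl fun k _ => h1 k, Finset.sum_congr rfl fun k _ => h2 k]
    simp only [hexp]
    simp only [Finset.sum_add_distrib, Finset.sum_sub_distrib, Finset.sum_const,
      Finset.card_univ, Fintype.card_fin, nsmul_eq_mul, ← Finset.mul_sum]
    ring
  have hint : Integrable (fun y => 2 * U1 y ^ 2 + 8 * ((n : ℝ) - 1) ^ 2 * U2 y ^ 2)
      (Measure.pi fun _ : Fin n => P) := (a1.const_mul 2).add (b1.const_mul _)
  have hmk := mul_meas_ge_le_integral_of_nonneg (μ := Measure.pi fun _ : Fin n => P)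
    (f := fun y => 2 * U1 y ^ 2 + 8 * ((n : ℝ) - 1) ^ 2 * U2 y ^ 2)
    (Eventually.of_forall fun y => by positivity) hint (d ^ 2)
  rw [integral_add (a1.const_mul 2) (b1.const_mul _), integral_const_mul, integral_const_mul,
    b2] at hmk
  rw [le_div_iff₀ (by positivity), mul_comm]
  refine le_trans (mul_le_mul_of_nonneg_left (measureReal_mono ?_) (by positivity))
    (hmk.trans ?_)
  · intro y hy
    simp only [Set.mem_ofPred_eq] at hy ⊢
    rw [hdec] at hy
    have h1 : d ^ 2 ≤ (U1 y + 2 * (n - 1) * U2 y) ^ 2 := by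
      rw [← sq_abs (U1 y + _)]; gcongr
    nlinarith [sq_nonneg (U1 y - 2 * (n - 1) * U2 y)]
  · simp only [ξ] at a2 ⊢
    linarith

end UStatistic

/-! ### Autocorrelations over the ellipsoid -/

/-- Sums over `ℤ` of an even function, bounded by twice the sum over the positive integers. -/
theorem sum_natAbs_le {f : ℕ → ℝ} (hf : ∀ j, 0 ≤ f j) (hs : Summable fun j => f (j + 1))
    (F : Finset ℤ) : ∑ r ∈ F, f r.natAbs ≤ f 0 + 2 * ∑' j, f (j + 1) := by
  have hhalf : ∀ G : Finset ℤ, (∀ r ∈ G, r ≠ 0) → Set.InjOn Int.natAbs G →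
      ∑ r ∈ G, f r.natAbs ≤ ∑' j, f (j + 1) := by
    intro G h0 hinj
    have hinj' : Set.InjOn (fun r : ℤ => r.natAbs - 1) G := by
      intro x hx y hy hxy
      have hx0 := h0 x hx
      have hy0 := h0 y hy
      refine hinj hx hy ?_
      simp only at hxy; omega
    have h1 : ∑ r ∈ G, f r.natAbs = ∑ j ∈ G.image (fun r : ℤ => r.natAbs - 1), f (j + 1) := by
      rw [Finset.sum_image hinj']
      refine Finset.sum_congr rfl fun r hr => ?_
      have := h0 r hr
      congr 1; omega
    rw [h1]
    exact hs.sum_le_tsum _ fun j _ => hf _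
  have hsplit : ∑ r ∈ F, f r.natAbs = ∑ r ∈ F.filter (fun r => r = 0), f r.natAbs +
      (∑ r ∈ F.filter (fun r => 0 < r), f r.natAbs +
        ∑ r ∈ F.filter (fun r => r < 0), f r.natAbs) := by
    simp only [Finset.sum_filter, ← Finset.sum_add_distrib]
    refine Finset.sum_congr rfl fun r _ => ?_
    rcases lt_trichotomy r 0 with h | h | h
    · simp [h, h.ne, h.le]
    · simp [h]
    · simp [h, h.ne', not_lt.2 h.le]
  have h1 := hhalf (F.filter fun r => 0 < r) (fun r hr => by
    have := (Finset.mem_filter.1 hr).2; omega) (fun x hx y hy h => by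
    have := (Finset.mem_filter.1 hx).2; have := (Finset.mem_filter.1 hy).2; omega)
  have h2 := hhalf (F.filter fun r => r < 0) (fun r hr => by
    have := (Finset.mem_filter.1 hr).2; omega) (fun x hx y hy h => by
    have := (Finset.mem_filter.1 hx).2; have := (Finset.mem_filter.1 hy).2; omega)
  have h3 : ∑ r ∈ F.filter (fun r => r = 0), f r.natAbs ≤ f 0 := by
    have : F.filter (fun r => r = 0) ⊆ {0} := fun r hr => by
      simpa using (Finset.mem_filter.1 hr).2
    refine (Finset.sum_le_sum_of_subset_of_nonneg this fun _ _ _ => hf _).trans ?_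
    simp
  rw [hsplit]; linarith

/-- The autocorrelation of `|σ|` at lag `d`, the sequence being extended to `ℤ` by symmetry and the
sum being restricted to `R`. -/
def absConv (σ : ℕ → ℝ) (R : Finset ℤ) (d : ℤ) : ℝ :=
  ∑ r ∈ R, |σ r.natAbs| * |σ (r - d).natAbs|

theorem absConv_nonneg (σ : ℕ → ℝ) (R : Finset ℤ) (d : ℤ) : 0 ≤ absConv σ R d :=
  Finset.sum_nonneg fun _ _ => by positivity

/-- Autocorrelations of elements of `𝒯(α)` are square summable, uniformly over `𝒯(α)`, as soon as
`α > 1/4`: by the Cauchy-Schwarz inequality with weights `|r|^α |r - d|^α`. -/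
theorem exists_sum_absConv_sq_le {α : ℝ} (hα : 1 / 4 < α) :
    ∃ Z : ℝ, 0 < Z ∧ ∀ σ ∈ toeplitzEllipsoid α, ∀ R D : Finset ℤ,
      ∑ d ∈ D, absConv σ R d ^ 2 ≤ Z := by
  -- the weight sequence is `1` at the origin
  set ω : ℕ → ℝ := fun j => max 1 (j : ℝ) with hω
  have hω1 : ∀ j, 0 < ω j := fun j => lt_max_of_lt_left one_pos
  have hωs : ∀ j : ℕ, ω (j + 1) = (j : ℝ) + 1 := fun j => by
    simp only [hω]; push_cast; exact max_eq_right (by linarith [(Nat.cast_nonneg j : (0:ℝ) ≤ j)])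
  have hsum4 : Summable fun j : ℕ => ω (j + 1) ^ (-(4 * α)) := by
    have h := (summable_nat_add_iff 1).2 (Real.summable_nat_rpow.2 (by linarith : -(4 * α) < -1))
    refine h.congr fun j => ?_
    rw [hωs]; push_cast; rfl
  set Z0 : ℝ := ω 0 ^ (-(4 * α)) + 2 * ∑' j : ℕ, ω (j + 1) ^ (-(4 * α)) with hZ0
  have hZ0pos : 0 < Z0 := by
    have h1 : 0 < ω 0 ^ (-(4 * α)) := Real.rpow_pos_of_pos (hω1 0) _
    have h2 : 0 ≤ ∑' j : ℕ, ω (j + 1) ^ (-(4 * α)) :=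
      tsum_nonneg fun j => (Real.rpow_pos_of_pos (hω1 _) _).le
    rw [hZ0]; linarith
  have hZ : ∀ F : Finset ℤ, ∑ r ∈ F, ω r.natAbs ^ (-(4 * α)) ≤ Z0 := fun F =>
    sum_natAbs_le (f := fun j => ω j ^ (-(4 * α))) (fun j => (Real.rpow_pos_of_pos (hω1 _) _).le)
      hsum4 F
  refine ⟨9 * Z0, by linarith, fun σ hσ R D => ?_⟩
  obtain ⟨-, hσ0, hσs, hσle⟩ := hσ
  set V : ℕ → ℝ := fun j => σ j ^ 2 * ω j ^ (2 * α) with hV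
  have hV0 : ∀ j, 0 ≤ V j := fun j => mul_nonneg (sq_nonneg _) (Real.rpow_pos_of_pos (hω1 _) _).le
  have hVs : (fun j => V (j + 1)) =
      fun j : ℕ => σ (j + 1) ^ 2 * ((j : ℝ) + 1) ^ (2 * α) := by
    funext j; simp only [hV, hωs]
  have hVF : ∀ F : Finset ℤ, ∑ r ∈ F, V r.natAbs ≤ 3 := fun F => by
    have h := sum_natAbs_le hV0 (by rw [hVs]; exact hσs) F
    rw [hVs] at h
    have h0 : V 0 = 1 := by simp [hV, hσ0, hω]
    linarith
  have hshift : ∀ (g : ℕ → ℝ) (c : ℝ), (∀ F : Finset ℤ, ∑ r ∈ F, g r.natAbs ≤ c) →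
      ∀ (F : Finset ℤ) (e : ℤ → ℤ), Function.Injective e → ∑ r ∈ F, g (e r).natAbs ≤ c := by
    intro g c hg F e he
    have := hg (F.image e)
    rwa [Finset.sum_image fun x _ y _ h => he h] at this
  have hterm : ∀ d : ℤ, absConv σ R d ^ 2 ≤
      (∑ r ∈ R, V r.natAbs * V (r - d).natAbs) * Z0 := by
    intro d
    have hcs := Finset.sum_mul_sq_le_sq_mul_sq R
      (fun r => (|σ r.natAbs| * ω r.natAbs ^ α) * (|σ (r - d).natAbs| * ω (r - d).natAbs ^ α))
      (fun r => ω r.natAbs ^ (-α) * ω (r - d).natAbs ^ (-α))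
    have hpow : ∀ j, ω j ^ α * ω j ^ (-α) = 1 := fun j => by
      rw [← Real.rpow_add (hω1 j)]; simp
    have hsqα : ∀ j, (ω j ^ α) ^ 2 = ω j ^ (2 * α) := fun j => by
      rw [mul_comm, Real.rpow_mul (hω1 j).le]; exact (Real.rpow_natCast _ 2).symm
    have hsqα' : ∀ j, ((ω j ^ (-α)) ^ 2) ^ 2 = ω j ^ (-(4 * α)) := fun j => by
      rw [← pow_mul, ← Real.rpow_natCast, ← Real.rpow_mul (hω1 j).le]
      congr 1; push_cast; ring
    have e1 : ∑ r ∈ R, ((|σ r.natAbs| * ω r.natAbs ^ α) * (|σ (r - d).natAbs| *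
        ω (r - d).natAbs ^ α)) * (ω r.natAbs ^ (-α) * ω (r - d).natAbs ^ (-α)) = absConv σ R d := by
      refine Finset.sum_congr rfl fun r _ => ?_
      linear_combination (|σ r.natAbs| * |σ (r - d).natAbs| *
        (ω (r - d).natAbs ^ α * ω (r - d).natAbs ^ (-α))) * hpow r.natAbs +
        (|σ r.natAbs| * |σ (r - d).natAbs|) * hpow (r - d).natAbs
    have e2 : ∑ r ∈ R, ((|σ r.natAbs| * ω r.natAbs ^ α) * (|σ (r - d).natAbs| *
        ω (r - d).natAbs ^ α)) ^ 2 = ∑ r ∈ R, V r.natAbs * V (r - d).natAbs := by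
      refine Finset.sum_congr rfl fun r _ => ?_
      simp only [hV, mul_pow, sq_abs, hsqα]
    rw [e1, e2] at hcs
    refine hcs.trans (mul_le_mul_of_nonneg_left ?_
      (Finset.sum_nonneg fun r _ => mul_nonneg (hV0 _) (hV0 _)))
    have hle : ∀ r ∈ R, (ω r.natAbs ^ (-α) * ω (r - d).natAbs ^ (-α)) ^ 2 ≤
        (1 / 2) * ω r.natAbs ^ (-(4 * α)) + (1 / 2) * ω (r - d).natAbs ^ (-(4 * α)) := by
      intro r _
      rw [← hsqα', ← hsqα', mul_pow]
      nlinarith [sq_nonneg ((ω r.natAbs ^ (-α)) ^ 2 - (ω (r - d).natAbs ^ (-α)) ^ 2)]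
    refine (Finset.sum_le_sum hle).trans ?_
    rw [Finset.sum_add_distrib, ← Finset.mul_sum, ← Finset.mul_sum]
    have h1 := hZ R
    have h2 := hshift (fun j => ω j ^ (-(4 * α))) Z0 hZ R (fun r => r - d)
      (sub_left_injective)
    linarith
  calc ∑ d ∈ D, absConv σ R d ^ 2
      ≤ ∑ d ∈ D, (∑ r ∈ R, V r.natAbs * V (r - d).natAbs) * Z0 :=
        Finset.sum_le_sum fun d _ => hterm d
    _ = (∑ r ∈ R, V r.natAbs * ∑ d ∈ D, V (r - d).natAbs) * Z0 := by
        rw [← Finset.sum_mul, Finset.sum_comm]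
        simp_rw [Finset.mul_sum]
    _ ≤ (∑ r ∈ R, V r.natAbs * 3) * Z0 := by
        gcongr with r hr
        exact hshift V 3 hVF D (fun d => r - d) (sub_right_injective)
    _ ≤ (3 * 3) * Z0 := by
        rw [← Finset.sum_mul]
        gcongr
        exact hVF R
    _ = 9 * Z0 := by ring

/-! ### Moments of the diagonal sums -/

section Moments

variable {p m : ℕ} (a : unitInterval) {σ : ℕ → ℝ}

theorem toeplitzSection_lag {j : ℕ} (i : Fin p) (hj : j ≤ i) (h : (i : ℕ) - j < p) :
    toeplitzSection σ p i ⟨(i : ℕ) - j, h⟩ = σ j := by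
  simp only [toeplitzSection, Matrix.of_apply]
  congr 1; omega

theorem lag_ne {j : ℕ} (hj1 : 1 ≤ j) (i : Fin p) (hj : j ≤ i) (h : (i : ℕ) - j < p) :
    i ≠ ⟨(i : ℕ) - j, h⟩ := fun e => by
  have := congrArg Fin.val e
  simp only at this; omega

theorem integrable_prod_obs {S : Matrix (Fin p) (Fin p) ℝ} (hS : S.PosSemidef) (i j : Fin p) :
    Integrable (fun y : Fin p → ℝ => y i * y j) (observationLaw a S) := by
  have h := (observation_four_moment a hS i j i j).1
  have h2 : MemLp (fun y : Fin p → ℝ => y i * y j) 2 (observationLaw a S) := by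
    refine (memLp_two_iff_integrable_sq (by fun_prop)).2 (h.congr (Eventually.of_forall fun y => ?_))
    simp only; ring
  exact h2.integrable (by norm_num)

theorem integrable_diagonalSum {S : Matrix (Fin p) (Fin p) ℝ} (hS : S.PosSemidef) (j : ℕ) :
    Integrable (diagonalSum (p := p) m j) (observationLaw a S) :=
  integrable_finsetSum _ fun _ _ => integrable_prod_obs a hS _ _

theorem integrable_diagonalSum_mul {S : Matrix (Fin p) (Fin p) ℝ} (hS : S.PosSemidef) (j j' : ℕ) :
    Integrable (fun y => diagonalSum (p := p) m j y * diagonalSum m j' y)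
      (observationLaw a S) := by
  simp only [diagonalSum, Finset.sum_mul, Finset.mul_sum]
  refine integrable_finsetSum _ fun i _ => integrable_finsetSum _ fun i' _ => ?_
  exact (observation_four_moment a hS i' ⟨(i' : ℕ) - j, _⟩ i ⟨(i : ℕ) - j', _⟩).1.congr
    (Eventually.of_forall fun y => by simp only; ring)

theorem card_filter_le_val :
    (Finset.univ.filter (fun i : Fin p => m ≤ (i : ℕ))).card = p - m := by
  have h : (Finset.univ.filter (fun i : Fin p => m ≤ (i : ℕ))).map Fin.valEmbedding =
      Finset.Ico m p := by
    ext x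
    simp only [Finset.mem_map, Finset.mem_filter, Finset.mem_univ, true_and, Finset.mem_Ico,
      Fin.valEmbedding_apply]
    exact ⟨fun ⟨i, hi, e⟩ => e ▸ ⟨hi, i.2⟩, fun h => ⟨⟨x, h.2⟩, h.1, rfl⟩⟩
  rw [← Finset.card_map, h, Nat.card_Ico]

theorem integral_diagonalSum (hS : (toeplitzSection σ p).PosSemidef) (hmp : m ≤ p) {j : ℕ}
    (hj : j ∈ Finset.Icc 1 m) :
    ∫ y, diagonalSum m j y ∂(observationLaw a (toeplitzSection σ p)) =
      ((p : ℝ) - m) * (a : ℝ) ^ 2 * σ j := by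
  rw [Finset.mem_Icc] at hj
  unfold diagonalSum
  rw [integral_finsetSum _ fun i _ => integrable_prod_obs a hS _ _]
  have : ∀ i ∈ Finset.univ.filter (fun i : Fin p => m ≤ (i : ℕ)),
      ∫ y : Fin p → ℝ, y i * y ⟨(i : ℕ) - j, (Nat.sub_le _ _).trans_lt i.isLt⟩
        ∂(observationLaw a (toeplitzSection σ p)) = (a : ℝ) ^ 2 * σ j := by
    intro i hi
    have hji : j ≤ i := hj.2.trans (Finset.mem_filter.1 hi).2
    rw [observation_two_moment a hS (lag_ne hj.1 i hji _), toeplitzSection_lag i hji]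
  rw [Finset.sum_congr rfl this, Finset.sum_const, card_filter_le_val, nsmul_eq_mul,
    Nat.cast_sub hmp]
  ring

/-- The covariance of `Y_i Y_{i-j}` and `Y_{i'} Y_{i'-j'}`. The first two terms of the bound are the
products of covariances of Isserlis' formula; the last one accounts for coincidences between the two
pairs of coordinates, which raise the probability that all of them are observed. -/
theorem abs_cov_products_le (hS : (toeplitzSection σ p).PosSemidef) {j j' : ℕ}
    (hj : j ∈ Finset.Icc 1 m) (hj' : j' ∈ Finset.Icc 1 m) {i i' : Fin p} (hi : m ≤ (i : ℕ))
    (hi' : m ≤ (i' : ℕ)) (h : (i : ℕ) - j < p) (h' : (i' : ℕ) - j' < p) :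
    |∫ y : Fin p → ℝ, y i * y ⟨(i : ℕ) - j, h⟩ * y i' * y ⟨(i' : ℕ) - j', h'⟩
        ∂(observationLaw a (toeplitzSection σ p)) - (a : ℝ) ^ 4 * (σ j * σ j')| ≤
      (a : ℝ) ^ 2 * (|σ ((i : ℤ) - i').natAbs| * |σ ((i : ℤ) - i' - ((j : ℤ) - j')).natAbs| +
        |σ ((i : ℤ) - i' + j').natAbs| * |σ ((i : ℤ) - i' + j' - ((j : ℤ) + j')).natAbs| +
        ((if (i' : ℕ) = i then 1 else 0) + (if (i' : ℕ) + j = i then 1 else 0) +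
          (if (i' : ℕ) = i + j' then 1 else 0) + (if (i' : ℕ) + j = i + j' then 1 else 0)) *
          (|σ j| * |σ j'|)) := by
  rw [Finset.mem_Icc] at hj hj'
  rw [(observation_four_moment a hS _ _ _ _).2, toeplitzSection_lag i (hj.2.trans hi),
    toeplitzSection_lag i' (hj'.2.trans hi')]
  have ha0 : (0 : ℝ) ≤ a := a.2.1
  have ha1 : (a : ℝ) ≤ 1 := a.2.2
  set q : Fin p := ⟨(i : ℕ) - j, h⟩ with hq
  set q' : Fin p := ⟨(i' : ℕ) - j', h'⟩ with hq'
  have e1 : toeplitzSection σ p i i' = σ ((i : ℤ) - i').natAbs := rfl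
  have e2 : toeplitzSection σ p q q' = σ ((i : ℤ) - i' - ((j : ℤ) - j')).natAbs := by
    simp only [toeplitzSection, Matrix.of_apply, hq, hq']; congr 1; omega
  have e3 : toeplitzSection σ p i q' = σ ((i : ℤ) - i' + j').natAbs := by
    simp only [toeplitzSection, Matrix.of_apply, hq']; congr 1; omega
  have e4 : toeplitzSection σ p q i' = σ ((i : ℤ) - i' + j' - ((j : ℤ) + j')).natAbs := by
    simp only [toeplitzSection, Matrix.of_apply, hq]; congr 1; omega
  rw [e1, e2, e3, e4]
  set c : ℕ := ({i, q, i', q'} : Finset (Fin p)).card with hc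
  have hiq : i ≠ q := lag_ne hj.1 i (hj.2.trans hi) h
  have hiq' : i' ≠ q' := lag_ne hj'.1 i' (hj'.2.trans hi') h'
  have hc2 : 2 ≤ c := by
    rw [hc, ← Finset.card_pair hiq]
    exact Finset.card_le_card (by intro x; simp; tauto)
  have hac : (a : ℝ) ^ c ≤ (a : ℝ) ^ 2 := pow_le_pow_of_le_one ha0 ha1 hc2
  have hac0 : 0 ≤ (a : ℝ) ^ c := pow_nonneg ha0 _
  have ha4 : (a : ℝ) ^ 4 ≤ (a : ℝ) ^ 2 := pow_le_pow_of_le_one ha0 ha1 (by norm_num)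
  have ha40 : 0 ≤ (a : ℝ) ^ 4 := pow_nonneg ha0 _
  set X : ℝ := σ ((i : ℤ) - i').natAbs
  set Y : ℝ := σ ((i : ℤ) - i' - ((j : ℤ) - j')).natAbs
  set X' : ℝ := σ ((i : ℤ) - i' + j').natAbs
  set Y' : ℝ := σ ((i : ℤ) - i' + j' - ((j : ℤ) + j')).natAbs
  set κ : ℝ := ((if (i' : ℕ) = i then 1 else 0) + (if (i' : ℕ) + j = i then 1 else 0) +
          (if (i' : ℕ) = i + j' then 1 else 0) + (if (i' : ℕ) + j = i + j' then 1 else 0)) with hκ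
  -- `κ` counts the coincidences; without any, four distinct coordinates are involved
  have hdiff : |(a : ℝ) ^ c - (a : ℝ) ^ 4| ≤ (a : ℝ) ^ 2 * κ := by
    by_cases hdist : (i' : ℕ) = i ∨ (i' : ℕ) + j = i ∨ (i' : ℕ) = i + j' ∨ (i' : ℕ) + j = i + j'
    · have hκ1 : 1 ≤ κ := by
        rcases hdist with e | e | e | e <;> rw [hκ] <;> simp only [e, if_true] <;>
          split_ifs <;> norm_num
      have : |(a : ℝ) ^ c - (a : ℝ) ^ 4| ≤ (a : ℝ) ^ 2 := by
        rw [abs_le]; constructor <;> linarith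
      nlinarith [sq_nonneg (a : ℝ)]
    · push Not at hdist
      have hc4 : c = 4 := by
        have n1 : i ≠ i' := fun e => hdist.1 (by rw [e])
        have n2 : q ≠ i' := fun e => hdist.2.1 (by
          have := congrArg Fin.val e; simp only [hq] at this; omega)
        have n3 : i ≠ q' := fun e => hdist.2.2.1 (by
          have := congrArg Fin.val e; simp only [hq'] at this; omega)
        have n4 : q ≠ q' := fun e => hdist.2.2.2 (by
          have := congrArg Fin.val e; simp only [hq, hq'] at this; omega)
        rw [hc, Finset.card_insert_of_notMem (by simp [hiq, n1, n3]),
          Finset.card_insert_of_notMem (by simp [n2, n4]), Finset.card_pair hiq']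
      have hκ0 : 0 ≤ κ := by rw [hκ]; split_ifs <;> norm_num
      rw [hc4]; simp; positivity
  calc |(a : ℝ) ^ c * (σ j * σ j' + X * Y + X' * Y') - (a : ℝ) ^ 4 * (σ j * σ j')|
      = |(a : ℝ) ^ c * (X * Y) + (a : ℝ) ^ c * (X' * Y') +
          ((a : ℝ) ^ c - (a : ℝ) ^ 4) * (σ j * σ j')| := by congr 1; ring
    _ ≤ |(a : ℝ) ^ c * (X * Y)| + |(a : ℝ) ^ c * (X' * Y')| +
          |((a : ℝ) ^ c - (a : ℝ) ^ 4) * (σ j * σ j')| := abs_add_three _ _ _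
    _ = (a : ℝ) ^ c * (|X| * |Y|) + (a : ℝ) ^ c * (|X'| * |Y'|) +
          |(a : ℝ) ^ c - (a : ℝ) ^ 4| * (|σ j| * |σ j'|) := by
        simp only [abs_mul, abs_of_nonneg hac0]
    _ ≤ (a : ℝ) ^ 2 * (|X| * |Y|) + (a : ℝ) ^ 2 * (|X'| * |Y'|) +
          ((a : ℝ) ^ 2 * κ) * (|σ j| * |σ j'|) := by gcongr
    _ = _ := by ring

/-- The covariances of the diagonal sums are controlled by the autocorrelations of `|σ|` at lags
`j - j'` and `j + j'`: for fixed `i`, the sum over `i'` of the bounds of `abs_cov_products_le` is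
an autocorrelation, and the terms `|σ_j| |σ_{j'}|` due to coincidences are single terms of the
autocorrelation at lag `j - j'`. -/
theorem abs_cov_diagonalSum_le (hS : (toeplitzSection σ p).PosSemidef) (hmp : m ≤ p) {j j' : ℕ}
    (hj : j ∈ Finset.Icc 1 m) (hj' : j' ∈ Finset.Icc 1 m) :
    |∫ y, (diagonalSum m j y - ((p : ℝ) - m) * (a : ℝ) ^ 2 * σ j) *
        (diagonalSum m j' y - ((p : ℝ) - m) * (a : ℝ) ^ 2 * σ j')
        ∂(observationLaw a (toeplitzSection σ p))| ≤
      (a : ℝ) ^ 2 * p * (5 * absConv σ (Finset.Icc (-(2 * p : ℤ)) (2 * p)) ((j : ℤ) - j') +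
        absConv σ (Finset.Icc (-(2 * p : ℤ)) (2 * p)) ((j : ℤ) + j')) := by
  set P := observationLaw a (toeplitzSection σ p)
  set R : Finset ℤ := Finset.Icc (-(2 * p : ℤ)) (2 * p)
  set I := Finset.univ.filter (fun i : Fin p => m ≤ (i : ℕ)) with hI
  set μ : ℕ → ℝ := fun j => ((p : ℝ) - m) * (a : ℝ) ^ 2 * σ j
  have hm1 := Finset.mem_Icc.1 hj
  have hm1' := Finset.mem_Icc.1 hj'
  have hcard : (I.card : ℝ) = (p : ℝ) - m := by
    rw [hI, card_filter_le_val, Nat.cast_sub hmp]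
  -- the covariance is the double sum of the covariances of the products
  have hcov : ∫ y, (diagonalSum m j y - μ j) * (diagonalSum m j' y - μ j') ∂P =
      ∑ i ∈ I, ∑ i' ∈ I, (∫ y : Fin p → ℝ, y i * y ⟨(i : ℕ) - j, (Nat.sub_le _ _).trans_lt i.isLt⟩ *
        y i' * y ⟨(i' : ℕ) - j', (Nat.sub_le _ _).trans_lt i'.isLt⟩ ∂P -
          (a : ℝ) ^ 4 * (σ j * σ j')) := by
    have h1 : ∫ y, (diagonalSum m j y - μ j) * (diagonalSum m j' y - μ j') ∂P =
        ∫ y, diagonalSum m j y * diagonalSum m j' y ∂P - μ j * μ j' := by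
      have hi1 := integrable_diagonalSum (m := m) a hS j
      have hi2 := integrable_diagonalSum (m := m) a hS j'
      have hi12 := integrable_diagonalSum_mul (m := m) a hS j j'
      have e : (fun y => (diagonalSum (p := p) m j y - μ j) * (diagonalSum m j' y - μ j')) =
          fun y => (diagonalSum m j y * diagonalSum m j' y - μ j' * diagonalSum m j y) -
            (μ j * diagonalSum m j' y - μ j * μ j') := by
        funext y; ring
      have s1 : Integrable (fun y => diagonalSum m j y * diagonalSum m j' y -
          μ j' * diagonalSum m j y) P := hi12.sub (hi1.const_mul _)
      have s2 : Integrable (fun y => μ j * diagonalSum m j' y - μ j * μ j') P :=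
        (hi2.const_mul _).sub (integrable_const _)
      rw [e, integral_sub s1 s2,
        integral_sub hi12 (hi1.const_mul _), integral_sub (hi2.const_mul _) (integrable_const _),
        integral_const_mul, integral_const_mul, integral_diagonalSum a hS hmp hj,
        integral_diagonalSum a hS hmp hj']
      simp only [integral_const, probReal_univ, smul_eq_mul, one_mul, μ]
      ring
    have h2 : ∫ y, diagonalSum m j y * diagonalSum m j' y ∂P = ∑ i ∈ I, ∑ i' ∈ I,
        ∫ y : Fin p → ℝ, y i * y ⟨(i : ℕ) - j, (Nat.sub_le _ _).trans_lt i.isLt⟩ *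
        y i' * y ⟨(i' : ℕ) - j', (Nat.sub_le _ _).trans_lt i'.isLt⟩ ∂P := by
      have e : (fun y => diagonalSum (p := p) m j y * diagonalSum m j' y) = fun y =>
          ∑ i ∈ I, ∑ i' ∈ I, y i * y ⟨(i : ℕ) - j, (Nat.sub_le _ _).trans_lt i.isLt⟩ *
            y i' * y ⟨(i' : ℕ) - j', (Nat.sub_le _ _).trans_lt i'.isLt⟩ := by
        funext y
        simp only [diagonalSum, Finset.sum_mul, Finset.mul_sum]
        rw [Finset.sum_comm]
        refine Finset.sum_congr rfl fun i _ => Finset.sum_congr rfl fun i' _ => by ring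
      rw [e, integral_finsetSum _ fun i _ => integrable_finsetSum _ fun i' _ =>
        (observation_four_moment a hS _ _ _ _).1]
      refine Finset.sum_congr rfl fun i _ => ?_
      rw [integral_finsetSum _ fun i' _ => (observation_four_moment a hS _ _ _ _).1]
    rw [h1, h2]
    simp only [Finset.sum_sub_distrib, Finset.sum_const, nsmul_eq_mul, hcard, μ]
    ring
  rw [hcov]
  have hrow : ∀ i ∈ I, ∑ i' ∈ I, |∫ y : Fin p → ℝ,
      y i * y ⟨(i : ℕ) - j, (Nat.sub_le _ _).trans_lt i.isLt⟩ *
        y i' * y ⟨(i' : ℕ) - j', (Nat.sub_le _ _).trans_lt i'.isLt⟩ ∂P -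
          (a : ℝ) ^ 4 * (σ j * σ j')| ≤
      (a : ℝ) ^ 2 * (5 * absConv σ R ((j : ℤ) - j') + absConv σ R ((j : ℤ) + j')) := by
    intro i hi
    have hi2 := i.2
    have him := (Finset.mem_filter.1 hi).2
    refine (Finset.sum_le_sum fun i' hi' => abs_cov_products_le a hS hj hj'
      him (Finset.mem_filter.1 hi').2 _ _).trans ?_
    rw [← Finset.mul_sum, Finset.sum_add_distrib, Finset.sum_add_distrib, ← Finset.sum_mul]
    refine mul_le_mul_of_nonneg_left ?_ (sq_nonneg _)
    have s1 : ∑ i' ∈ I, |σ ((i : ℤ) - i').natAbs| * |σ ((i : ℤ) - i' - ((j : ℤ) - j')).natAbs| ≤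
        absConv σ R ((j : ℤ) - j') := by
      unfold absConv
      rw [← Finset.sum_image (g := fun i' : Fin p => (i : ℤ) - i')
        (f := fun r => |σ r.natAbs| * |σ (r - ((j : ℤ) - j')).natAbs|)
        (fun x _ y _ h => by simp only at h; exact Fin.ext (by omega))]
      refine Finset.sum_le_sum_of_subset_of_nonneg ?_ fun _ _ _ => by positivity
      intro r hr
      obtain ⟨i', -, rfl⟩ := Finset.mem_image.1 hr
      have := i'.2
      simp only [R, Finset.mem_Icc]; omega
    have s2 : ∑ i' ∈ I, |σ ((i : ℤ) - i' + j').natAbs| *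
        |σ ((i : ℤ) - i' + j' - ((j : ℤ) + j')).natAbs| ≤ absConv σ R ((j : ℤ) + j') := by
      unfold absConv
      rw [← Finset.sum_image (g := fun i' : Fin p => (i : ℤ) - i' + j')
        (f := fun r => |σ r.natAbs| * |σ (r - ((j : ℤ) + j')).natAbs|)
        (fun x _ y _ h => by simp only at h; exact Fin.ext (by omega))]
      refine Finset.sum_le_sum_of_subset_of_nonneg ?_ fun _ _ _ => by positivity
      intro r hr
      obtain ⟨i', -, rfl⟩ := Finset.mem_image.1 hr
      have := i'.2
      simp only [R, Finset.mem_Icc]; omega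
    have s3 : |σ j| * |σ j'| ≤ absConv σ R ((j : ℤ) - j') := by
      unfold absConv
      have : |σ j| * |σ j'| = |σ ((j : ℤ)).natAbs| * |σ ((j : ℤ) - ((j : ℤ) - j')).natAbs| := by
        simp
      rw [this]
      exact Finset.single_le_sum (f := fun r : ℤ => |σ r.natAbs| * |σ (r - ((j : ℤ) - j')).natAbs|)
        (fun _ _ => by positivity) (by simp only [R, Finset.mem_Icc]; omega)
    have hone : ∀ Q : Fin p → Prop, ∀ [DecidablePred Q], (∀ x y, Q x → Q y → x = y) →
        ∑ i' ∈ I, (if Q i' then (1 : ℝ) else 0) ≤ 1 := by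
      intro Q _ hQ
      rw [Finset.sum_boole]
      have : (I.filter Q).card ≤ 1 := Finset.card_le_one.2 fun x hx y hy =>
        hQ x y (Finset.mem_filter.1 hx).2 (Finset.mem_filter.1 hy).2
      exact_mod_cast this
    have s4 : ∑ i' ∈ I, (((if (i' : ℕ) = i then (1 : ℝ) else 0) +
        (if (i' : ℕ) + j = i then 1 else 0) + (if (i' : ℕ) = i + j' then 1 else 0)) +
          (if (i' : ℕ) + j = i + j' then 1 else 0)) ≤ 4 := by
      simp only [Finset.sum_add_distrib]
      have t1 := hone (fun x => (x : ℕ) = i) fun x y hx hy => Fin.ext (by omega)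
      have t2 := hone (fun x => (x : ℕ) + j = i) fun x y hx hy => Fin.ext (by omega)
      have t3 := hone (fun x => (x : ℕ) = i + j') fun x y hx hy => Fin.ext (by omega)
      have t4 := hone (fun x => (x : ℕ) + j = i + j') fun x y hx hy => Fin.ext (by omega)
      linarith
    have s5 := mul_le_mul s4 s3 (by positivity) (by norm_num)
    linarith
  refine (Finset.abs_sum_le_sum_abs _ _).trans
    ((Finset.sum_le_sum fun i hi => (Finset.abs_sum_le_sum_abs _ _).trans (hrow i hi)).trans ?_)
  rw [Finset.sum_const, nsmul_eq_mul, hcard]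
  have hw1 := absConv_nonneg σ R ((j : ℤ) - j')
  have hw2 := absConv_nonneg σ R ((j : ℤ) + j')
  have hpm : (p : ℝ) - m ≤ p := by linarith [(Nat.cast_nonneg m : (0:ℝ) ≤ m)]
  have h0 : 0 ≤ (a : ℝ) ^ 2 * (5 * absConv σ R ((j : ℤ) - j') + absConv σ R ((j : ℤ) + j')) := by
    positivity
  calc _ ≤ (p : ℝ) * ((a : ℝ) ^ 2 * (5 * absConv σ R ((j : ℤ) - j') +
        absConv σ R ((j : ℤ) + j'))) := mul_le_mul_of_nonneg_right hpm h0
    _ = _ := by ring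

end Moments

/-- The squared Frobenius norm of the covariance matrix of the diagonal sums has, uniformly over
`𝒯(α)`, the same order `a⁴ p² m` as under the null hypothesis. -/
theorem exists_frobenius_cov_le {α : ℝ} (hα : 1 / 4 < α) :
    ∃ Z : ℝ, 0 < Z ∧ ∀ σ ∈ toeplitzEllipsoid α, ∀ (a : unitInterval) (m p : ℕ), m ≤ p →
      ∑ i ∈ Finset.Icc 1 m, ∑ j ∈ Finset.Icc 1 m,
        (∫ y, (diagonalSum m i y - ((p : ℝ) - m) * (a : ℝ) ^ 2 * σ i) *
          (diagonalSum m j y - ((p : ℝ) - m) * (a : ℝ) ^ 2 * σ j)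
          ∂(observationLaw a (toeplitzSection σ p))) ^ 2 ≤ Z * (a : ℝ) ^ 4 * (p : ℝ) ^ 2 * m := by
  obtain ⟨Z, hZ, hconv⟩ := exists_sum_absConv_sq_le hα
  refine ⟨52 * Z, by linarith, fun σ hσ a m p hmp => ?_⟩
  set R : Finset ℤ := Finset.Icc (-(2 * p : ℤ)) (2 * p)
  have hS := (hσ.1 p).posSemidef
  have hrow : ∀ i ∈ Finset.Icc 1 m, ∑ j ∈ Finset.Icc 1 m,
        (∫ y, (diagonalSum m i y - ((p : ℝ) - m) * (a : ℝ) ^ 2 * σ i) *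
          (diagonalSum m j y - ((p : ℝ) - m) * (a : ℝ) ^ 2 * σ j)
          ∂(observationLaw a (toeplitzSection σ p))) ^ 2 ≤ 52 * Z * (a : ℝ) ^ 4 * (p : ℝ) ^ 2 := by
    intro i hi
    have h1 : ∀ j ∈ Finset.Icc 1 m,
        (∫ y, (diagonalSum m i y - ((p : ℝ) - m) * (a : ℝ) ^ 2 * σ i) *
          (diagonalSum m j y - ((p : ℝ) - m) * (a : ℝ) ^ 2 * σ j)
          ∂(observationLaw a (toeplitzSection σ p))) ^ 2 ≤
        ((a : ℝ) ^ 2 * p) ^ 2 * (50 * absConv σ R ((i : ℤ) - j) ^ 2 +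
          2 * absConv σ R ((i : ℤ) + j) ^ 2) := by
      intro j hj
      have h := abs_cov_diagonalSum_le a hS hmp hi hj
      rw [← sq_abs]
      refine (pow_le_pow_left₀ (abs_nonneg _) h 2).trans ?_
      rw [mul_pow]
      refine mul_le_mul_of_nonneg_left ?_ (sq_nonneg _)
      nlinarith [sq_nonneg (5 * absConv σ R ((i : ℤ) - j) - absConv σ R ((i : ℤ) + j))]
    refine (Finset.sum_le_sum h1).trans ?_
    rw [← Finset.mul_sum, Finset.sum_add_distrib, ← Finset.mul_sum, ← Finset.mul_sum]
    have h2 : ∑ j ∈ Finset.Icc 1 m, absConv σ R ((i : ℤ) - j) ^ 2 ≤ Z := by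
      rw [← Finset.sum_image (g := fun j : ℕ => (i : ℤ) - j) (f := fun d => absConv σ R d ^ 2)
        (fun x _ y _ h => by simp only at h; omega)]
      exact hconv σ hσ R _
    have h3 : ∑ j ∈ Finset.Icc 1 m, absConv σ R ((i : ℤ) + j) ^ 2 ≤ Z := by
      rw [← Finset.sum_image (g := fun j : ℕ => (i : ℤ) + j) (f := fun d => absConv σ R d ^ 2)
        (fun x _ y _ h => by simp only at h; omega)]
      exact hconv σ hσ R _
    calc _ ≤ ((a : ℝ) ^ 2 * p) ^ 2 * (50 * Z + 2 * Z) := by gcongr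
      _ = _ := by ring
  refine (Finset.sum_le_sum hrow).trans (le_of_eq ?_)
  rw [Finset.sum_const, Nat.card_Icc, nsmul_eq_mul]
  simp; ring

/-! ### The two error probabilities -/

theorem measurable_statistic {n p : ℕ} (m : ℕ) : Measurable (statistic (n := n) (p := p) m) := by
  unfold statistic diagonalSum; fun_prop

theorem summable_sq_of_mem {α : ℝ} (hα : 0 ≤ α) {σ : ℕ → ℝ} (hσ : σ ∈ toeplitzEllipsoid α) :
    Summable fun j : ℕ => σ (j + 1) ^ 2 := by
  refine Summable.of_nonneg_of_le (fun j => sq_nonneg _) (fun j => ?_) hσ.2.2.1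
  have : (1 : ℝ) ≤ ((j : ℝ) + 1) ^ (2 * α) :=
    Real.one_le_rpow (by linarith [(Nat.cast_nonneg j : (0:ℝ) ≤ j)]) (by linarith)
  nlinarith [sq_nonneg (σ (j + 1))]

/-- The first `m` diagonals carry all but `m^{-2α}` of the energy of an element of `𝒯(α)`. -/
theorem tsum_sq_sub_le_sum {α : ℝ} (hα : 0 < α) {σ : ℕ → ℝ} (hσ : σ ∈ toeplitzEllipsoid α) {m : ℕ}
    (hm : 1 ≤ m) :
    ∑' j : ℕ, σ (j + 1) ^ 2 - (m : ℝ) ^ (-(2 * α)) ≤ ∑ j ∈ Finset.Icc 1 m, σ j ^ 2 := by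
  have hs := summable_sq_of_mem hα.le hσ
  have hm0 : (0 : ℝ) < m := by exact_mod_cast hm
  have hfin : ∑ j ∈ Finset.Icc 1 m, σ j ^ 2 =
      ∑' j : ℕ, if j < m then σ (j + 1) ^ 2 else 0 := by
    rw [tsum_eq_sum (s := Finset.range m) (fun j hj => by
      rw [Finset.mem_range] at hj; simp [hj])]
    rw [Finset.sum_congr (s₁ := Finset.range m) rfl (g := fun j => σ (j + 1) ^ 2) (fun j hj => by
      rw [if_pos (Finset.mem_range.1 hj)])]
    rw [Finset.range_eq_Ico, Finset.sum_Ico_add' (fun j => σ j ^ 2) 0 m 1]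
    rfl
  have hsfin : Summable fun j : ℕ => if j < m then σ (j + 1) ^ 2 else 0 :=
    summable_of_hasFiniteSupport ((Finset.range m).finite_toSet.subset fun j hj => by
      by_contra h
      simp only [Finset.coe_range, Set.mem_Iio] at h
      simp [h] at hj)
  have hle : ∀ j : ℕ, σ (j + 1) ^ 2 ≤ (if j < m then σ (j + 1) ^ 2 else 0) +
      (m : ℝ) ^ (-(2 * α)) * (σ (j + 1) ^ 2 * ((j : ℝ) + 1) ^ (2 * α)) := by
    intro j
    have hj0 : (0 : ℝ) ≤ j := Nat.cast_nonneg j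
    have hp1 : 0 ≤ (m : ℝ) ^ (-(2 * α)) * (σ (j + 1) ^ 2 * ((j : ℝ) + 1) ^ (2 * α)) := by
      positivity
    split_ifs with h
    · linarith
    · have hmj : (m : ℝ) ≤ (j : ℝ) + 1 := by
        have : (m : ℝ) ≤ j := by exact_mod_cast not_lt.1 h
        linarith
      have h1 : 1 ≤ (m : ℝ) ^ (-(2 * α)) * ((j : ℝ) + 1) ^ (2 * α) := by
        rw [Real.rpow_neg hm0.le, inv_mul_eq_div, one_le_div (by positivity)]
        exact Real.rpow_le_rpow hm0.le hmj (by linarith)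
      nlinarith [sq_nonneg (σ (j + 1))]
  have h := Summable.tsum_le_tsum hle hs (hsfin.add (hσ.2.2.1.mul_left _))
  rw [hsfin.tsum_add (hσ.2.2.1.mul_left _), tsum_mul_left, ← hfin] at h
  have h2 : (m : ℝ) ^ (-(2 * α)) * ∑' j : ℕ, σ (j + 1) ^ 2 * ((j : ℝ) + 1) ^ (2 * α) ≤
      (m : ℝ) ^ (-(2 * α)) * 1 := mul_le_mul_of_nonneg_left hσ.2.2.2 (by positivity)
  linarith

theorem toeplitzSection_identity (p : ℕ) :
    toeplitzSection (fun j => if j = 0 then 1 else 0) p = 1 := by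
  ext i j
  simp only [toeplitzSection, Matrix.of_apply, Matrix.one_apply]
  congr 1
  rw [Fin.ext_iff, eq_iff_iff]; omega

theorem identity_mem_ellipsoid (α : ℝ) :
    (fun j : ℕ => if j = 0 then (1 : ℝ) else 0) ∈ toeplitzEllipsoid α := by
  refine ⟨fun p => ?_, by simp, by simp [summable_zero], by simp⟩
  rw [toeplitzSection_identity]; exact Matrix.PosDef.one

theorem statistic_eq {n p : ℕ} (m : ℕ) (y : Sample n p) :
    statistic m y = (∑ k : Fin n, ∑ l ∈ Finset.univ.filter (fun l : Fin n => k ≠ l),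
      ∑ j ∈ Finset.Icc 1 m, diagonalSum m j (y k) * diagonalSum m j (y l)) /
        ((n : ℝ) * ((n : ℝ) - 1) * ((p : ℝ) - (m : ℝ)) ^ 2 * √(2 * (m : ℝ))) := by
  unfold statistic
  rw [div_eq_mul_inv _ ((n : ℝ) * _ * _ * _), mul_inv, one_div, one_div, mul_comm]

/-- Chebyshev's inequality for the unnormalized statistic, in terms of the energy of the first `m`
diagonals. -/
theorem exists_chebyshev_statistic {α : ℝ} (hα : 1 / 4 < α) :
    ∃ Z : ℝ, 0 < Z ∧ ∀ σ ∈ toeplitzEllipsoid α, ∀ (a : unitInterval) (n m p : ℕ), 2 ≤ n → m ≤ p →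
      ∀ d : ℝ, 0 < d →
      (sampleLaw n a (toeplitzSection σ p)).real {y | d ≤ |(∑ k : Fin n,
        ∑ l ∈ Finset.univ.filter (fun l : Fin n => k ≠ l), ∑ j ∈ Finset.Icc 1 m,
          diagonalSum m j (y k) * diagonalSum m j (y l)) -
        n * (n - 1) * (((p : ℝ) - m) ^ 2 * (a : ℝ) ^ 4 * ∑ j ∈ Finset.Icc 1 m, σ j ^ 2)|} ≤
      (4 * (n : ℝ) ^ 2 * (Z ^ 2 * (a : ℝ) ^ 4 * (p : ℝ) ^ 2 * m) +
        8 * ((n : ℝ) - 1) ^ 2 * (n * ((((p : ℝ) - m) ^ 2 * (a : ℝ) ^ 4 *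
          ∑ j ∈ Finset.Icc 1 m, σ j ^ 2) * (Z * (a : ℝ) ^ 2 * p * √m)))) / d ^ 2 := by
  obtain ⟨Z, hZ, hF⟩ := exists_frobenius_cov_le hα
  refine ⟨√Z, Real.sqrt_pos.2 hZ, fun σ hσ a n m p hn hmp d hd => ?_⟩
  -- the quadratic form of the covariance matrix is bounded by its Frobenius norm
  have hS := (hσ.1 p).posSemidef
  set μ : ℕ → ℝ := fun j => ((p : ℝ) - m) * (a : ℝ) ^ 2 * σ j with hμ
  have hch := ustat_chebyshev (P := observationLaw a (toeplitzSection σ p)) (n := n)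
    (J := Finset.Icc 1 m) (T := fun j => diagonalSum m j)
    (fun j => integrable_diagonalSum a hS j) (fun i j => integrable_diagonalSum_mul a hS i j)
    (μ := μ) (fun j hj => integral_diagonalSum a hS hmp hj) hd
  have hμsq : ∑ j ∈ Finset.Icc 1 m, μ j ^ 2 =
      ((p : ℝ) - m) ^ 2 * (a : ℝ) ^ 4 * ∑ j ∈ Finset.Icc 1 m, σ j ^ 2 := by
    rw [Finset.mul_sum]
    refine Finset.sum_congr rfl fun j _ => ?_
    simp only [hμ]; ring
  rw [hμsq] at hch
  refine hch.trans ?_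
  have hFb := hF σ hσ a m p hmp
  set C : ℕ → ℕ → ℝ := fun i j => ∫ y, (diagonalSum m i y - μ i) * (diagonalSum m j y - μ j)
    ∂(observationLaw a (toeplitzSection σ p))
  have hquad : ∑ i ∈ Finset.Icc 1 m, ∑ j ∈ Finset.Icc 1 m, μ i * μ j * C i j ≤
      (∑ j ∈ Finset.Icc 1 m, μ j ^ 2) * (√Z * (a : ℝ) ^ 2 * p * √m) := by
    have hcs := Finset.sum_mul_sq_le_sq_mul_sq (Finset.Icc 1 m ×ˢ Finset.Icc 1 m)
      (fun q => μ q.1 * μ q.2) (fun q => C q.1 q.2)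
    rw [Finset.sum_product, Finset.sum_product, Finset.sum_product] at hcs
    have e : ∑ x ∈ Finset.Icc 1 m, ∑ y ∈ Finset.Icc 1 m, (μ x * μ y) ^ 2 =
        (∑ j ∈ Finset.Icc 1 m, μ j ^ 2) ^ 2 := by
      rw [sq, Finset.sum_mul_sum]
      simp_rw [mul_pow]
    simp only at hcs
    rw [e] at hcs
    have hs0 : 0 ≤ ∑ j ∈ Finset.Icc 1 m, μ j ^ 2 := Finset.sum_nonneg fun _ _ => sq_nonneg _
    refine le_of_sq_le_sq ?_ (by positivity)
    refine hcs.trans ?_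
    rw [mul_pow]
    refine mul_le_mul_of_nonneg_left (hFb.trans (le_of_eq ?_)) (sq_nonneg _)
    rw [mul_pow, mul_pow, mul_pow, Real.sq_sqrt hZ.le, Real.sq_sqrt (Nat.cast_nonneg m)]
    ring
  rw [hμsq] at hquad
  have hFb' : ∑ i ∈ Finset.Icc 1 m, ∑ j ∈ Finset.Icc 1 m, C i j ^ 2 ≤
      √Z ^ 2 * (a : ℝ) ^ 4 * (p : ℝ) ^ 2 * m := by rw [Real.sq_sqrt hZ.le]; exact hFb
  gcongr

/-- Under the null hypothesis the mean of the statistic vanishes, and its standard deviation is of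
the order `a² / (n p)`. -/
theorem exists_type_one_le {α : ℝ} (hα : 1 / 4 < α) :
    ∃ C : ℝ, 0 < C ∧ ∀ (a : unitInterval) (n m p : ℕ) (t : ℝ), 0 < (a : ℝ) → 2 ≤ n → 1 ≤ m →
      2 * m ≤ p → 0 < t →
      (sampleLaw n a (1 : Matrix (Fin p) (Fin p) ℝ)).real {y | t < statistic m y} ≤
        C / ((n : ℝ) * p * t / (a : ℝ) ^ 2) ^ 2 := by
  obtain ⟨Z, hZ, hch⟩ := exists_chebyshev_statistic hα
  refine ⟨128 * Z ^ 2, by positivity, fun a n m p t ha hn hm hmp ht => ?_⟩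
  have hn' : (2 : ℝ) ≤ n := by exact_mod_cast hn
  have hm' : (1 : ℝ) ≤ m := by exact_mod_cast hm
  have hmp' : 2 * (m : ℝ) ≤ p := by exact_mod_cast hmp
  have hsq : 0 < √(2 * (m : ℝ)) := Real.sqrt_pos.2 (by linarith)
  set c : ℝ := (n : ℝ) * ((n : ℝ) - 1) * ((p : ℝ) - (m : ℝ)) ^ 2 * √(2 * (m : ℝ)) with hc
  have h1 : 0 < (n : ℝ) - 1 := by linarith
  have h2 : 0 < (p : ℝ) - m := by linarith
  have hc0 : 0 < c := by positivity
  have h := hch _ (identity_mem_ellipsoid α) a n m p hn (by omega) (t * c) (by positivity)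
  rw [toeplitzSection_identity] at h
  have hz : ∑ j ∈ Finset.Icc 1 m, (if j = 0 then (1 : ℝ) else 0) ^ 2 = 0 :=
    Finset.sum_eq_zero fun j hj => by
      rw [if_neg (by have := (Finset.mem_Icc.1 hj).1; omega)]; simp
  rw [hz] at h
  simp only [mul_zero, sub_zero, zero_mul, add_zero] at h
  refine (measureReal_mono fun y hy => ?_).trans (h.trans ?_)
  · simp only [Set.mem_ofPred_eq] at hy ⊢
    rw [statistic_eq, lt_div_iff₀ hc0] at hy
    exact hy.le.trans (le_abs_self _)
  · have hclow : (n : ℝ) ^ 2 * (p : ℝ) ^ 2 * √(2 * (m : ℝ)) / 8 ≤ c := by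
      have e1 : (n : ℝ) / 2 ≤ n - 1 := by linarith
      have e2 : (p : ℝ) / 2 ≤ p - m := by linarith
      calc (n : ℝ) ^ 2 * (p : ℝ) ^ 2 * √(2 * (m : ℝ)) / 8 =
          (n : ℝ) * ((n : ℝ) / 2) * ((p : ℝ) / 2) ^ 2 * √(2 * (m : ℝ)) := by ring
        _ ≤ c := by rw [hc]; gcongr
    have hp0 : (0 : ℝ) < p := by linarith
    have hsqrt : √(2 * (m : ℝ)) ^ 2 = 2 * m := Real.sq_sqrt (by linarith)
    calc 4 * (n : ℝ) ^ 2 * (Z ^ 2 * (a : ℝ) ^ 4 * (p : ℝ) ^ 2 * m) / (t * c) ^ 2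
        ≤ 4 * (n : ℝ) ^ 2 * (Z ^ 2 * (a : ℝ) ^ 4 * (p : ℝ) ^ 2 * m) /
          (t * ((n : ℝ) ^ 2 * (p : ℝ) ^ 2 * √(2 * (m : ℝ)) / 8)) ^ 2 := by gcongr
      _ = _ := by
          have : (t * ((n : ℝ) ^ 2 * (p : ℝ) ^ 2 * √(2 * (m : ℝ)) / 8)) ^ 2 =
            t ^ 2 * n ^ 4 * p ^ 4 * √(2 * (m : ℝ)) ^ 2 / 64 := by ring
          rw [this, hsqrt]
          field_simp
          ring

/-- Under the alternative, the statistic deviates from its mean by a fixed proportion `ε` with small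
probability once `a² n p` times the normalized energy of the first `m` diagonals is large. -/
theorem exists_type_two_le {α : ℝ} (hα : 1 / 4 < α) :
    ∃ C : ℝ, 0 < C ∧ ∀ σ ∈ toeplitzEllipsoid α, ∀ (a : unitInterval) (n m p : ℕ) (t ε : ℝ),
      0 < (a : ℝ) → 2 ≤ n → 1 ≤ m → 2 * m ≤ p → 0 < ε → 0 < ∑ j ∈ Finset.Icc 1 m, σ j ^ 2 →
      t ≤ (1 - ε) * ((a : ℝ) ^ 4 * (∑ j ∈ Finset.Icc 1 m, σ j ^ 2) / √(2 * (m : ℝ))) →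
      (sampleLaw n a (toeplitzSection σ p)).real {y | statistic m y ≤ t} ≤
        C / ε ^ 2 * (1 / ((a : ℝ) ^ 2 * n * p * ((∑ j ∈ Finset.Icc 1 m, σ j ^ 2) / √m)) ^ 2 +
          1 / ((a : ℝ) ^ 2 * n * p * ((∑ j ∈ Finset.Icc 1 m, σ j ^ 2) / √m))) := by
  obtain ⟨Z, hZ, hch⟩ := exists_chebyshev_statistic hα
  refine ⟨256 * Z ^ 2 + 32 * Z, by positivity, fun σ hσ a n m p t ε ha hn hm hmp hε hs ht => ?_⟩
  set s := ∑ j ∈ Finset.Icc 1 m, σ j ^ 2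
  have hn' : (2 : ℝ) ≤ n := by exact_mod_cast hn
  have hm' : (1 : ℝ) ≤ m := by exact_mod_cast hm
  have hmp' : 2 * (m : ℝ) ≤ p := by exact_mod_cast hmp
  have hp0 : (0 : ℝ) < p := by linarith
  have hsq : 0 < √(2 * (m : ℝ)) := Real.sqrt_pos.2 (by linarith)
  have hsqm : 0 < √(m : ℝ) := Real.sqrt_pos.2 (by linarith)
  set c : ℝ := (n : ℝ) * ((n : ℝ) - 1) * ((p : ℝ) - (m : ℝ)) ^ 2 * √(2 * (m : ℝ)) with hc
  have h1 : 0 < (n : ℝ) - 1 := by linarith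
  have h2 : 0 < (p : ℝ) - m := by linarith
  have hc0 : 0 < c := by positivity
  set M : ℝ := (n : ℝ) * (n - 1) * (((p : ℝ) - m) ^ 2 * (a : ℝ) ^ 4 * s) with hM
  have hM0 : 0 < M := by positivity
  have h := hch σ hσ a n m p hn (by omega) (ε * M) (by positivity)
  refine (measureReal_mono fun y hy => ?_).trans (h.trans ?_)
  · simp only [Set.mem_ofPred_eq] at hy ⊢
    rw [statistic_eq, div_le_iff₀ hc0] at hy
    have hMc : ((a : ℝ) ^ 4 * s / √(2 * (m : ℝ))) * c = M := by
      rw [hc, hM]; field_simp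
    have h3 : t * c ≤ (1 - ε) * M := by
      calc t * c ≤ (1 - ε) * ((a : ℝ) ^ 4 * s / √(2 * (m : ℝ))) * c := by gcongr
        _ = _ := by rw [mul_assoc, hMc]
    rw [abs_sub_comm]
    refine le_trans ?_ (le_abs_self _)
    linarith
  · have e1 : (n : ℝ) / 2 ≤ n - 1 := by linarith
    have e2 : (p : ℝ) / 2 ≤ p - m := by linarith
    have hM1 : (n : ℝ) * ((n : ℝ) / 2) * (((p : ℝ) / 2) ^ 2 * (a : ℝ) ^ 4 * s) ≤ M := by
      rw [hM]; gcongr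
    set Q : ℝ := (a : ℝ) ^ 2 * n * p * (s / √m) with hQ
    have hQ0 : 0 < Q := by positivity
    have hsm : √(m : ℝ) ^ 2 = m := Real.sq_sqrt (by linarith)
    have t1 : 4 * (n : ℝ) ^ 2 * (Z ^ 2 * (a : ℝ) ^ 4 * (p : ℝ) ^ 2 * m) / (ε * M) ^ 2 ≤
        256 * Z ^ 2 / ε ^ 2 * (1 / Q ^ 2) := by
      calc _ ≤ 4 * (n : ℝ) ^ 2 * (Z ^ 2 * (a : ℝ) ^ 4 * (p : ℝ) ^ 2 * m) /
            (ε * ((n : ℝ) * ((n : ℝ) / 2) * (((p : ℝ) / 2) ^ 2 * (a : ℝ) ^ 4 * s))) ^ 2 := by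
            gcongr
        _ = _ := by
            have hQ2 : Q ^ 2 = (a : ℝ) ^ 4 * n ^ 2 * p ^ 2 * s ^ 2 / m := by
              rw [hQ]
              calc ((a : ℝ) ^ 2 * n * p * (s / √m)) ^ 2 =
                  (a : ℝ) ^ 4 * n ^ 2 * p ^ 2 * s ^ 2 / √(m : ℝ) ^ 2 := by ring
                _ = _ := by rw [hsm]
            rw [hQ2]
            field_simp
            ring
    have t2 : 8 * ((n : ℝ) - 1) ^ 2 * (n * ((((p : ℝ) - m) ^ 2 * (a : ℝ) ^ 4 * s) *
        (Z * (a : ℝ) ^ 2 * p * √m))) / (ε * M) ^ 2 ≤ 32 * Z / ε ^ 2 * (1 / Q) := by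
      calc _ = 8 * Z * √m * p / (ε ^ 2 * n * ((p : ℝ) - m) ^ 2 * (a : ℝ) ^ 2 * s) := by
            rw [hM]; field_simp
        _ ≤ 8 * Z * √m * p / (ε ^ 2 * n * ((p : ℝ) / 2) ^ 2 * (a : ℝ) ^ 2 * s) := by gcongr
        _ = _ := by rw [hQ]; field_simp; ring
    rw [add_div _ _ ((ε * M) ^ 2)]
    calc _ ≤ 256 * Z ^ 2 / ε ^ 2 * (1 / Q ^ 2) + 32 * Z / ε ^ 2 * (1 / Q) := add_le_add t1 t2
      _ ≤ (256 * Z ^ 2 + 32 * Z) / ε ^ 2 * (1 / Q ^ 2) +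
          (256 * Z ^ 2 + 32 * Z) / ε ^ 2 * (1 / Q) := by
          have l1 : 256 * Z ^ 2 ≤ 256 * Z ^ 2 + 32 * Z := by linarith
          have l2 : 32 * Z ≤ 256 * Z ^ 2 + 32 * Z := by linarith [sq_nonneg Z]
          have hε2 : 0 ≤ ε ^ 2 := by positivity
          have r1 : 0 ≤ 1 / Q ^ 2 := by positivity
          have r2 : 0 ≤ 1 / Q := by positivity
          exact add_le_add
            (mul_le_mul_of_nonneg_right (div_le_div_of_nonneg_right l1 hε2) r1)
            (mul_le_mul_of_nonneg_right (div_le_div_of_nonneg_right l2 hε2) r2)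
      _ = _ := by ring

/-- On the allowed range of `u = m^α φ`, the normalized mean of the statistic exceeds the threshold
constant by a fixed proportion. In the borderline case `κ = B` this uses that the two bounds
`u ≥ D` and `u ≤ K^{-2α}` cannot both be attained. -/
theorem exists_threshold_slack {α D K κ : ℝ} (hα : 0 < α) (hD : 1 < D) (hK : 0 < K)
    (hDK : D ≤ K ^ (-(2 * α))) (hκ : κ ≤ thresholdConst D K)
    (hκ' : D = K ^ (-(2 * α)) → κ < thresholdConst D K) :
    ∃ G ε : ℝ, 0 < G ∧ 0 < ε ∧ ε ≤ 1 ∧ κ ≤ (1 - ε) * (G / √2) ∧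
      ∀ u, D ≤ u → u ≤ K ^ (-(2 * α)) → G ≤ u ^ (-(1 / (2 * α))) * (1 - (u ^ 2)⁻¹) := by
  set g : ℝ → ℝ := fun u => u ^ (-(1 / (2 * α))) * (1 - (u ^ 2)⁻¹) with hg
  have hcont : ContinuousOn g (Set.Icc D (K ^ (-(2 * α)))) := by
    intro u hu
    have hu0 : u ≠ 0 := by linarith [hu.1]
    refine ContinuousAt.continuousWithinAt ?_
    exact (Real.continuousAt_rpow_const u _ (Or.inl hu0)).mul
      (continuousAt_const.sub ((continuousAt_id.pow 2).inv₀ (pow_ne_zero 2 hu0)))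
  obtain ⟨u, hu, hmin⟩ := isCompact_Icc.exists_isMinOn (Set.nonempty_Icc.2 hDK) hcont
  have hu0 : 0 < u := by linarith [hu.1]
  have hs2 : 0 < √(2 : ℝ) := Real.sqrt_pos.2 two_pos
  have hKpow : (K ^ (-(2 * α))) ^ (-(1 / (2 * α))) = K := by
    rw [← Real.rpow_mul hK.le]
    have : -(2 * α) * -(1 / (2 * α)) = 1 := by field_simp
    rw [this, Real.rpow_one]
  have hneg : -(1 / (2 * α)) < 0 := by
    have : 0 < 1 / (2 * α) := by positivity
    linarith
  have hf1 : K ≤ u ^ (-(1 / (2 * α))) := by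
    conv_lhs => rw [← hKpow]
    exact Real.rpow_le_rpow_of_nonpos hu0 hu.2 hneg.le
  have hDpos : (D ^ 2)⁻¹ < 1 := inv_lt_one_of_one_lt₀ (by nlinarith)
  have hf2 : 1 - (D ^ 2)⁻¹ ≤ 1 - (u ^ 2)⁻¹ := by
    have : (u ^ 2)⁻¹ ≤ (D ^ 2)⁻¹ := by
      have := hu.1
      gcongr
    linarith
  have hG0 : 0 < g u := mul_pos (by linarith) (by linarith)
  have hlt : κ < g u / √2 := by
    have hB : thresholdConst D K = K * (1 - (D ^ 2)⁻¹) / √2 := by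
      unfold thresholdConst; ring
    rcases hu.1.eq_or_lt with h | h
    · rcases hDK.eq_or_lt with h' | h'
      · refine (hκ' h').trans_le ?_
        rw [hB]
        refine div_le_div_of_nonneg_right ?_ hs2.le
        exact mul_le_mul hf1 hf2 (by linarith) (by linarith)
      · refine hκ.trans_lt ?_
        rw [hB]
        refine div_lt_div_of_pos_right ?_ hs2
        refine mul_lt_mul ?_ hf2 (by linarith) (by linarith)
        conv_lhs => rw [← hKpow]
        exact Real.rpow_lt_rpow_of_neg hu0 (by rw [← h]; exact h') hneg
    · refine hκ.trans_lt ?_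
      rw [hB]
      refine div_lt_div_of_pos_right ?_ hs2
      refine mul_lt_mul' hf1 ?_ (by linarith) (by linarith)
      have : (u ^ 2)⁻¹ < (D ^ 2)⁻¹ := by gcongr
      linarith
  have hGs : 0 < g u / √2 := by positivity
  refine ⟨g u, 1 - max κ 0 / (g u / √2), hG0, ?_, ?_, ?_, fun v hv1 hv2 => hmin ⟨hv1, hv2⟩⟩
  · have : max κ 0 / (g u / √2) < 1 := (div_lt_one hGs).2 (max_lt hlt hGs)
    linarith
  · have : 0 ≤ max κ 0 / (g u / √2) := by positivity
    linarith
  · have : (1 - (1 - max κ 0 / (g u / √2))) * (g u / √2) = max κ 0 := by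
      field_simp; ring
    rw [this]; exact le_max_left _ _

/-! ### Consistency of the test -/

theorem toeplitzTest_eq_one_iff {n p m : ℕ} {t : ℝ} {y : Sample n p} :
    toeplitzTest m t y = 1 ↔ t < statistic m y := by
  unfold toeplitzTest; split_ifs with h <;> simp_all

theorem toeplitzTest_eq_zero_iff {n p m : ℕ} {t : ℝ} {y : Sample n p} :
    toeplitzTest m t y = 0 ↔ statistic m y ≤ t := by
  unfold toeplitzTest; split_ifs with h <;> simp_all

theorem measurable_toeplitzTest {n p : ℕ} (m : ℕ) (t : ℝ) :
    Measurable (toeplitzTest (n := n) (p := p) m t) := by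
  unfold toeplitzTest
  exact Measurable.ite (measurableSet_lt measurable_const (measurable_statistic m))
    measurable_const measurable_const

/-- The energy of the first `m` diagonals, in the normalization of the statistic: with
`u = m^α φ` it is at least `φ² - m^{-2α} = φ² (1 - u⁻²)`, while
`m^{-1/2} = φ^{1/(2α)} u^{-1/(2α)}`. -/
theorem energy_lower_bound {α φ G : ℝ} (hα : 0 < α) (hφ : 0 < φ) {m : ℕ} (hm : 1 ≤ m)
    (hG : G ≤ ((m : ℝ) ^ α * φ) ^ (-(1 / (2 * α))) * (1 - (((m : ℝ) ^ α * φ) ^ 2)⁻¹))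
    {σ : ℕ → ℝ} (hσ : σ ∈ toeplitzAlternative α φ) :
    G * φ ^ (2 + 1 / (2 * α)) ≤ (∑ j ∈ Finset.Icc 1 m, σ j ^ 2) / √m := by
  have hm0 : (0 : ℝ) < m := by exact_mod_cast hm
  have h1 := tsum_sq_sub_le_sum hα hσ.1 hm
  have h2 := hσ.2
  have hinv : ((((m : ℝ) ^ α * φ)) ^ 2)⁻¹ * φ ^ 2 = (m : ℝ) ^ (-(2 * α)) := by
    have : (m : ℝ) ^ (2 * α) = ((m : ℝ) ^ α) ^ 2 := by
      rw [mul_comm, Real.rpow_mul hm0.le]; exact Real.rpow_natCast _ 2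
    rw [Real.rpow_neg hm0.le, this, mul_pow]
    field_simp
  have hroot : (√(m : ℝ))⁻¹ = φ ^ (1 / (2 * α)) * ((m : ℝ) ^ α * φ) ^ (-(1 / (2 * α))) := by
    rw [Real.mul_rpow (by positivity) hφ.le, ← Real.rpow_mul hm0.le]
    have e1 : α * -(1 / (2 * α)) = -(1 / 2) := by field_simp
    rw [e1, Real.rpow_neg hm0.le, ← Real.sqrt_eq_rpow, Real.rpow_neg hφ.le]
    have : φ ^ (1 / (2 * α)) ≠ 0 := (Real.rpow_pos_of_pos hφ _).ne'
    field_simp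
  have hpow : φ ^ (2 + 1 / (2 * α)) = φ ^ 2 * φ ^ (1 / (2 * α)) := by
    rw [Real.rpow_add hφ]; norm_num
  rw [div_eq_mul_inv _ (√(m : ℝ)), hroot, hpow]
  have hpos : 0 ≤ φ ^ (1 / (2 * α)) * ((m : ℝ) ^ α * φ) ^ (-(1 / (2 * α))) := by positivity
  calc G * (φ ^ 2 * φ ^ (1 / (2 * α)))
      ≤ (((m : ℝ) ^ α * φ) ^ (-(1 / (2 * α))) * (1 - (((m : ℝ) ^ α * φ) ^ 2)⁻¹)) *
          (φ ^ 2 * φ ^ (1 / (2 * α))) := mul_le_mul_of_nonneg_right hG (by positivity)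
    _ = (φ ^ 2 - (((m : ℝ) ^ α * φ) ^ 2)⁻¹ * φ ^ 2) *
          (φ ^ (1 / (2 * α)) * ((m : ℝ) ^ α * φ) ^ (-(1 / (2 * α)))) := by ring
    _ ≤ _ := by
        refine mul_le_mul_of_nonneg_right ?_ hpos
        rw [hinv]; linarith

theorem upper_bound {α : ℝ} (hα : 1 / 4 < α) {n p : ℕ → ℕ} {a : ℕ → unitInterval}
    (ha : ∀ N, 0 < (a N : ℝ)) (hn : Tendsto n atTop atTop) (hp : Tendsto p atTop atTop)
    {φ t : ℕ → ℝ} {m : ℕ → ℕ} {D K κ : ℝ} (hφ : ∀ N, 0 < φ N) (hD : 1 < D) (hK : 0 < K)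
    (hm : Tendsto m atTop atTop)
    (hmp : Tendsto (fun N => (m N : ℝ) / (p N : ℝ)) atTop (𝓝 0))
    (hmφ : ∀ᶠ N in atTop, D ≤ (m N : ℝ) ^ α * φ N ∧ (m N : ℝ) ^ α * φ N ≤ K ^ (-(2 * α)))
    (hq : Tendsto (fun N => (a N : ℝ) ^ 2 * n N * p N * φ N ^ (2 + 1 / (2 * α))) atTop atTop)
    (hκ : κ ≤ thresholdConst D K) (hκ' : D = K ^ (-(2 * α)) → κ < thresholdConst D K)
    (ht : ∀ᶠ N in atTop, t N ≤ κ * (a N : ℝ) ^ 4 * φ N ^ (2 + 1 / (2 * α)))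
    (hr : Tendsto (fun N => (n N : ℝ) * p N * t N / (a N : ℝ) ^ 2) atTop atTop) :
    Tendsto (fun N => totalError (a N) α (φ N)
      (toeplitzTest (n := n N) (p := p N) (m N) (t N))) atTop (𝓝 0) := by
  have hα0 : 0 < α := by linarith
  obtain ⟨N₀, h₀⟩ := hmφ.exists
  obtain ⟨G, ε, hG, hε, hε1, hκG, hGu⟩ :=
    exists_threshold_slack hα0 hD hK (h₀.1.trans h₀.2) hκ hκ'
  obtain ⟨C₁, hC₁, hI⟩ := exists_type_one_le hα
  obtain ⟨C₂, hC₂, hII⟩ := exists_type_two_le hα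
  set q : ℕ → ℝ := fun N => (a N : ℝ) ^ 2 * n N * p N * φ N ^ (2 + 1 / (2 * α)) with hqdef
  set r : ℕ → ℝ := fun N => (n N : ℝ) * p N * t N / (a N : ℝ) ^ 2 with hrdef
  have hGq : Tendsto (fun N => G * q N) atTop atTop := hq.const_mul_atTop hG
  have l1 : Tendsto (fun N => C₁ / r N ^ 2) atTop (𝓝 0) :=
    tendsto_const_nhds.div_atTop ((tendsto_pow_atTop two_ne_zero).comp hr)
  have l2 : Tendsto (fun N => C₂ / ε ^ 2 * (1 / (G * q N) ^ 2 + 1 / (G * q N))) atTop (𝓝 0) := by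
    have e1 : Tendsto (fun N => 1 / (G * q N) ^ 2) atTop (𝓝 0) :=
      tendsto_const_nhds.div_atTop ((tendsto_pow_atTop two_ne_zero).comp hGq)
    have e2 : Tendsto (fun N => 1 / (G * q N)) atTop (𝓝 0) := tendsto_const_nhds.div_atTop hGq
    simpa using (e1.add e2).const_mul (C₂ / ε ^ 2)
  have l3 : Tendsto (fun N => ENNReal.ofReal (C₁ / r N ^ 2) +
      ENNReal.ofReal (C₂ / ε ^ 2 * (1 / (G * q N) ^ 2 + 1 / (G * q N)))) atTop (𝓝 0) := by
    have := (ENNReal.tendsto_ofReal l1).add (ENNReal.tendsto_ofReal l2)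
    simpa using this
  refine tendsto_of_tendsto_of_tendsto_of_le_of_le' tendsto_const_nhds l3
    (Eventually.of_forall fun _ => zero_le) ?_
  have hmp2 : ∀ᶠ N in atTop, (m N : ℝ) / p N < 1 / 2 := hmp.eventually_lt_const (by norm_num)
  filter_upwards [hmφ, ht, hn.eventually_ge_atTop 2, hp.eventually_ge_atTop 1,
    hm.eventually_ge_atTop 1, hmp2, hr.eventually_gt_atTop 0, hGq.eventually_gt_atTop 0]
    with N hN1 hN2 hn2 hp1 hm1 hmp' hrN hqN
  have hp0 : (0 : ℝ) < p N := by exact_mod_cast hp1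
  have hn0 : (0 : ℝ) < n N := by
    have : 0 < n N := by omega
    exact_mod_cast this
  have hm0 : (0 : ℝ) < m N := by exact_mod_cast hm1
  have h2mp : 2 * m N ≤ p N := by
    rw [div_lt_iff₀ hp0] at hmp'
    have : 2 * (m N : ℝ) ≤ p N := by linarith
    exact_mod_cast this
  have ha2 : 0 < (a N : ℝ) ^ 2 := pow_pos (ha N) 2
  have ht0 : 0 < t N := by
    by_contra hneg
    have : r N ≤ 0 := div_nonpos_of_nonpos_of_nonneg
      (mul_nonpos_of_nonneg_of_nonpos (by positivity) (not_lt.1 hneg)) ha2.le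
    linarith
  refine add_le_add ?_ (iSup₂_le fun σ hσ => ?_)
  · simp only [toeplitzTest_eq_one_iff]
    rw [← ofReal_measureReal]
    exact ENNReal.ofReal_le_ofReal (hI (a N) (n N) (m N) (p N) (t N) (ha N) hn2 hm1 h2mp ht0)
  · simp only [toeplitzTest_eq_zero_iff]
    rw [← ofReal_measureReal]
    refine ENNReal.ofReal_le_ofReal ?_
    have hE := energy_lower_bound hα0 (hφ N) hm1 (hGu _ hN1.1 hN1.2) hσ
    set s := ∑ j ∈ Finset.Icc 1 (m N), σ j ^ 2
    have hφp : 0 < φ N ^ (2 + 1 / (2 * α)) := Real.rpow_pos_of_pos (hφ N) _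
    have hsm : 0 < √(m N : ℝ) := Real.sqrt_pos.2 hm0
    have hs0 : 0 < s := by
      have : 0 < s / √(m N : ℝ) := lt_of_lt_of_le (by positivity) hE
      exact (div_pos_iff_of_pos_right hsm).1 this
    have hs2 : 0 < √(2 : ℝ) := Real.sqrt_pos.2 two_pos
    refine (hII σ hσ.1 (a N) (n N) (m N) (p N) (t N) ε (ha N) hn2 hm1 h2mp hε hs0 ?_).trans ?_
    · refine hN2.trans ?_
      calc κ * (a N : ℝ) ^ 4 * φ N ^ (2 + 1 / (2 * α))
          ≤ ((1 - ε) * (G / √2)) * (a N : ℝ) ^ 4 * φ N ^ (2 + 1 / (2 * α)) := by gcongr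
        _ = (1 - ε) * ((a N : ℝ) ^ 4 * (G * φ N ^ (2 + 1 / (2 * α))) / √2) := by ring
        _ ≤ (1 - ε) * ((a N : ℝ) ^ 4 * (s / √(m N : ℝ)) / √2) := by
            have : 0 ≤ 1 - ε := by linarith
            gcongr
        _ = (1 - ε) * ((a N : ℝ) ^ 4 * s / √(2 * (m N : ℝ))) := by
            rw [Real.sqrt_mul two_pos.le]; ring
    · have hQ : G * q N ≤ (a N : ℝ) ^ 2 * n N * p N * (s / √(m N : ℝ)) := by
        calc G * q N = (a N : ℝ) ^ 2 * n N * p N * (G * φ N ^ (2 + 1 / (2 * α))) := by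
              simp only [hqdef]; ring
          _ ≤ _ := by gcongr
      have hε2 : 0 ≤ C₂ / ε ^ 2 := by positivity
      refine mul_le_mul_of_nonneg_left (add_le_add ?_ ?_) hε2
      · exact one_div_le_one_div_of_le (by positivity) (pow_le_pow_left₀ hqN.le hQ 2)
      · exact one_div_le_one_div_of_le hqN hQ

/-! ### Gaussian densities -/

section GaussianDensity

open Matrix
open scoped MatrixOrder

variable {p : ℕ}

theorem stdGaussian_eq_withDensity (p : ℕ) : stdGaussian (EuclideanSpace ℝ (Fin p)) =
    volume.withDensity fun x => ∏ i, gaussianPDF 0 1 (x i) := by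
  have hpi : (Measure.pi fun _ : Fin p => gaussianReal 0 1) =
      (volume : Measure (Fin p → ℝ)).withDensity fun x => ∏ i, gaussianPDF 0 1 (x i) := by
    refine Measure.pi_eq fun s hs => ?_
    rw [withDensity_apply _ (MeasurableSet.univ_pi hs), volume_pi, Measure.restrict_pi_pi,
      lintegral_fin_pi_prod _ (fun _ => gaussianPDF 0 1) fun _ => measurable_gaussianPDF 0 1]
    refine Finset.prod_congr rfl fun i _ => ?_
    rw [gaussianReal_apply 0 one_ne_zero]
  rw [← map_pi_eq_stdGaussian, hpi]
  ext s hs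
  have hmp := PiLp.volume_preserving_toLp (Fin p)
  rw [Measure.map_apply hmp.measurable hs, withDensity_apply _ (hmp.measurable hs),
    withDensity_apply _ hs, ← hmp.setLIntegral_comp_preimage hs (by fun_prop)]

theorem prod_gaussianPDF (x : EuclideanSpace ℝ (Fin p)) :
    ∏ i, gaussianPDF 0 1 (x i) =
      ENNReal.ofReal ((√(2 * Real.pi))⁻¹ ^ p * Real.exp (-(x ⬝ᵥ x) / 2)) := by
  simp only [gaussianPDF_def]
  rw [← ENNReal.ofReal_prod_of_nonneg fun i _ => gaussianPDFReal_nonneg _ _ _]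
  congr 1
  simp only [gaussianPDFReal_def, NNReal.coe_one, mul_one, sub_zero, Finset.prod_mul_distrib,
    Finset.prod_const, Finset.card_univ, Fintype.card_fin, ← Real.exp_sum, dotProduct]
  rw [← Finset.sum_div, Finset.sum_neg_distrib]
  simp [sq]

/-- The density of `𝒩(0, S)` with respect to the standard Gaussian measure. -/
noncomputable def gaussianRatio (S : Matrix (Fin p) (Fin p) ℝ) (x : Fin p → ℝ) : ℝ :=
  (√S.det)⁻¹ * Real.exp ((x ⬝ᵥ x - x ⬝ᵥ S⁻¹ *ᵥ x) / 2)

theorem gaussianRatio_nonneg (S : Matrix (Fin p) (Fin p) ℝ) (x : Fin p → ℝ) :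
    0 ≤ gaussianRatio S x := by unfold gaussianRatio; positivity

theorem measurable_gaussianRatio (S : Matrix (Fin p) (Fin p) ℝ) :
    Measurable (gaussianRatio S) := by
  have h : Continuous fun x : Fin p → ℝ => (x ⬝ᵥ x - x ⬝ᵥ S⁻¹ *ᵥ x) / 2 := by
    simp only [dotProduct, mulVec]; fun_prop
  exact ((Real.continuous_exp.comp h).const_mul _).measurable

/-- Change of variables by the square root of `S`. -/
theorem lintegral_multivariateGaussian {S : Matrix (Fin p) (Fin p) ℝ} (hS : S.PosDef)
    {f : EuclideanSpace ℝ (Fin p) → ℝ≥0∞} (hf : Measurable f) :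
    ∫⁻ x, f x ∂(multivariateGaussian 0 S) =
      ∫⁻ x, f x * ENNReal.ofReal (gaussianRatio S x) ∂(stdGaussian (EuclideanSpace ℝ (Fin p))) := by
  set R := CFC.sqrt S with hR
  have hRR : R * R = S := CFC.sqrt_mul_sqrt_self S hS.posSemidef.nonneg
  have hRT : Rᵀ = R := by
    have h : IsSelfAdjoint R := (CFC.sqrt_nonneg S).isSelfAdjoint
    have := h.star_eq
    rwa [star_eq_conjTranspose, conjTranspose_eq_transpose_of_trivial] at this
  have hdet2 : R.det * R.det = S.det := by rw [← det_mul, hRR]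
  have hdetS : 0 < S.det := hS.det_pos
  have hdet0 : R.det ≠ 0 := fun h => by rw [h] at hdet2; simp at hdet2; linarith
  have hdetabs : |R.det| = √S.det := by rw [← hdet2, ← sq, Real.sqrt_sq_eq_abs]
  have hunit : IsUnit R.det := isUnit_iff_ne_zero.2 hdet0
  set T := toEuclideanCLM (n := Fin p) (𝕜 := ℝ) R with hT
  set T' := toEuclideanCLM (n := Fin p) (𝕜 := ℝ) R⁻¹ with hT'
  have hT'T : ∀ x, T' (T x) = x := fun x => by
    rw [hT, hT', ← mul_apply_eq_comp, ← map_mul, nonsing_inv_mul _ hunit, map_one]; rfl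
  have hdetT : LinearMap.det (T : EuclideanSpace ℝ (Fin p) →ₗ[ℝ] EuclideanSpace ℝ (Fin p)) =
      R.det := by
    rw [hT, coe_toEuclideanCLM_eq_toEuclideanLin, LinearMap.det_toLpLin]
  have hmapT : (volume : Measure (EuclideanSpace ℝ (Fin p))).map T =
      ENNReal.ofReal |(R.det)⁻¹| • volume := by
    have := Measure.map_linearMap_addHaar_eq_smul_addHaar
      (volume : Measure (EuclideanSpace ℝ (Fin p)))
      (f := (T : EuclideanSpace ℝ (Fin p) →ₗ[ℝ] EuclideanSpace ℝ (Fin p)))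
      (by rw [hdetT]; exact hdet0)
    rw [hdetT] at this
    exact this
  set g : EuclideanSpace ℝ (Fin p) → ℝ≥0∞ := fun x => ∏ i, gaussianPDF 0 1 (x i) with hg
  have hgm : Measurable g := by
    simp only [hg]
    exact Finset.measurable_prod _ fun i _ => (measurable_gaussianPDF 0 1).comp (by fun_prop)
  have hquad : ∀ y : EuclideanSpace ℝ (Fin p), (T' y) ⬝ᵥ (T' y) = y ⬝ᵥ S⁻¹ *ᵥ y := by
    intro y
    have hRi : R⁻¹ᵀ = R⁻¹ := by rw [transpose_nonsing_inv, hRT]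
    change (R⁻¹ *ᵥ y) ⬝ᵥ (R⁻¹ *ᵥ y) = _
    rw [dotProduct_mulVec, vecMul_mulVec, ← dotProduct_mulVec, hRi, ← Matrix.mul_inv_rev, hRR]
  have hgT : ∀ y, ENNReal.ofReal |(R.det)⁻¹| * g (T' y) = ENNReal.ofReal (gaussianRatio S y) * g y := by
    intro y
    simp only [hg, prod_gaussianPDF]
    rw [← ENNReal.ofReal_mul (abs_nonneg _), ← ENNReal.ofReal_mul (gaussianRatio_nonneg _ _),
      hquad, abs_inv, hdetabs, gaussianRatio]
    congr 1
    have : Real.exp ((y ⬝ᵥ y - y ⬝ᵥ S⁻¹ *ᵥ y) / 2) * Real.exp (-(y ⬝ᵥ y) / 2) =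
        Real.exp (-(y ⬝ᵥ S⁻¹ *ᵥ y) / 2) := by
      rw [← Real.exp_add]; congr 1; ring
    rw [← this]; ring
  have hmv : multivariateGaussian 0 S = (stdGaussian (EuclideanSpace ℝ (Fin p))).map T := by
    rw [multivariateGaussian]; simp only [zero_add]; rfl
  have hstd : stdGaussian (EuclideanSpace ℝ (Fin p)) = volume.withDensity g :=
    stdGaussian_eq_withDensity p
  have hfT : Measurable fun x => f (T x) := hf.comp T.continuous.measurable
  have hfL : Measurable fun x : EuclideanSpace ℝ (Fin p) =>
      f x * ENNReal.ofReal (gaussianRatio S x) :=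
    hf.mul ((measurable_gaussianRatio S).comp (by fun_prop)).ennreal_ofReal
  rw [hmv, lintegral_map hf T.continuous.measurable, hstd,
    lintegral_withDensity_eq_lintegral_mul _ hgm hfT,
    lintegral_withDensity_eq_lintegral_mul _ hgm hfL]
  have hgf : Measurable fun y => g (T' y) * f y := (hgm.comp T'.continuous.measurable).mul hf
  have h1 : ∫⁻ x, (g * fun x => f (T x)) x = ∫⁻ y, g (T' y) * f y ∂(volume.map T) := by
    rw [lintegral_map hgf T.continuous.measurable]
    simp [hT'T]
  rw [h1, hmapT, lintegral_smul_measure, smul_eq_mul,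
    ← lintegral_const_mul _ hgf]
  refine lintegral_congr fun y => ?_
  simp only [Pi.mul_apply, hg] at hgT ⊢
  rw [← mul_assoc, hgT, mul_comm (∏ i, _), mul_assoc, mul_comm _ (f y), mul_assoc]
  ring

theorem lintegral_gaussianRatio {S : Matrix (Fin p) (Fin p) ℝ} (hS : S.PosDef) :
    ∫⁻ x, ENNReal.ofReal (gaussianRatio S x) ∂(stdGaussian (EuclideanSpace ℝ (Fin p))) = 1 := by
  have := lintegral_multivariateGaussian hS (f := fun _ => 1) measurable_const
  simpa using this.symm

/-- The inner product of the likelihood ratios of `𝒩(0, 1 + A)` and `𝒩(0, 1 + B)` against the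
standard Gaussian measure is `det (1 - AB)^{-1/2}`. -/
theorem lintegral_gaussianRatio_mul {A B : Matrix (Fin p) (Fin p) ℝ} (hA : (1 + A).PosDef)
    (hB : (1 + B).PosDef) (hM : ((1 + A)⁻¹ + (1 + B)⁻¹ - 1).PosDef) :
    0 < (1 - A * B).det ∧
    ∫⁻ x, ENNReal.ofReal (gaussianRatio (1 + A) x * gaussianRatio (1 + B) x)
      ∂(stdGaussian (EuclideanSpace ℝ (Fin p))) = ENNReal.ofReal (√(1 - A * B).det)⁻¹ := by
  set M := (1 + A)⁻¹ + (1 + B)⁻¹ - 1 with hMdef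
  have uA : IsUnit (1 + A).det := isUnit_iff_ne_zero.2 hA.det_pos.ne'
  have uB : IsUnit (1 + B).det := isUnit_iff_ne_zero.2 hB.det_pos.ne'
  have uM : IsUnit M.det := isUnit_iff_ne_zero.2 hM.det_pos.ne'
  -- the product of the two ratios is, up to a constant, the ratio of `𝒩(0, M⁻¹)`
  have hprod : (1 + A) * M * (1 + B) = 1 - A * B := by
    have e1 := mul_nonsing_inv _ uA
    have e2 := nonsing_inv_mul _ uB
    rw [hMdef]
    generalize (1 + A)⁻¹ = X at e1 ⊢
    generalize (1 + B)⁻¹ = Y at e2 ⊢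
    calc (1 + A) * (X + Y - 1) * (1 + B) =
        ((1 + A) * X) * (1 + B) + (1 + A) * (Y * (1 + B)) - (1 + A) * (1 + B) := by noncomm_ring
      _ = 1 - A * B := by rw [e1, e2]; noncomm_ring
  have hdet : (1 - A * B).det = (1 + A).det * M.det * (1 + B).det := by
    rw [← hprod, det_mul, det_mul]
  have hpos : 0 < (1 - A * B).det := by
    rw [hdet]; exact mul_pos (mul_pos hA.det_pos hM.det_pos) hB.det_pos
  refine ⟨hpos, ?_⟩
  have hMi : M⁻¹.PosDef := hM.inv
  have hrat : ∀ x : Fin p → ℝ, gaussianRatio (1 + A) x * gaussianRatio (1 + B) x =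
      (√(1 - A * B).det)⁻¹ * gaussianRatio M⁻¹ x := by
    intro x
    have hdi : (√(M⁻¹).det)⁻¹ = √M.det := by
      rw [det_nonsing_inv, Ring.inverse_eq_inv', Real.sqrt_inv, inv_inv]
    have hs : √(1 - A * B).det = √(1 + A).det * √M.det * √(1 + B).det := by
      rw [hdet, Real.sqrt_mul (mul_pos hA.det_pos hM.det_pos).le, Real.sqrt_mul hA.det_pos.le]
    have hsM : √M.det ≠ 0 := (Real.sqrt_pos.2 hM.det_pos).ne'
    simp only [gaussianRatio]
    rw [hdi, hs, nonsing_inv_nonsing_inv _ uM]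
    have hexp : Real.exp ((x ⬝ᵥ x - x ⬝ᵥ M *ᵥ x) / 2) =
        Real.exp ((x ⬝ᵥ x - x ⬝ᵥ (1 + A)⁻¹ *ᵥ x) / 2) *
          Real.exp ((x ⬝ᵥ x - x ⬝ᵥ (1 + B)⁻¹ *ᵥ x) / 2) := by
      rw [← Real.exp_add, hMdef, sub_mulVec, add_mulVec, one_mulVec, dotProduct_sub,
        dotProduct_add]
      congr 1; ring
    rw [hexp, mul_inv, mul_inv]
    field_simp
  simp_rw [hrat]
  have hc : 0 ≤ (√(1 - A * B).det)⁻¹ := by positivity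
  simp_rw [ENNReal.ofReal_mul hc]
  have hm : Measurable fun x : EuclideanSpace ℝ (Fin p) =>
      ENNReal.ofReal (gaussianRatio M⁻¹ x) :=
    ((measurable_gaussianRatio _).comp (by fun_prop)).ennreal_ofReal
  rw [lintegral_const_mul _ hm, lintegral_gaussianRatio hMi, mul_one]

end GaussianDensity

/-! ### Determinants close to one -/

section Determinant

open Matrix

variable {p : ℕ}

/-- The Euclidean operator norm of `A` is at most `√D`. -/
def OpSqBound (A : Matrix (Fin p) (Fin p) ℝ) (D : ℝ) : Prop :=
  ∀ x : Fin p → ℝ, (A *ᵥ x) ⬝ᵥ (A *ᵥ x) ≤ D * (x ⬝ᵥ x)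

/-- The squared Frobenius norm. -/
def frobSq (A : Matrix (Fin p) (Fin p) ℝ) : ℝ := ∑ i, ∑ j, A i j ^ 2

theorem frobSq_nonneg (A : Matrix (Fin p) (Fin p) ℝ) : 0 ≤ frobSq A :=
  Finset.sum_nonneg fun _ _ => Finset.sum_nonneg fun _ _ => sq_nonneg _

theorem frobSq_transpose (A : Matrix (Fin p) (Fin p) ℝ) : frobSq Aᵀ = frobSq A := by
  unfold frobSq; rw [Finset.sum_comm]; rfl

theorem trace_mul_self_of_symm {A : Matrix (Fin p) (Fin p) ℝ} (hA : Aᵀ = A) :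
    trace (A * A) = frobSq A := by
  simp only [trace, diag, mul_apply, frobSq]
  refine Finset.sum_congr rfl fun i _ => Finset.sum_congr rfl fun j _ => ?_
  rw [sq, show A j i = A i j from congrFun (congrFun hA i) j]

theorem frobSq_mul_le {A B : Matrix (Fin p) (Fin p) ℝ} {D : ℝ} (hA : OpSqBound A D) :
    frobSq (A * B) ≤ D * frobSq B := by
  unfold frobSq
  rw [Finset.sum_comm, Finset.sum_comm (f := fun i j => B i j ^ 2), Finset.mul_sum]
  refine Finset.sum_le_sum fun j _ => ?_
  have h := hA fun i => B i j
  simp only [dotProduct] at h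
  simp_rw [sq]
  exact h

theorem dotProduct_self_nonneg' (x : Fin p → ℝ) : 0 ≤ x ⬝ᵥ x :=
  Finset.sum_nonneg fun _ _ => mul_self_nonneg _

theorem abs_dotProduct_le (x y : Fin p → ℝ) {c : ℝ} (hc : 0 < c) :
    |x ⬝ᵥ y| ≤ (c * (x ⬝ᵥ x) + (y ⬝ᵥ y) / c) / 2 := by
  have h1 : 0 ≤ (c • x - y) ⬝ᵥ (c • x - y) := dotProduct_self_nonneg' _
  have h2 : 0 ≤ (c • x + y) ⬝ᵥ (c • x + y) := dotProduct_self_nonneg' _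
  simp only [sub_dotProduct, dotProduct_sub, add_dotProduct, dotProduct_add, smul_dotProduct,
    dotProduct_smul, smul_eq_mul, dotProduct_comm y x] at h1 h2
  have e : (c * (x ⬝ᵥ x) + (y ⬝ᵥ y) / c) / 2 = (c * (c * (x ⬝ᵥ x)) + y ⬝ᵥ y) / (2 * c) := by
    field_simp
  rw [e, le_div_iff₀ (by positivity), ← abs_of_pos (by positivity : 0 < 2 * c), ← abs_mul, abs_le]
  constructor <;> linarith

/-- `log (1 / x) ≤ (1 - x) + 2 (1 - x)²` for `x ≥ 1/2`. -/
theorem neg_log_le {x : ℝ} (hx : 1 / 2 ≤ x) : -Real.log x ≤ (1 - x) + 2 * (1 - x) ^ 2 := by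
  have hx0 : 0 < x := by linarith
  have h := Real.one_sub_inv_le_log_of_pos hx0
  have : x⁻¹ - 1 ≤ (1 - x) + 2 * (1 - x) ^ 2 := by
    rw [← sub_nonneg]
    have e : (1 - x) + 2 * (1 - x) ^ 2 - (x⁻¹ - 1) = (1 - x) ^ 2 * (2 * x - 1) / x := by
      field_simp; ring
    rw [e]
    exact div_nonneg (mul_nonneg (sq_nonneg _) (by linarith)) hx0.le
  linarith

theorem trace_mul_self_eq_sum_eigenvalues {M : Matrix (Fin p) (Fin p) ℝ} (hM : M.IsHermitian) :
    trace (M * M) = ∑ i, hM.eigenvalues i ^ 2 := by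
  conv_lhs => rw [hM.spectral_theorem, ← map_mul, Unitary.conjStarAlgAut_apply, trace_mul_comm,
    ← mul_assoc]
  simp [diagonal_mul_diagonal, trace_diagonal, sq]

/-- The determinant of a symmetric matrix close to the identity, through the eigenvalues: `neg_log_le`
is applied to each of them. -/
theorem inv_det_le {M : Matrix (Fin p) (Fin p) ℝ} (hM : Mᵀ = M)
    (hlow : ∀ x : Fin p → ℝ, (1 / 2) * (x ⬝ᵥ x) ≤ x ⬝ᵥ M *ᵥ x) :
    0 < M.det ∧ M.det⁻¹ ≤ Real.exp (trace (1 - M) + 2 * frobSq (1 - M)) := by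
  have hH : M.IsHermitian := by
    rw [IsHermitian, conjTranspose_eq_transpose_of_trivial, hM]
  have hev : ∀ i, 1 / 2 ≤ hH.eigenvalues i := by
    intro i
    have h := hlow (hH.eigenvectorBasis i)
    have h1 : ((hH.eigenvectorBasis i : EuclideanSpace ℝ (Fin p)) : Fin p → ℝ) ⬝ᵥ
        ((hH.eigenvectorBasis i : EuclideanSpace ℝ (Fin p)) : Fin p → ℝ) = 1 := by
      have := hH.eigenvectorBasis.orthonormal.1 i
      have h2 := EuclideanSpace.real_norm_sq_eq (hH.eigenvectorBasis i)
      rw [this] at h2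
      simp only [dotProduct, ← sq]
      linarith
    rw [hH.mulVec_eigenvectorBasis, dotProduct_smul, h1] at h
    simpa using h
  have hdet : M.det = ∏ i, hH.eigenvalues i := by
    have := hH.det_eq_prod_eigenvalues
    simpa using this
  have hpos : 0 < M.det := by
    rw [hdet]; exact Finset.prod_pos fun i _ => by linarith [hev i]
  refine ⟨hpos, ?_⟩
  rw [← Real.exp_log (inv_pos.2 hpos), Real.exp_le_exp, Real.log_inv, hdet,
    Real.log_prod fun i _ => by linarith [hev i], ← Finset.sum_neg_distrib]
  have htr : trace M = ∑ i, hH.eigenvalues i := by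
    have := hH.trace_eq_sum_eigenvalues
    simpa using this
  have hsym : (1 - M)ᵀ = 1 - M := by rw [transpose_sub, hM, transpose_one]
  have hfrob : frobSq (1 - M) = ∑ i, (1 - hH.eigenvalues i) ^ 2 := by
    rw [← trace_mul_self_of_symm hsym]
    have e : (1 - M) * (1 - M) = 1 - 2 • M + M * M := by noncomm_ring
    rw [e, trace_add, trace_sub, trace_smul, trace_mul_self_eq_sum_eigenvalues hH, htr]
    simp only [trace_one, Fintype.card_fin, sub_sq, Finset.sum_add_distrib,
      Finset.sum_sub_distrib, one_pow, mul_one, Finset.sum_const, Finset.card_univ, nsmul_eq_mul,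
      ← Finset.mul_sum]
    simp
  have htr1 : trace (1 - M) = ∑ i, (1 - hH.eigenvalues i) := by
    rw [trace_sub, htr]; simp
  rw [hfrob, htr1, Finset.mul_sum, ← Finset.sum_add_distrib]
  exact Finset.sum_le_sum fun i _ => neg_log_le (hev i)

variable {A B : Matrix (Fin p) (Fin p) ℝ} {D : ℝ}

theorem abs_quad_le (hA : OpSqBound A D) (hD : D ≤ 1 / 64) (x : Fin p → ℝ) :
    |x ⬝ᵥ A *ᵥ x| ≤ (1 / 8) * (x ⬝ᵥ x) := by
  have h := abs_dotProduct_le x (A *ᵥ x) (c := 1 / 8) (by norm_num)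
  have h2 := hA x
  have h3 := dotProduct_self_nonneg' x
  have h4 : D * (x ⬝ᵥ x) ≤ (1 / 64) * (x ⬝ᵥ x) := mul_le_mul_of_nonneg_right hD h3
  refine h.trans ?_
  rw [div_div_eq_mul_div, div_one]
  linarith

theorem dotProduct_self_pos {x : Fin p → ℝ} (hx : x ≠ 0) : 0 < x ⬝ᵥ x :=
  lt_of_le_of_ne (dotProduct_self_nonneg' x) fun h => hx (dotProduct_self_eq_zero.1 h.symm)

theorem posDef_of_symm {M : Matrix (Fin p) (Fin p) ℝ} (hM : Mᵀ = M)
    (hpos : ∀ x : Fin p → ℝ, x ≠ 0 → 0 < x ⬝ᵥ M *ᵥ x) : M.PosDef :=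
  posDef_iff_dotProduct_mulVec.2
    ⟨by rw [IsHermitian, conjTranspose_eq_transpose_of_trivial, hM], fun x hx => hpos x hx⟩

theorem posDef_one_add (hAs : Aᵀ = A) (hA : OpSqBound A D) (hD : D ≤ 1 / 64) : (1 + A).PosDef := by
  refine posDef_of_symm (by rw [transpose_add, hAs, transpose_one]) fun x hx => ?_
  have h1 := (abs_le.1 (abs_quad_le hA hD x)).1
  have h2 := dotProduct_self_pos hx
  rw [add_mulVec, one_mulVec, dotProduct_add]
  linarith

/-- The constant is `(1 - 1/8) / (1 + 1/8)²`, from `x = (1 + A) y`; only the fact that it exceeds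
`1/2` matters. -/
theorem quad_inv_one_add_ge (hAs : Aᵀ = A) (hA : OpSqBound A D) (hD : D ≤ 1 / 64)
    (x : Fin p → ℝ) : (56 / 81) * (x ⬝ᵥ x) ≤ x ⬝ᵥ (1 + A)⁻¹ *ᵥ x := by
  have hu : IsUnit (1 + A).det := isUnit_iff_ne_zero.2 (posDef_one_add hAs hA hD).det_pos.ne'
  set y := (1 + A)⁻¹ *ᵥ x with hy
  have hx : x = y + A *ᵥ y := by
    have : (1 + A) *ᵥ y = x := by rw [hy, mulVec_mulVec, mul_nonsing_inv _ hu, one_mulVec]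
    rw [← this, add_mulVec, one_mulVec]
  have h1 := abs_le.1 (abs_quad_le hA hD y)
  have h2 := hA y
  have h3 := dotProduct_self_nonneg' y
  have h4 : D * (y ⬝ᵥ y) ≤ (1 / 64) * (y ⬝ᵥ y) := mul_le_mul_of_nonneg_right hD h3
  have e1 : x ⬝ᵥ x = y ⬝ᵥ y + 2 * (y ⬝ᵥ A *ᵥ y) + (A *ᵥ y) ⬝ᵥ (A *ᵥ y) := by
    rw [hx, add_dotProduct, dotProduct_add, dotProduct_add, dotProduct_comm (A *ᵥ y) y]; ring
  have e2 : x ⬝ᵥ y = y ⬝ᵥ y + y ⬝ᵥ A *ᵥ y := by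
    conv_lhs => rw [hx]
    rw [add_dotProduct, dotProduct_comm (A *ᵥ y) y]
  rw [e1, e2]
  linarith [h1.1, h1.2]

theorem posDef_inv_add_inv_sub_one (hAs : Aᵀ = A) (hBs : Bᵀ = B) (hA : OpSqBound A D)
    (hB : OpSqBound B D) (hD : D ≤ 1 / 64) : ((1 + A)⁻¹ + (1 + B)⁻¹ - 1).PosDef := by
  refine posDef_of_symm ?_ fun x hx => ?_
  · rw [transpose_sub, transpose_add, transpose_nonsing_inv, transpose_nonsing_inv, transpose_add,
      transpose_add, hAs, hBs, transpose_one]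
  · have h1 := quad_inv_one_add_ge hAs hA hD x
    have h2 := quad_inv_one_add_ge hBs hB hD x
    have h3 := dotProduct_self_pos hx
    rw [sub_mulVec, add_mulVec, one_mulVec, dotProduct_sub, dotProduct_add]
    linarith

/-- The matrix `1 - AB` is not symmetric, so that `inv_det_le` is applied to
`M = (1 - AB) (1 - AB)ᵀ`, whose determinant is the square of `det (1 - AB)`. -/
theorem inv_sqrt_det_le (hAs : Aᵀ = A) (hBs : Bᵀ = B) (hA : OpSqBound A D) (hB : OpSqBound B D)
    (hD0 : 0 ≤ D) (hD : D ≤ 1 / 64) (hdet : 0 < (1 - A * B).det) :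
    (√(1 - A * B).det)⁻¹ ≤ Real.exp (trace (A * B) / 2 + (9 / 2) * D * frobSq B) := by
  set M := (1 - A * B) * (1 - B * A) with hMdef
  have htAB : (A * B)ᵀ = B * A := by rw [transpose_mul, hAs, hBs]
  have htBA : (B * A)ᵀ = A * B := by rw [transpose_mul, hAs, hBs]
  have hMt : Mᵀ = M := by
    rw [hMdef, transpose_mul, transpose_sub, transpose_sub, htAB, htBA, transpose_one]
  have hdetM : M.det = (1 - A * B).det ^ 2 := by
    rw [hMdef, det_mul, sq]
    congr 1
    rw [← det_transpose, transpose_sub, htBA, transpose_one]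
  have hlow : ∀ x : Fin p → ℝ, (1 / 2) * (x ⬝ᵥ x) ≤ x ⬝ᵥ M *ᵥ x := by
    intro x
    have e : x ⬝ᵥ M *ᵥ x = (x - (B * A) *ᵥ x) ⬝ᵥ (x - (B * A) *ᵥ x) := by
      have h1 : x - (B * A) *ᵥ x = (1 - B * A) *ᵥ x := by rw [sub_mulVec, one_mulVec]
      rw [h1, hMdef, ← mulVec_mulVec, dotProduct_mulVec]
      congr 1
      rw [← mulVec_transpose, transpose_sub, htAB, transpose_one]
    have h2 : ((B * A) *ᵥ x) ⬝ᵥ ((B * A) *ᵥ x) ≤ (1 / 4096) * (x ⬝ᵥ x) := by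
      rw [← mulVec_mulVec]
      have h3 := dotProduct_self_nonneg' x
      calc _ ≤ D * ((A *ᵥ x) ⬝ᵥ (A *ᵥ x)) := hB _
        _ ≤ D * (D * (x ⬝ᵥ x)) := mul_le_mul_of_nonneg_left (hA x) hD0
        _ = (D * D) * (x ⬝ᵥ x) := by ring
        _ ≤ (1 / 4096) * (x ⬝ᵥ x) := mul_le_mul_of_nonneg_right (by nlinarith) h3
    have h4 := (abs_le.1 (abs_dotProduct_le x ((B * A) *ᵥ x) (c := 1 / 64) (by norm_num))).2
    have h5 := dotProduct_self_nonneg' ((B * A) *ᵥ x)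
    have h6 := dotProduct_self_nonneg' x
    rw [div_div_eq_mul_div, div_one] at h4
    rw [e, sub_dotProduct, dotProduct_sub, dotProduct_sub, dotProduct_comm ((B * A) *ᵥ x) x]
    linarith
  obtain ⟨hMpos, hMle⟩ := inv_det_le hMt hlow
  have hsub : 1 - M = A * B + B * A - A * (B * (B * A)) := by rw [hMdef]; noncomm_ring
  have htr : trace (1 - M) ≤ 2 * trace (A * B) := by
    have h1 : trace (A * (B * (B * A))) = frobSq (A * B) := by
      rw [← mul_assoc, ← htAB]
      simp only [trace, diag, mul_apply, transpose_apply, frobSq]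
      simp_rw [sq]
    rw [hsub, trace_sub, trace_add, h1, trace_mul_comm B A]
    linarith [frobSq_nonneg (A * B)]
  have hfAB := frobSq_mul_le (B := B) hA
  have hfBA : frobSq (B * A) = frobSq (A * B) := by rw [← htAB, frobSq_transpose]
  have hfr : frobSq (1 - M) ≤ 9 * (D * frobSq B) := by
    have h1 : frobSq (A * (B * (B * A))) ≤ frobSq (A * B) := by
      calc _ ≤ D * frobSq (B * (B * A)) := frobSq_mul_le hA
        _ ≤ D * (D * frobSq (B * A)) := mul_le_mul_of_nonneg_left (frobSq_mul_le hB) hD0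
        _ = (D * D) * frobSq (A * B) := by rw [hfBA]; ring
        _ ≤ 1 * frobSq (A * B) := mul_le_mul_of_nonneg_right (by nlinarith) (frobSq_nonneg _)
        _ = _ := one_mul _
    have h2 : frobSq (1 - M) ≤ 3 * (frobSq (A * B) + frobSq (B * A) +
        frobSq (A * (B * (B * A)))) := by
      rw [hsub]
      simp only [frobSq, ← Finset.sum_add_distrib, Finset.mul_sum]
      refine Finset.sum_le_sum fun i _ => Finset.sum_le_sum fun j _ => ?_
      simp only [Matrix.sub_apply, Matrix.add_apply]
      generalize (A * B) i j = x
      generalize (B * A) i j = y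
      generalize (A * (B * (B * A))) i j = z
      nlinarith [sq_nonneg (x - y), sq_nonneg (x + z), sq_nonneg (y + z)]
    linarith
  have hfinal : (√(1 - A * B).det)⁻¹ ^ 4 ≤
      Real.exp (trace (A * B) / 2 + (9 / 2) * D * frobSq B) ^ 4 := by
    have e1 : (√(1 - A * B).det)⁻¹ ^ 4 = M.det⁻¹ := by
      rw [hdetM, inv_pow]
      congr 1
      calc √(1 - A * B).det ^ 4 = (√(1 - A * B).det ^ 2) ^ 2 := by ring
        _ = _ := by rw [Real.sq_sqrt hdet.le]
    rw [e1, ← Real.exp_nat_mul]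
    refine hMle.trans (Real.exp_le_exp.2 ?_)
    push_cast
    linarith
  exact le_of_pow_le_pow_left₀ (by norm_num) (Real.exp_pos _).le hfinal

/-- The second-moment bound for the likelihood ratios of two small perturbations of the identity:
the linear term `tr (AB) / 2` is exact, the remainder is of second order. -/
theorem lintegral_gaussianRatio_mul_le (hAs : Aᵀ = A) (hBs : Bᵀ = B) (hA : OpSqBound A D)
    (hB : OpSqBound B D) (hD0 : 0 ≤ D) (hD : D ≤ 1 / 64) :
    ∫⁻ x, ENNReal.ofReal (gaussianRatio (1 + A) x * gaussianRatio (1 + B) x)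
      ∂(stdGaussian (EuclideanSpace ℝ (Fin p))) ≤
      ENNReal.ofReal (Real.exp (trace (A * B) / 2 + (9 / 2) * D * frobSq B)) := by
  obtain ⟨h1, h2⟩ := lintegral_gaussianRatio_mul (posDef_one_add hAs hA hD)
    (posDef_one_add hBs hB hD) (posDef_inv_add_inv_sub_one hAs hBs hA hB hD)
  rw [h2]
  exact ENNReal.ofReal_le_ofReal (inv_sqrt_det_le hAs hBs hA hB hD0 hD h1)

end Determinant

/-! ### Conditioning on the masks -/

section Masks

open Matrix

variable {n p : ℕ}

/-- The matrix `(z_i A_{ij} z_j)`, which keeps the entries of `A` seen through the mask `z`. -/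
def maskMat (z : Fin p → ℝ) (A : Matrix (Fin p) (Fin p) ℝ) : Matrix (Fin p) (Fin p) ℝ :=
  Matrix.of fun i j => z i * A i j * z j

theorem maskMat_mulVec (z : Fin p → ℝ) (A : Matrix (Fin p) (Fin p) ℝ) (x : Fin p → ℝ) :
    maskMat z A *ᵥ x = fun i => z i * (A *ᵥ fun j => z j * x j) i := by
  funext i
  simp only [mulVec, dotProduct, maskMat, of_apply, Finset.mul_sum]
  exact Finset.sum_congr rfl fun j _ => by ring

theorem maskMat_transpose {z : Fin p → ℝ} {A : Matrix (Fin p) (Fin p) ℝ} (hA : Aᵀ = A) :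
    (maskMat z A)ᵀ = maskMat z A := by
  ext i j
  have : A j i = A i j := congrFun (congrFun hA i) j
  simp only [transpose_apply, maskMat, of_apply, this]; ring

theorem dotProduct_mask_le {z : Fin p → ℝ} (hz : ∀ i, z i = 0 ∨ z i = 1) (x : Fin p → ℝ) :
    (fun i => z i * x i) ⬝ᵥ (fun i => z i * x i) ≤ x ⬝ᵥ x := by
  refine Finset.sum_le_sum fun i _ => ?_
  rcases hz i with h | h <;> simp only [h, zero_mul, one_mul, le_refl]
  exact mul_self_nonneg _

theorem OpSqBound.maskMat {z : Fin p → ℝ} (hz : ∀ i, z i = 0 ∨ z i = 1)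
    {A : Matrix (Fin p) (Fin p) ℝ} {D : ℝ} (hD : 0 ≤ D) (hA : OpSqBound A D) :
    OpSqBound (maskMat z A) D := by
  intro x
  rw [maskMat_mulVec]
  exact (dotProduct_mask_le hz _).trans ((hA _).trans
    (mul_le_mul_of_nonneg_left (dotProduct_mask_le hz x) hD))

/-- Unobserved coordinates may be replaced by independent standard Gaussian noise: through the mask
`z`, the laws `𝒩(0, 1 + A)` and `𝒩(0, 1 + zAz)` look the same. -/
theorem map_mask_multivariateGaussian {z : Fin p → ℝ} (hz : ∀ i, z i = 0 ∨ z i = 1)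
    {A : Matrix (Fin p) (Fin p) ℝ} (hA : (1 + A).PosSemidef) (hA' : (1 + maskMat z A).PosSemidef) :
    (multivariateGaussian (0 : EuclideanSpace ℝ (Fin p)) (1 + A)).map (fun x i => z i * x i) =
      (multivariateGaussian (0 : EuclideanSpace ℝ (Fin p)) (1 + maskMat z A)).map
        (fun x i => z i * x i) := by
  let Dz : EuclideanSpace ℝ (Fin p) →L[ℝ] EuclideanSpace ℝ (Fin p) :=
    toEuclideanCLM (n := Fin p) (𝕜 := ℝ) (diagonal z)
  have hDz : ∀ x i, (Dz x) i = z i * x i := fun x i => by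
    simp [Dz, ofLp_toEuclideanCLM, mulVec_diagonal]
  have hcomp : (fun (x : EuclideanSpace ℝ (Fin p)) (i : Fin p) => z i * x i) =
      (fun (x : EuclideanSpace ℝ (Fin p)) (i : Fin p) => x i) ∘ Dz := by
    funext x i; simp [hDz]
  have hm : Measurable (fun (x : EuclideanSpace ℝ (Fin p)) (i : Fin p) => x i) := by fun_prop
  rw [hcomp, ← Measure.map_map hm Dz.continuous.measurable,
    ← Measure.map_map hm Dz.continuous.measurable]
  congr 1
  have hcf : ∀ S : Matrix (Fin p) (Fin p) ℝ, S.PosSemidef → ∀ t : EuclideanSpace ℝ (Fin p),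
      charFun ((multivariateGaussian (0 : EuclideanSpace ℝ (Fin p)) S).map Dz) t =
        Complex.exp (-(((Dz t) ⬝ᵥ S *ᵥ (Dz t) : ℝ) : ℂ) / 2) := by
    intro S hS t
    have h1 : charFun ((multivariateGaussian (0 : EuclideanSpace ℝ (Fin p)) S).map Dz) t =
        charFun (multivariateGaussian (0 : EuclideanSpace ℝ (Fin p)) S) (Dz t) := by
      rw [charFun_apply, charFun_apply, integral_map (by fun_prop) (by fun_prop)]
      refine integral_congr_ae (Eventually.of_forall fun x => ?_)
      have : inner ℝ (Dz x) t = inner ℝ x (Dz t) := by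
        simp only [PiLp.inner_apply, hDz]
        refine Finset.sum_congr rfl fun i _ => ?_
        simp; ring
      simp only [this]
    rw [h1, charFun_multivariateGaussian hS]
    simp [neg_div]
  apply Measure.ext_of_charFun
  funext t
  rw [hcf _ hA, hcf _ hA']
  congr 4
  have hq : (Dz t) ⬝ᵥ A *ᵥ (Dz t) = (Dz t) ⬝ᵥ maskMat z A *ᵥ (Dz t) := by
    rw [maskMat_mulVec]
    have hidem : (fun j => z j * (Dz t) j) = fun j => (Dz t) j := by
      funext j; rw [hDz]; rcases hz j with h | h <;> simp [h]
    rw [hidem]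
    simp only [dotProduct]
    refine Finset.sum_congr rfl fun i _ => ?_
    rw [hDz]; rcases hz i with h | h <;> simp [h]
  rw [add_mulVec, add_mulVec, dotProduct_add, dotProduct_add, hq]

/-- The law of the `n` masks of a sample. -/
noncomputable def masksLaw (n p : ℕ) (a : unitInterval) : Measure (Fin n → Fin p → ℝ) :=
  Measure.pi fun _ => maskLaw a p

instance (n p : ℕ) (a : unitInterval) : IsProbabilityMeasure (masksLaw n p a) := by
  unfold masksLaw; infer_instance

theorem ae_masksLaw (n p : ℕ) (a : unitInterval) :
    ∀ᵐ ε ∂(masksLaw n p a), ∀ k i, ε k i = 0 ∨ ε k i = 1 := by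
  rw [ae_all_iff]
  intro k
  exact (measurePreserving_eval (fun _ : Fin n => maskLaw a p)
    k).quasiMeasurePreserving.ae (ae_maskLaw a p)

/-- The coordinatewise product of masks and complete data. -/
def maskSample (ε : Fin n → Fin p → ℝ) (x : Fin n → EuclideanSpace ℝ (Fin p)) : Sample n p :=
  fun k i => ε k i * x k i

theorem measurable_maskSample : Measurable fun w : (Fin n → EuclideanSpace ℝ (Fin p)) ×
    (Fin n → Fin p → ℝ) => maskSample w.2 w.1 := by
  unfold maskSample; fun_prop

theorem sampleLaw_eq_map (a : unitInterval) (S : Matrix (Fin p) (Fin p) ℝ) :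
    sampleLaw n a S = ((Measure.pi fun _ : Fin n =>
      multivariateGaussian (0 : EuclideanSpace ℝ (Fin p)) S).prod (masksLaw n p a)).map
        fun w => maskSample w.2 w.1 := by
  unfold sampleLaw observationLaw
  rw [← Measure.pi_map_pi (fun _ => (measurable_mask p).aemeasurable)]
  have hmp := measurePreserving_arrowProdEquivProdArrow (EuclideanSpace ℝ (Fin p)) (Fin p → ℝ)
    (Fin n) (fun _ => multivariateGaussian (0 : EuclideanSpace ℝ (Fin p)) S)
    (fun _ => maskLaw a p)
  unfold masksLaw
  rw [← hmp.map_eq, Measure.map_map measurable_maskSample hmp.measurable]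
  rfl

/-- The law of the sample is a mixture over the masks of laws of masked Gaussian vectors. -/
theorem sampleLaw_apply (a : unitInterval) (S : Matrix (Fin p) (Fin p) ℝ)
    {W : Set (Sample n p)} (hW : MeasurableSet W) :
    sampleLaw n a S W = ∫⁻ ε, (Measure.pi fun _ : Fin n =>
      multivariateGaussian (0 : EuclideanSpace ℝ (Fin p)) S) {x | maskSample ε x ∈ W}
        ∂(masksLaw n p a) := by
  rw [sampleLaw_eq_map, Measure.map_apply measurable_maskSample hW,
    Measure.prod_apply_symm (measurable_maskSample hW)]
  rfl

theorem measurable_gaussian_section (S : Matrix (Fin p) (Fin p) ℝ)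
    {W : Set (Sample n p)} (hW : MeasurableSet W) :
    Measurable fun ε : Fin n → Fin p → ℝ => (Measure.pi fun _ : Fin n =>
      multivariateGaussian (0 : EuclideanSpace ℝ (Fin p)) S) {x | maskSample ε x ∈ W} :=
  measurable_measure_prodMk_right (measurable_maskSample hW)

theorem measurableSet_section (ε : Fin n → Fin p → ℝ) {W : Set (Sample n p)}
    (hW : MeasurableSet W) :
    MeasurableSet {x : Fin n → EuclideanSpace ℝ (Fin p) | maskSample ε x ∈ W} := by
  have : Measurable fun x : Fin n → EuclideanSpace ℝ (Fin p) => maskSample ε x := by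
    unfold maskSample; fun_prop
  exact this hW

theorem pi_withDensity {E : Type*} [MeasurableSpace E] (μ : Fin n → Measure E)
    [∀ i, SigmaFinite (μ i)] (f : Fin n → E → ℝ≥0∞) (hf : ∀ i, Measurable (f i))
    [∀ i, SigmaFinite ((μ i).withDensity (f i))] :
    Measure.pi (fun i => (μ i).withDensity (f i)) =
      (Measure.pi μ).withDensity fun x => ∏ i, f i (x i) := by
  refine Measure.pi_eq fun s hs => ?_
  rw [withDensity_apply _ (MeasurableSet.univ_pi hs), Measure.restrict_pi_pi,
    lintegral_fin_pi_prod _ f hf]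
  exact Finset.prod_congr rfl fun i _ => (withDensity_apply _ (hs i)).symm

theorem multivariateGaussian_eq_withDensity {S : Matrix (Fin p) (Fin p) ℝ} (hS : S.PosDef) :
    multivariateGaussian (0 : EuclideanSpace ℝ (Fin p)) S =
      (stdGaussian (EuclideanSpace ℝ (Fin p))).withDensity
        fun x => ENNReal.ofReal (gaussianRatio S x) := by
  ext s hs
  rw [withDensity_apply _ hs, ← lintegral_indicator_one hs,
    lintegral_multivariateGaussian hS (measurable_one.indicator hs), ← lintegral_indicator hs]
  refine lintegral_congr fun x => ?_
  by_cases hx : x ∈ s <;> simp [hx]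

/-- The likelihood ratio, given the masks `ε`, of the laws `𝒩(0, 1 + zAz)` of complete vectors, which
are indistinguishable from `𝒩(0, 1 + A)` through the masks. -/
noncomputable def maskedRatio (A : Matrix (Fin p) (Fin p) ℝ) (ε : Fin n → Fin p → ℝ)
    (x : Fin n → EuclideanSpace ℝ (Fin p)) : ℝ :=
  ∏ k, gaussianRatio (1 + maskMat (ε k) A) (x k)

theorem maskedRatio_nonneg (A : Matrix (Fin p) (Fin p) ℝ) (ε : Fin n → Fin p → ℝ)
    (x : Fin n → EuclideanSpace ℝ (Fin p)) : 0 ≤ maskedRatio A ε x :=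
  Finset.prod_nonneg fun _ _ => gaussianRatio_nonneg _ _

theorem measurable_maskedRatio (A : Matrix (Fin p) (Fin p) ℝ) (ε : Fin n → Fin p → ℝ) :
    Measurable (maskedRatio A ε) :=
  Finset.measurable_prod _ fun k _ => (measurable_gaussianRatio _).comp (by fun_prop)

/-- Given the masks, the probability of an event of the sample is the integral of the likelihood
ratio `maskedRatio` under the null hypothesis. -/
theorem gaussian_section_eq {A : Matrix (Fin p) (Fin p) ℝ} {D : ℝ} (hAs : Aᵀ = A)
    (hA : OpSqBound A D) (hD0 : 0 ≤ D) (hD : D ≤ 1 / 64) {ε : Fin n → Fin p → ℝ}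
    (hε : ∀ k i, ε k i = 0 ∨ ε k i = 1) {W : Set (Sample n p)} (hW : MeasurableSet W) :
    (Measure.pi fun _ : Fin n => multivariateGaussian (0 : EuclideanSpace ℝ (Fin p)) (1 + A))
        {x | maskSample ε x ∈ W} =
      ∫⁻ x in {x | maskSample ε x ∈ W}, ENNReal.ofReal (maskedRatio A ε x)
        ∂(Measure.pi fun _ : Fin n => stdGaussian (EuclideanSpace ℝ (Fin p))) := by
  have hpd : ∀ k, (1 + maskMat (ε k) A).PosDef := fun k =>
    posDef_one_add (maskMat_transpose hAs) (hA.maskMat (hε k) hD0) hD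
  have hmk : ∀ k, Measurable fun (x : EuclideanSpace ℝ (Fin p)) (i : Fin p) => ε k i * x i :=
    fun k => by fun_prop
  have hsec : ∀ S : Fin n → Matrix (Fin p) (Fin p) ℝ, (Measure.pi fun k : Fin n =>
      multivariateGaussian (0 : EuclideanSpace ℝ (Fin p)) (S k)) {x | maskSample ε x ∈ W} =
      Measure.pi (fun k => (multivariateGaussian (0 : EuclideanSpace ℝ (Fin p)) (S k)).map
        fun x i => ε k i * x i) W := by
    intro S
    have : ∀ k, IsProbabilityMeasure ((multivariateGaussian (0 : EuclideanSpace ℝ (Fin p))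
        (S k)).map fun x i => ε k i * x i) := fun k =>
      Measure.isProbabilityMeasure_map (hmk k).aemeasurable
    rw [← Measure.pi_map_pi (fun k => (hmk k).aemeasurable), Measure.map_apply (by fun_prop) hW]
    rfl
  rw [hsec fun _ => 1 + A]
  simp_rw [fun k => map_mask_multivariateGaussian (hε k) (posDef_one_add hAs hA hD).posSemidef
    (hpd k).posSemidef]
  rw [← hsec fun k => 1 + maskMat (ε k) A]
  have hdens : ∀ k, multivariateGaussian (0 : EuclideanSpace ℝ (Fin p)) (1 + maskMat (ε k) A) =
      (stdGaussian (EuclideanSpace ℝ (Fin p))).withDensity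
        fun x => ENNReal.ofReal (gaussianRatio (1 + maskMat (ε k) A) x) := fun k =>
    multivariateGaussian_eq_withDensity (hpd k)
  have : ∀ k, SigmaFinite ((stdGaussian (EuclideanSpace ℝ (Fin p))).withDensity
      fun x => ENNReal.ofReal (gaussianRatio (1 + maskMat (ε k) A) x)) := fun k => by
    rw [← hdens k]; infer_instance
  simp_rw [hdens]
  rw [pi_withDensity (fun _ : Fin n => stdGaussian (EuclideanSpace ℝ (Fin p)))
    (fun k x => ENNReal.ofReal (gaussianRatio (1 + maskMat (ε k) A) x))
    (fun k => ((measurable_gaussianRatio _).comp (by fun_prop)).ennreal_ofReal),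
    withDensity_apply _ (measurableSet_section ε hW)]
  refine lintegral_congr fun x => ?_
  rw [maskedRatio, ENNReal.ofReal_prod_of_nonneg fun _ _ => gaussianRatio_nonneg _ _]

theorem lintegral_maskedRatio_mul_le {A B : Matrix (Fin p) (Fin p) ℝ} {D : ℝ} (hAs : Aᵀ = A)
    (hBs : Bᵀ = B) (hA : OpSqBound A D) (hB : OpSqBound B D) (hD0 : 0 ≤ D) (hD : D ≤ 1 / 64)
    {ε : Fin n → Fin p → ℝ} (hε : ∀ k i, ε k i = 0 ∨ ε k i = 1) :
    ∫⁻ x, ENNReal.ofReal (maskedRatio A ε x * maskedRatio B ε x)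
        ∂(Measure.pi fun _ : Fin n => stdGaussian (EuclideanSpace ℝ (Fin p))) ≤
      ENNReal.ofReal (Real.exp (∑ k, (trace (maskMat (ε k) A * maskMat (ε k) B) / 2 +
        (9 / 2) * D * frobSq (maskMat (ε k) B)))) := by
  have h1 : ∀ x : Fin n → EuclideanSpace ℝ (Fin p),
      ENNReal.ofReal (maskedRatio A ε x * maskedRatio B ε x) =
      ∏ k, ENNReal.ofReal (gaussianRatio (1 + maskMat (ε k) A) (x k) *
        gaussianRatio (1 + maskMat (ε k) B) (x k)) := fun x => by
    rw [maskedRatio, maskedRatio, ← Finset.prod_mul_distrib, ENNReal.ofReal_prod_of_nonneg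
      fun _ _ => mul_nonneg (gaussianRatio_nonneg _ _) (gaussianRatio_nonneg _ _)]
  simp_rw [h1]
  rw [lintegral_fin_pi_prod (fun _ : Fin n => stdGaussian (EuclideanSpace ℝ (Fin p)))
    (fun k x => ENNReal.ofReal (gaussianRatio (1 + maskMat (ε k) A) x *
      gaussianRatio (1 + maskMat (ε k) B) x))
    (fun k => (((measurable_gaussianRatio _).comp (by fun_prop)).mul
      ((measurable_gaussianRatio _).comp (by fun_prop))).ennreal_ofReal),
    Real.exp_sum, ENNReal.ofReal_prod_of_nonneg fun _ _ => (Real.exp_pos _).le]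
  exact Finset.prod_le_prod' fun k _ => lintegral_gaussianRatio_mul_le (maskMat_transpose hAs)
    (maskMat_transpose hBs) (hA.maskMat (hε k) hD0) (hB.maskMat (hε k) hD0) hD0 hD

end Masks

/-! ### Testing against a mixture -/

/-- The second-moment method: a mixture of `P`-densities whose second moment is at most `1 + η`
cannot be told from `P` with total error below `1 - √η`. -/
theorem mixture_test_lower_bound {X ι : Type*} [MeasurableSpace X] (P : Measure X)
    [IsProbabilityMeasure P] (G : Finset ι) (hG : G.Nonempty) (L : ι → X → ℝ)
    (hLm : ∀ u, Measurable (L u)) (hL0 : ∀ u x, 0 ≤ L u x)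
    (hL1 : ∀ u ∈ G, ∫⁻ x, ENNReal.ofReal (L u x) ∂P = 1) {η : ℝ} (hη : 0 ≤ η)
    (h2 : ∑ u ∈ G, ∑ v ∈ G, ∫⁻ x, ENNReal.ofReal (L u x * L v x) ∂P ≤
      ENNReal.ofReal ((G.card : ℝ) ^ 2 * (1 + η))) {W : Set X} (hW : MeasurableSet W) :
    ENNReal.ofReal (1 - √η) ≤ P W + (G.card : ℝ≥0∞)⁻¹ *
      ∑ u ∈ G, ∫⁻ x in Wᶜ, ENNReal.ofReal (L u x) ∂P := by
  have hc : (0 : ℝ) < G.card := by exact_mod_cast hG.card_pos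
  set g : X → ℝ := fun x => (G.card : ℝ)⁻¹ * ∑ u ∈ G, L u x with hg
  have hg0 : ∀ x, 0 ≤ g x := fun x =>
    mul_nonneg (by positivity) (Finset.sum_nonneg fun u _ => hL0 u x)
  have hgm : Measurable g := (Finset.measurable_sum _ fun u _ => hLm u).const_mul _
  have hofg : ∀ x, ENNReal.ofReal (g x) = (G.card : ℝ≥0∞)⁻¹ * ∑ u ∈ G, ENNReal.ofReal (L u x) := by
    intro x
    rw [hg, ENNReal.ofReal_mul (by positivity), ENNReal.ofReal_inv_of_pos hc,
      ENNReal.ofReal_natCast, ENNReal.ofReal_sum_of_nonneg fun u _ => hL0 u x]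
  have hset : ∀ V : Set X, ∫⁻ x in V, ENNReal.ofReal (g x) ∂P =
      (G.card : ℝ≥0∞)⁻¹ * ∑ u ∈ G, ∫⁻ x in V, ENNReal.ofReal (L u x) ∂P := by
    intro V
    simp_rw [hofg]
    rw [lintegral_const_mul _ (Finset.measurable_sum _ fun u _ => (hLm u).ennreal_ofReal),
      lintegral_finsetSum _ fun u _ => (hLm u).ennreal_ofReal]
  have hg1 : ∫⁻ x, ENNReal.ofReal (g x) ∂P = 1 := by
    have := hset Set.univ
    rw [Measure.restrict_univ] at this
    rw [this, Finset.sum_congr rfl hL1, Finset.sum_const, nsmul_eq_mul, mul_one]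
    exact ENNReal.inv_mul_cancel (by simpa using hG.ne_empty) (ENNReal.natCast_ne_top _)
  have hg2 : ∫⁻ x, ENNReal.ofReal (g x ^ 2) ∂P ≤ ENNReal.ofReal (1 + η) := by
    have e : ∀ x, ENNReal.ofReal (g x ^ 2) = ENNReal.ofReal (((G.card : ℝ) ^ 2)⁻¹) *
        ∑ u ∈ G, ∑ v ∈ G, ENNReal.ofReal (L u x * L v x) := by
      intro x
      have : g x ^ 2 = ((G.card : ℝ) ^ 2)⁻¹ * ∑ u ∈ G, ∑ v ∈ G, L u x * L v x := by
        rw [hg, ← Finset.sum_mul_sum]; ring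
      rw [this, ENNReal.ofReal_mul (by positivity), ENNReal.ofReal_sum_of_nonneg fun u _ =>
        Finset.sum_nonneg fun v _ => mul_nonneg (hL0 _ _) (hL0 _ _)]
      congr 1
      refine Finset.sum_congr rfl fun u _ => ?_
      rw [ENNReal.ofReal_sum_of_nonneg fun v _ => mul_nonneg (hL0 _ _) (hL0 _ _)]
    have hm2 : ∀ u v, Measurable fun x => ENNReal.ofReal (L u x * L v x) := fun u v =>
      ((hLm u).mul (hLm v)).ennreal_ofReal
    simp_rw [e]
    rw [lintegral_const_mul _ (Finset.measurable_sum _ fun u _ =>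
      Finset.measurable_sum _ fun v _ => hm2 u v), lintegral_finsetSum _ fun u _ =>
      Finset.measurable_sum _ fun v _ => hm2 u v]
    simp_rw [lintegral_finsetSum G fun v _ => hm2 _ v]
    refine (mul_le_mul_right h2 _).trans (le_of_eq ?_)
    rw [← ENNReal.ofReal_mul (by positivity)]
    congr 1
    field_simp
  have hint : Integrable g P := by
    refine ⟨hgm.aestronglyMeasurable, ?_⟩
    rw [hasFiniteIntegral_iff_ofReal (Eventually.of_forall hg0), hg1]
    exact ENNReal.one_lt_top
  have hint2 : Integrable (fun x => g x ^ 2) P := by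
    refine ⟨(hgm.pow_const 2).aestronglyMeasurable, ?_⟩
    rw [hasFiniteIntegral_iff_ofReal (Eventually.of_forall fun x => sq_nonneg _)]
    exact hg2.trans_lt ENNReal.ofReal_lt_top
  have hmean : ∫ x, g x ∂P = 1 := by
    rw [integral_eq_lintegral_of_nonneg_ae (Eventually.of_forall hg0) hgm.aestronglyMeasurable,
      hg1]; rfl
  have hsec : ∫ x, g x ^ 2 ∂P ≤ 1 + η := by
    rw [integral_eq_lintegral_of_nonneg_ae (Eventually.of_forall fun x => sq_nonneg _)
      (hgm.pow_const 2).aestronglyMeasurable]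
    exact ENNReal.toReal_le_of_le_ofReal (by linarith) hg2
  have hsub : Integrable (fun x => g x - 1) P := hint.sub (integrable_const 1)
  have hsub2 : Integrable (fun x => (g x - 1) ^ 2) P := by
    have := (hint2.sub (hint.const_mul 2)).add (integrable_const 1)
    exact this.congr (Eventually.of_forall fun x => by simp; ring)
  have hvar : ∫ x, (g x - 1) ^ 2 ∂P ≤ η := by
    have e : (fun x => (g x - 1) ^ 2) = fun x => (g x ^ 2 - 2 * g x) + 1 := by
      funext x; ring
    have i1 : Integrable (fun x => g x ^ 2 - 2 * g x) P := hint2.sub (hint.const_mul 2)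
    rw [e, integral_add i1 (integrable_const 1), integral_sub hint2 (hint.const_mul 2),
      integral_const_mul, hmean]
    simp only [integral_const, probReal_univ, smul_eq_mul, mul_one]
    linarith
  have habs : ∫ x, |g x - 1| ∂P ≤ √η := by
    -- `2 s |v| ≤ s² + v²` with `s = ∫ |g - 1|`
    set s := ∫ x, |g x - 1| ∂P with hs
    have hs0 : 0 ≤ s := integral_nonneg fun x => abs_nonneg _
    have h1 : ∫ x, 2 * s * |g x - 1| ∂P ≤ ∫ x, s ^ 2 + (g x - 1) ^ 2 ∂P := by
      refine integral_mono (hsub.abs.const_mul _) ((integrable_const _).add hsub2) fun x => ?_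
      simp only
      nlinarith [sq_nonneg (s - |g x - 1|), sq_abs (g x - 1)]
    rw [integral_const_mul, integral_add (integrable_const _) hsub2] at h1
    simp only [integral_const, probReal_univ, smul_eq_mul, one_mul] at h1
    exact Real.le_sqrt_of_sq_le (by nlinarith)
  have hmain : 1 - √η ≤ P.real W + ∫ x in Wᶜ, g x ∂P := by
    have h1 : ∫ x in Wᶜ, g x ∂P = P.real Wᶜ + ∫ x in Wᶜ, (g x - 1) ∂P := by
      rw [integral_sub hint.integrableOn (integrable_const 1)]
      simp
    have h3 : |∫ x in Wᶜ, (g x - 1) ∂P| ≤ ∫ x, |g x - 1| ∂P :=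
      (abs_integral_le_integral_abs).trans
        (setIntegral_le_integral hsub.abs (Eventually.of_forall fun x => abs_nonneg _))
    have h4 := (abs_le.1 h3).1
    have h5 := probReal_add_probReal_compl (μ := P) hW
    rw [h1]; linarith
  rw [← hset, ← ofReal_integral_eq_lintegral_ofReal hint.integrableOn
    (Eventually.of_forall hg0), ← ofReal_measureReal (μ := P) (s := W),
    ← ENNReal.ofReal_add measureReal_nonneg (setIntegral_nonneg hW.compl fun x _ => hg0 x)]
  exact ENNReal.ofReal_le_ofReal hmain

/-! ### Random signs and their autocorrelations -/

section Signs

variable {m p : ℕ}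

/-- The finitely supported sequence `0, u_0, …, u_{m-1}, 0, 0, …` attached to a vector of signs. -/
noncomputable def signSeq (u : Fin m → ℤˣ) (j : ℕ) : ℝ :=
  if h : 1 ≤ j ∧ j ≤ m then ((u ⟨j - 1, by omega⟩ : ℤ) : ℝ) else 0

theorem signSeq_succ (u : Fin m → ℤˣ) (i : Fin m) : signSeq u (i + 1) = ((u i : ℤ) : ℝ) := by
  rw [signSeq, dif_pos ⟨by omega, by omega⟩]; rfl

theorem signSeq_zero (u : Fin m → ℤˣ) : signSeq u 0 = 0 := dif_neg (by omega)

theorem signSeq_of_lt (u : Fin m → ℤˣ) {j : ℕ} (hj : m < j) : signSeq u j = 0 :=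
  dif_neg (by omega)

theorem sign_sq (s : ℤˣ) : ((s : ℤ) : ℝ) ^ 2 = 1 := by
  rcases Int.units_eq_one_or s with h | h <;> simp [h]

theorem abs_signSeq_le (u : Fin m → ℤˣ) (j : ℕ) : |signSeq u j| ≤ 1 := by
  unfold signSeq
  split_ifs with h
  · rcases Int.units_eq_one_or (u ⟨j - 1, by omega⟩) with h | h <;> simp [h]
  · simp

/-- Flipping one sign shows that a product of four signs is centred as soon as one index is
different from the three others. -/
theorem sum_signSeq_mul_eq_zero {b c d e : ℕ} (hc : b ≠ c) (hd : b ≠ d) (he : b ≠ e) :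
    ∑ u : Fin m → ℤˣ, signSeq u b * (signSeq u c * signSeq u d * signSeq u e) = 0 := by
  by_cases hb : 1 ≤ b ∧ b ≤ m
  · let i : Fin m := ⟨b - 1, by omega⟩
    let w : Fin m → ℤˣ := Pi.mulSingle i (-1)
    have hflip : ∀ u : Fin m → ℤˣ, signSeq (w * u) b = -signSeq u b := by
      intro u
      simp only [signSeq, dif_pos hb, Pi.mul_apply, w, i, Pi.mulSingle_eq_same]
      push_cast; ring
    have hkeep : ∀ (u : Fin m → ℤˣ) (x : ℕ), b ≠ x → signSeq (w * u) x = signSeq u x := by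
      intro u x hx
      unfold signSeq
      split_ifs with h
      · have : (⟨x - 1, by omega⟩ : Fin m) ≠ i := fun hh => by
          have := congrArg Fin.val hh
          simp only [i] at this; omega
        simp only [Pi.mul_apply, w, Pi.mulSingle_eq_of_ne this, one_mul]
      · rfl
    have hs := Fintype.sum_equiv (Equiv.mulLeft w)
      (fun u => signSeq (w * u) b * (signSeq (w * u) c * signSeq (w * u) d * signSeq (w * u) e))
      (fun u => signSeq u b * (signSeq u c * signSeq u d * signSeq u e)) fun u => rfl
    simp only [hflip, hkeep _ _ hc, hkeep _ _ hd, hkeep _ _ he, neg_mul,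
      Finset.sum_neg_distrib] at hs
    linarith
  · refine Finset.sum_eq_zero fun u _ => ?_
    rw [signSeq, dif_neg hb, zero_mul]

/-- The autocorrelation at lag `d` of the two-sided sequence `r ↦ signSeq u |r|`. -/
noncomputable def autoCorr (u : Fin m → ℤˣ) (d : ℤ) : ℝ :=
  ∑ r ∈ Finset.Icc (-(m : ℤ)) m, signSeq u r.natAbs * signSeq u (r - d).natAbs

theorem abs_autoCorr_le (u : Fin m → ℤˣ) (d : ℤ) : |autoCorr u d| ≤ 2 * m + 1 := by
  refine (Finset.abs_sum_le_sum_abs _ _).trans ((Finset.sum_le_sum (g := fun _ => (1 : ℝ))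
    fun r _ => ?_).trans ?_)
  · rw [abs_mul]
    exact mul_le_one₀ (abs_signSeq_le _ _) (abs_nonneg _) (abs_signSeq_le _ _)
  · rw [Finset.sum_const, Int.card_Icc, nsmul_eq_mul, mul_one]
    have : ((m : ℤ) + 1 - -(m : ℤ)).toNat = 2 * m + 1 := by omega
    rw [this]; push_cast; exact le_rfl

theorem autoCorr_eq_zero (u : Fin m → ℤˣ) {d : ℤ} (hd : d ∉ Finset.Icc (-(2 * m : ℤ)) (2 * m)) :
    autoCorr u d = 0 := by
  refine Finset.sum_eq_zero fun r hr => ?_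
  rw [Finset.mem_Icc] at hr hd
  rw [signSeq_of_lt u (j := (r - d).natAbs) (by omega), mul_zero]

/-- At a nonzero lag `d`, the product of the terms `r` and `r'` of the autocorrelation is centred
unless `r' ∈ {r, -r, d + r, d - r}`. -/
theorem sum_autoCorr_sq_le (hm : 1 ≤ m) {d : ℤ} (hd : d ≠ 0) :
    ∑ u : Fin m → ℤˣ, autoCorr u d ^ 2 ≤ 2 ^ m * (12 * m) := by
  have e : ∀ u : Fin m → ℤˣ, autoCorr u d ^ 2 =
      ∑ r ∈ Finset.Icc (-(m : ℤ)) m, ∑ r' ∈ Finset.Icc (-(m : ℤ)) m,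
        signSeq u r.natAbs * signSeq u (r - d).natAbs *
          (signSeq u r'.natAbs * signSeq u (r' - d).natAbs) := fun u => by
    rw [sq, autoCorr, Finset.sum_mul_sum]
  simp_rw [e]
  rw [Finset.sum_comm]
  simp_rw [Finset.sum_comm (s := Finset.univ)]
  have hterm : ∀ r r' : ℤ, ∑ u : Fin m → ℤˣ, signSeq u r.natAbs * signSeq u (r - d).natAbs *
      (signSeq u r'.natAbs * signSeq u (r' - d).natAbs) ≤
      if r' ∈ ({r, -r, d + r, d - r} : Finset ℤ) then 2 ^ m else 0 := by
    intro r r'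
    split_ifs with h
    · refine (Finset.sum_le_sum (g := fun _ => (1 : ℝ)) fun u _ => ?_).trans (le_of_eq ?_)
      · refine (le_abs_self _).trans ?_
        rw [abs_mul, abs_mul, abs_mul]
        exact mul_le_one₀ (mul_le_one₀ (abs_signSeq_le _ _) (abs_nonneg _) (abs_signSeq_le _ _))
          (by positivity) (mul_le_one₀ (abs_signSeq_le _ _) (abs_nonneg _) (abs_signSeq_le _ _))
      · simp
    · simp only [Finset.mem_insert, Finset.mem_singleton, not_or] at h
      refine le_of_eq ?_
      by_cases h2 : r.natAbs = (r - d).natAbs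
      · rw [← sum_signSeq_mul_eq_zero (m := m) (b := r'.natAbs) (c := r.natAbs)
          (d := (r - d).natAbs) (e := (r' - d).natAbs) (by omega) (by omega) (by omega)]
        exact Finset.sum_congr rfl fun u _ => by ring
      · rw [← sum_signSeq_mul_eq_zero (m := m) (b := r.natAbs) (c := (r - d).natAbs)
          (d := r'.natAbs) (e := (r' - d).natAbs) (by omega) (by omega) (by omega)]
        exact Finset.sum_congr rfl fun u _ => by ring
  calc _ ≤ ∑ r ∈ Finset.Icc (-(m : ℤ)) m, ∑ r' ∈ Finset.Icc (-(m : ℤ)) m,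
        (if r' ∈ ({r, -r, d + r, d - r} : Finset ℤ) then (2 : ℝ) ^ m else 0) :=
        Finset.sum_le_sum fun r _ => Finset.sum_le_sum fun r' _ => hterm r r'
    _ ≤ ∑ r ∈ Finset.Icc (-(m : ℤ)) m, 4 * (2 : ℝ) ^ m := by
        refine Finset.sum_le_sum fun r _ => ?_
        rw [← Finset.sum_filter, Finset.sum_const, nsmul_eq_mul]
        refine mul_le_mul_of_nonneg_right ?_ (by positivity)
        have h1 : (Finset.filter (fun r' => r' ∈ ({r, -r, d + r, d - r} : Finset ℤ))
            (Finset.Icc (-(m : ℤ)) m)).card ≤ ({r, -r, d + r, d - r} : Finset ℤ).card :=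
          Finset.card_le_card fun x hx => (Finset.mem_filter.1 hx).2
        exact_mod_cast h1.trans Finset.card_le_four
    _ ≤ 2 ^ m * (12 * m) := by
        rw [Finset.sum_const, Int.card_Icc, nsmul_eq_mul]
        have : ((m : ℤ) + 1 - -(m : ℤ)).toNat = 2 * m + 1 := by omega
        rw [this]; push_cast
        have h1 : (1 : ℝ) ≤ m := by exact_mod_cast hm
        have h2 : (0 : ℝ) < 2 ^ m := by positivity
        nlinarith

/-- The sum of the squared autocorrelations at nonzero lags. -/
noncomputable def autoEnergy (u : Fin m → ℤˣ) : ℝ :=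
  ∑ d ∈ (Finset.Icc (-(2 * m : ℤ)) (2 * m)).erase 0, autoCorr u d ^ 2

theorem sum_autoEnergy_le (hm : 1 ≤ m) :
    ∑ u : Fin m → ℤˣ, autoEnergy u ≤ 2 ^ m * (48 * (m : ℝ) ^ 2) := by
  unfold autoEnergy
  rw [Finset.sum_comm]
  refine (Finset.sum_le_sum fun d hd =>
    sum_autoCorr_sq_le hm (Finset.ne_of_mem_erase hd)).trans (le_of_eq ?_)
  rw [Finset.sum_const, Finset.card_erase_of_mem (by simp), Int.card_Icc, nsmul_eq_mul]
  have : ((2 * m : ℤ) + 1 - -(2 * m : ℤ)).toNat - 1 = 4 * m := by omega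
  rw [this]; push_cast; ring

open Classical in
/-- The sign vectors whose autocorrelations at nonzero lags have energy at most `(l m)²`; the mean
energy is of the order `m²`. -/
noncomputable def goodSigns (m : ℕ) (l : ℝ) : Finset (Fin m → ℤˣ) :=
  Finset.univ.filter fun u => autoEnergy u ≤ (l * m) ^ 2

/-- By Markov's inequality, most sign vectors are good. -/
theorem card_goodSigns_ge (hm : 1 ≤ m) {l : ℝ} (hl : 0 < l) :
    (2 : ℝ) ^ m * (1 - 48 / l ^ 2) ≤ (goodSigns m l).card := by
  classical
  have hm' : (0 : ℝ) < m := by exact_mod_cast hm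
  have h1 := Finset.card_filter_add_card_filter_not (s := (Finset.univ : Finset (Fin m → ℤˣ)))
    (fun u => autoEnergy u ≤ (l * m) ^ 2)
  have hcard : (Finset.univ : Finset (Fin m → ℤˣ)).card = 2 ^ m := by simp
  rw [hcard] at h1
  have h2 : ((Finset.univ.filter fun u : Fin m → ℤˣ => ¬ autoEnergy u ≤ (l * m) ^ 2).card : ℝ) *
      (l * m) ^ 2 ≤ 2 ^ m * (48 * (m : ℝ) ^ 2) := by
    refine le_trans ?_ (sum_autoEnergy_le hm)
    rw [← nsmul_eq_mul]
    refine (Finset.card_nsmul_le_sum _ _ _ fun u hu => ?_).trans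
      (Finset.sum_le_sum_of_subset_of_nonneg (Finset.filter_subset _ _) fun u _ _ =>
        Finset.sum_nonneg fun _ _ => sq_nonneg _)
    exact (not_le.1 (Finset.mem_filter.1 hu).2).le
  have h3 : ((Finset.univ.filter fun u : Fin m → ℤˣ => ¬ autoEnergy u ≤ (l * m) ^ 2).card : ℝ) ≤
      2 ^ m * (48 / l ^ 2) := by
    rw [← mul_le_mul_iff_left₀ (show 0 < (l * m) ^ 2 by positivity)]
    refine h2.trans (le_of_eq ?_)
    field_simp
  have h4 : ((goodSigns m l).card : ℝ) +
      (Finset.univ.filter fun u : Fin m → ℤˣ => ¬ autoEnergy u ≤ (l * m) ^ 2).card = 2 ^ m := by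
    have : (goodSigns m l).card +
      (Finset.univ.filter fun u : Fin m → ℤˣ => ¬ autoEnergy u ≤ (l * m) ^ 2).card = 2 ^ m := by
      unfold goodSigns; convert h1
    exact_mod_cast this
  linarith

/-- The Cauchy-Schwarz inequality over the `4m` nonzero lags. -/
theorem sum_abs_autoCorr_le (hm : 1 ≤ m) {l : ℝ} (hl : 1 ≤ l) {u : Fin m → ℤˣ}
    (hu : u ∈ goodSigns m l) :
    ∑ d ∈ Finset.Icc (-(2 * m : ℤ)) (2 * m), |autoCorr u d| ≤ 5 * (l * (m * √m)) := by
  have hm' : (1 : ℝ) ≤ m := by exact_mod_cast hm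
  have hs1 : 1 ≤ √(m : ℝ) := Real.one_le_sqrt.2 hm'
  have hen : autoEnergy u ≤ (l * m) ^ 2 := by
    classical
    unfold goodSigns at hu
    exact (Finset.mem_filter.1 hu).2
  rw [← Finset.add_sum_erase _ _ (show (0 : ℤ) ∈ Finset.Icc (-(2 * m : ℤ)) (2 * m) by simp)]
  have h1 : ∑ d ∈ (Finset.Icc (-(2 * m : ℤ)) (2 * m)).erase 0, |autoCorr u d| ≤
      2 * (l * (m * √m)) := by
    refine abs_le_of_sq_le_sq' ?_ (by positivity) |>.2
    have h := sq_sum_le_card_mul_sum_sq (s := (Finset.Icc (-(2 * m : ℤ)) (2 * m)).erase 0)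
      (f := fun d => |autoCorr u d|)
    simp only [sq_abs] at h
    rw [Finset.card_erase_of_mem (by simp), Int.card_Icc,
      show ((2 * m : ℤ) + 1 - -(2 * m : ℤ)).toNat - 1 = 4 * m by omega] at h
    refine h.trans ?_
    push_cast
    refine (mul_le_mul_of_nonneg_left hen (by positivity)).trans (le_of_eq ?_)
    rw [mul_pow, mul_pow, mul_pow, mul_pow, Real.sq_sqrt (by positivity)]; ring
  have h2 := abs_autoCorr_le u 0
  have h3 : (m : ℝ) ≤ l * (m * √m) := by
    calc (m : ℝ) = 1 * (m * 1) := by ring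
      _ ≤ l * (m * √m) := by gcongr
  linarith

end Signs

/-! ### The least favourable sequences -/

section Perturbation

open Matrix

variable {m p : ℕ}

/-- The Toeplitz sequence with `σ_0 = 1` and `σ_j = ± c` for `1 ≤ j ≤ m`. -/
noncomputable def signSigma (c : ℝ) (u : Fin m → ℤˣ) (j : ℕ) : ℝ :=
  if j = 0 then 1 else c * signSeq u j

/-- The off-diagonal part of the Toeplitz matrix of `signSigma`. -/
noncomputable def signMat (p : ℕ) (c : ℝ) (u : Fin m → ℤˣ) : Matrix (Fin p) (Fin p) ℝ :=
  Matrix.of fun i j => c * signSeq u ((i : ℤ) - j).natAbs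

theorem toeplitzSection_signSigma (c : ℝ) (u : Fin m → ℤˣ) :
    toeplitzSection (signSigma c u) p = 1 + signMat p c u := by
  ext i j
  simp only [toeplitzSection, signSigma, signMat, of_apply, Matrix.add_apply, one_apply]
  by_cases h : i = j
  · subst h; simp [signSeq_zero]
  · rw [if_neg h, if_neg, zero_add]
    intro h'; apply h; ext; omega

theorem signMat_transpose (c : ℝ) (u : Fin m → ℤˣ) : (signMat p c u)ᵀ = signMat p c u := by
  ext i j
  simp only [signMat, transpose_apply, of_apply]
  rw [show ((j : ℤ) - i).natAbs = ((i : ℤ) - j).natAbs by omega]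

/-- Translation of the index: on the window `[-m, p + m]` no term of the autocorrelation is lost. -/
theorem sum_signSeq_shift (u : Fin m → ℤˣ) (j j' : Fin p) :
    ∑ i ∈ Finset.Icc (-(m : ℤ)) (p + m), signSeq u (i - j).natAbs * signSeq u (i - j').natAbs =
      autoCorr u ((j' : ℤ) - j) := by
  have hmap : (Finset.Icc (-(m : ℤ)) m).map (addRightEmbedding (j : ℤ)) ⊆
      Finset.Icc (-(m : ℤ)) (p + m) := by
    intro x hx
    simp only [Finset.mem_map, Finset.mem_Icc, addRightEmbedding_apply] at hx ⊢
    obtain ⟨y, hy, rfl⟩ := hx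
    have := j.isLt
    omega
  rw [← Finset.sum_subset hmap, Finset.sum_map]
  · refine Finset.sum_congr rfl fun r _ => ?_
    simp only [addRightEmbedding_apply]
    rw [show r + (j : ℤ) - j = r by ring, show r + (j : ℤ) - j' = r - ((j' : ℤ) - j) by ring]
  · intro x _ hx
    rw [signSeq_of_lt u (j := (x - j).natAbs), zero_mul]
    by_contra hlt
    apply hx
    simp only [Finset.mem_map, Finset.mem_Icc, addRightEmbedding_apply]
    exact ⟨x - j, by omega, by omega⟩

/-- The operator norm of a Toeplitz matrix through the autocorrelations of its diagonals: `‖Ax‖²`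
is at most a quadratic form with the Toeplitz matrix of the autocorrelations, to which Schur's test
applies. -/
theorem opSqBound_signMat (c : ℝ) (u : Fin m → ℤˣ) :
    OpSqBound (signMat p c u)
      (c ^ 2 * ∑ d ∈ Finset.Icc (-(2 * m : ℤ)) (2 * m), |autoCorr u d|) := by
  intro x
  set C := ∑ d ∈ Finset.Icc (-(2 * m : ℤ)) (2 * m), |autoCorr u d| with hC
  let f : ℤ → ℝ := fun i => ∑ j : Fin p, signSeq u (i - j).natAbs * x j
  have h1 : (signMat p c u *ᵥ x) ⬝ᵥ (signMat p c u *ᵥ x) = c ^ 2 * ∑ i : Fin p, f i ^ 2 := by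
    simp only [dotProduct, Finset.mul_sum, f]
    refine Finset.sum_congr rfl fun i _ => ?_
    have : (signMat p c u *ᵥ x) i = c * ∑ j : Fin p, signSeq u ((i : ℤ) - j).natAbs * x j := by
      simp only [mulVec, dotProduct, signMat, of_apply, Finset.mul_sum]
      exact Finset.sum_congr rfl fun j _ => by ring
    rw [this]; ring
  -- extending the range of `i` turns the inner sums into full autocorrelations
  have h2 : ∑ i : Fin p, f i ^ 2 ≤ ∑ i ∈ Finset.Icc (-(m : ℤ)) (p + m), f i ^ 2 := by
    let emb : Fin p ↪ ℤ := ⟨fun i => (i : ℤ), fun a b h => by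
      ext; simpa using h⟩
    rw [show ∑ i : Fin p, f i ^ 2 = ∑ i ∈ Finset.univ.map emb, f i ^ 2 by
      rw [Finset.sum_map]; rfl]
    refine Finset.sum_le_sum_of_subset_of_nonneg ?_ fun _ _ _ => sq_nonneg _
    intro y hy
    obtain ⟨i, _, rfl⟩ := Finset.mem_map.1 hy
    rw [Finset.mem_Icc]
    have : emb i = (i : ℤ) := rfl
    have := i.isLt
    omega
  have h3 : ∑ i ∈ Finset.Icc (-(m : ℤ)) (p + m), f i ^ 2 =
      ∑ j : Fin p, ∑ j' : Fin p, x j * x j' * autoCorr u ((j' : ℤ) - j) := by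
    simp_rw [← sum_signSeq_shift, Finset.mul_sum, f, sq, Finset.sum_mul_sum]
    rw [Finset.sum_comm]
    refine Finset.sum_congr rfl fun j _ => ?_
    rw [Finset.sum_comm]
    exact Finset.sum_congr rfl fun j' _ => Finset.sum_congr rfl fun i _ => by ring
  -- Schur's test: absolute row and column sums
  have hrow : ∀ g : Fin p → ℤ, Function.Injective g → ∑ j, |autoCorr u (g j)| ≤ C := by
    intro g hg
    rw [show ∑ j, |autoCorr u (g j)| = ∑ d ∈ Finset.univ.map ⟨g, hg⟩, |autoCorr u d| from
      (Finset.sum_map Finset.univ ⟨g, hg⟩ fun d => |autoCorr u d|).symm,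
      ← Finset.sum_filter_add_sum_filter_not _ (fun d => d ∈ Finset.Icc (-(2 * m : ℤ)) (2 * m)),
      Finset.sum_eq_zero (s := Finset.filter (fun d => ¬ _) _) (fun d hd => by
        rw [autoCorr_eq_zero u (Finset.mem_filter.1 hd).2, abs_zero]), add_zero]
    exact Finset.sum_le_sum_of_subset_of_nonneg (fun d hd => (Finset.mem_filter.1 hd).2)
      fun _ _ _ => abs_nonneg _
  have h4 : ∑ j : Fin p, ∑ j' : Fin p, x j * x j' * autoCorr u ((j' : ℤ) - j) ≤ C * (x ⬝ᵥ x) := by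
    calc _ ≤ ∑ j : Fin p, ∑ j' : Fin p, (x j ^ 2 * |autoCorr u ((j' : ℤ) - j)| / 2 +
          x j' ^ 2 * |autoCorr u ((j' : ℤ) - j)| / 2) := by
          refine Finset.sum_le_sum fun j _ => Finset.sum_le_sum fun j' _ => ?_
          refine (le_abs_self _).trans ?_
          rw [abs_mul]
          have h : |x j * x j'| ≤ (x j ^ 2 + x j' ^ 2) / 2 := by
            rw [abs_le]; constructor <;> nlinarith [sq_nonneg (x j + x j'), sq_nonneg (x j - x j')]
          nlinarith [mul_le_mul_of_nonneg_right h (abs_nonneg (autoCorr u ((j' : ℤ) - j)))]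
      _ ≤ ∑ j : Fin p, x j ^ 2 * C / 2 + ∑ j' : Fin p, x j' ^ 2 * C / 2 := by
          simp_rw [Finset.sum_add_distrib]
          rw [Finset.sum_comm (f := fun j j' : Fin p =>
            x j' ^ 2 * |autoCorr u ((j' : ℤ) - j)| / 2)]
          simp_rw [← Finset.sum_div, ← Finset.mul_sum]
          gcongr with j _ j' _
          · exact hrow (fun j' => (j' : ℤ) - j) fun b b' h => by ext; simp at h; omega
          · exact hrow (fun j => (j' : ℤ) - j) fun b b' h => by ext; simp at h; omega
      _ = C * (x ⬝ᵥ x) := by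
          rw [← Finset.sum_add_distrib, dotProduct, Finset.mul_sum]
          exact Finset.sum_congr rfl fun j _ => by ring
  rw [h1, mul_assoc]
  exact mul_le_mul_of_nonneg_left ((h2.trans_eq h3).trans h4) (sq_nonneg c)

theorem OpSqBound.mono {A : Matrix (Fin p) (Fin p) ℝ} {D D' : ℝ} (hA : OpSqBound A D)
    (h : D ≤ D') : OpSqBound A D' := fun x =>
  (hA x).trans (mul_le_mul_of_nonneg_right h (dotProduct_self_nonneg' x))

theorem opSqBound_signMat_of_good (hm : 1 ≤ m) {l : ℝ} (hl : 1 ≤ l) {u : Fin m → ℤˣ}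
    (hu : u ∈ goodSigns m l) (φ : ℝ) :
    OpSqBound (signMat p (φ / √m) u) (5 * φ ^ 2 * l * √m) := by
  refine (opSqBound_signMat _ u).mono ?_
  have hm' : (0 : ℝ) < m := by exact_mod_cast hm
  refine (mul_le_mul_of_nonneg_left (sum_abs_autoCorr_le hm hl hu) (sq_nonneg _)).trans
    (le_of_eq ?_)
  rw [div_pow, Real.sq_sqrt hm'.le]
  field_simp

/-- The sign sequences belong to the alternative when `m^α φ ≤ 1`. -/
theorem signSigma_mem_alternative {α φ l : ℝ} (hα : 0 ≤ α) (hφ : 0 < φ) (hm : 1 ≤ m) (hl : 1 ≤ l)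
    (hmφ : (m : ℝ) ^ α * φ ≤ 1) (hD : 5 * φ ^ 2 * l * √m ≤ 1 / 64) {u : Fin m → ℤˣ}
    (hu : u ∈ goodSigns m l) : signSigma (φ / √m) u ∈ toeplitzAlternative α φ := by
  have hm' : (0 : ℝ) < m := by exact_mod_cast hm
  have hsq : ∀ j : ℕ, signSigma (φ / √m) u (j + 1) ^ 2 = if j < m then φ ^ 2 / m else 0 := by
    intro j
    rw [signSigma, if_neg (by omega)]
    split_ifs with h
    · have := signSeq_succ u ⟨j, h⟩
      simp only at this
      rw [this, mul_pow, sign_sq, div_pow, Real.sq_sqrt hm'.le, mul_one]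
    · rw [signSeq_of_lt u (by omega)]; simp
  have hz1 : ∀ j ∉ Finset.range m, signSigma (φ / √m) u (j + 1) ^ 2 = 0 := fun j hj => by
    rw [hsq, if_neg (by simpa using hj)]
  have hz2 : ∀ j ∉ Finset.range m,
      signSigma (φ / √m) u (j + 1) ^ 2 * ((j : ℝ) + 1) ^ (2 * α) = 0 := fun j hj => by
    rw [hz1 j hj, zero_mul]
  refine ⟨⟨fun p => ?_, by simp [signSigma], summable_of_ne_finset_zero hz2, ?_⟩, ?_⟩
  · rw [toeplitzSection_signSigma]
    exact posDef_one_add (signMat_transpose _ _) (opSqBound_signMat_of_good hm hl hu φ) hD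
  · rw [tsum_eq_sum hz2]
    calc _ ≤ ∑ j ∈ Finset.range m, φ ^ 2 / m * (m : ℝ) ^ (2 * α) := by
          refine Finset.sum_le_sum fun j hj => ?_
          rw [hsq, if_pos (Finset.mem_range.1 hj)]
          refine mul_le_mul_of_nonneg_left (Real.rpow_le_rpow (by positivity) ?_ (by positivity))
            (by positivity)
          exact_mod_cast Finset.mem_range.1 hj
      _ = ((m : ℝ) ^ α * φ) ^ 2 := by
          rw [Finset.sum_const, Finset.card_range, nsmul_eq_mul, mul_comm 2 α, Real.rpow_mul hm'.le,
            mul_pow]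
          have : (((m : ℝ) ^ α) ^ (2 : ℝ)) = ((m : ℝ) ^ α) ^ 2 := by
            exact_mod_cast Real.rpow_natCast ((m : ℝ) ^ α) 2
          rw [this]; field_simp
      _ ≤ 1 := pow_le_one₀ (by positivity) hmφ
  · rw [tsum_eq_sum hz1]
    refine le_of_eq ?_
    rw [Finset.sum_congr rfl fun j hj => by rw [hsq, if_pos (Finset.mem_range.1 hj)],
      Finset.sum_const, Finset.card_range, nsmul_eq_mul]
    field_simp

end Perturbation

/-! ### Counting observed pairs -/

section PairCount

variable {p : ℕ}

/-- The number of pairs of observed coordinates at distance `d`, for a `0`-`1` mask `z`. -/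
noncomputable def pairCount (d : ℕ) (z : Fin p → ℝ) : ℝ :=
  ∑ i : Fin p, ∑ j : Fin p, if (i : ℕ) = j + d then z i * z j else 0

/-- A Toeplitz sum over the observed coordinates is a sum over lags. -/
theorem sum_mask_toeplitz {m : ℕ} {f : ℕ → ℝ} (h0 : f 0 = 0) (hf : ∀ j, m < j → f j = 0)
    (z : Fin p → ℝ) :
    ∑ i : Fin p, ∑ j : Fin p, z i * z j * f ((i : ℤ) - j).natAbs =
      2 * ∑ k : Fin m, f (k + 1) * pairCount (k + 1) z := by
  have hsel : ∀ (i j : ℕ) (w : ℝ), ∑ k : Fin m, f (k + 1) * (if i = j + (k + 1) then w else 0) =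
      if j < i then f (i - j) * w else 0 := by
    intro i j w
    split_ifs with h
    · by_cases hm : i - j ≤ m
      · rw [Finset.sum_eq_single ⟨i - j - 1, by omega⟩]
        · rw [if_pos (by simp only; omega)]
          simp only
          rw [show i - j - 1 + 1 = i - j by omega]
        · intro k _ hk
          rw [if_neg, mul_zero]
          intro he; apply hk; ext; simp only; omega
        · simp
      · rw [hf _ (by omega), zero_mul]
        refine Finset.sum_eq_zero fun k _ => ?_
        rw [if_neg (by omega), mul_zero]
    · refine Finset.sum_eq_zero fun k _ => ?_
      rw [if_neg (by omega), mul_zero]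
  have hsum : ∑ k : Fin m, f (k + 1) * pairCount (k + 1) z =
      ∑ i : Fin p, ∑ j : Fin p, if (j : ℕ) < i then f (i - j) * (z i * z j) else 0 := by
    simp_rw [pairCount, Finset.mul_sum]
    rw [Finset.sum_comm]
    refine Finset.sum_congr rfl fun i _ => ?_
    rw [Finset.sum_comm]
    exact Finset.sum_congr rfl fun j _ => hsel i j _
  have hsum' := hsum
  rw [Finset.sum_comm] at hsum'
  rw [two_mul]
  nth_rewrite 1 [hsum']
  rw [hsum, ← Finset.sum_add_distrib]
  refine Finset.sum_congr rfl fun i _ => ?_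
  rw [← Finset.sum_add_distrib]
  refine Finset.sum_congr rfl fun j _ => ?_
  rcases lt_trichotomy (i : ℕ) j with h | h | h
  · rw [if_pos h, if_neg (by omega), show ((i : ℤ) - j).natAbs = (j : ℕ) - i by omega]; ring
  · rw [if_neg (by omega), if_neg (by omega), show ((i : ℤ) - j).natAbs = 0 by omega, h0]; ring
  · rw [if_neg (by omega), if_pos h, show ((i : ℤ) - j).natAbs = (i : ℕ) - j by omega]; ring

/-- The pairs of coordinates at distance `d`. -/
def lagPairs (p d : ℕ) : Finset (Fin p × Fin p) :=
  Finset.univ.filter fun q => (q.1 : ℕ) = q.2 + d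

theorem pairCount_eq (d : ℕ) (z : Fin p → ℝ) :
    pairCount d z = ∑ q ∈ lagPairs p d, z q.1 * z q.2 := by
  rw [pairCount, lagPairs, Finset.sum_filter, Fintype.sum_prod_type]

theorem card_lagPairs_le (p d : ℕ) : (lagPairs p d).card ≤ p := by
  have := Finset.card_le_card_of_injOn (s := lagPairs p d) (t := (Finset.univ : Finset (Fin p)))
    (fun q => q.2) (fun _ _ => Finset.mem_univ _) fun q hq q' hq' h => by
      simp only [lagPairs, Finset.coe_filter, Finset.mem_univ, true_and, Set.mem_ofPred_eq] at hq hq'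
      simp only at h
      refine Prod.ext ?_ h
      ext; rw [hq, hq', h]
  simpa using this

/-- The mean and the second moment of a pair count. The excess of the second moment over the squared
mean comes from couples of pairs that share a coordinate. -/
theorem pairCount_moments (a : unitInterval) {d : ℕ} (hd : 1 ≤ d) :
    MemLp (pairCount (p := p) d) 2 (maskLaw a p) ∧
    ∫ z, pairCount d z ∂(maskLaw a p) = (lagPairs p d).card * (a : ℝ) ^ 2 ∧
    ∫ z, pairCount d z ^ 2 ∂(maskLaw a p) ≤
      ((lagPairs p d).card * (a : ℝ) ^ 2) ^ 2 + 3 * p * (a : ℝ) ^ 2 := by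
  classical
  have hne : ∀ q ∈ lagPairs p d, q.1 ≠ q.2 := fun q hq h => by
    have h1 := (Finset.mem_filter.1 hq).2
    rw [h] at h1; omega
  have hsq : ∀ z : Fin p → ℝ, pairCount d z ^ 2 = ∑ q ∈ lagPairs p d, ∑ r ∈ lagPairs p d,
      z q.1 * z q.2 * z r.1 * z r.2 := fun z => by
    rw [sq, pairCount_eq, Finset.sum_mul_sum]
    exact Finset.sum_congr rfl fun q _ => Finset.sum_congr rfl fun r _ => by ring
  have hint2 : Integrable (fun z : Fin p → ℝ => pairCount d z ^ 2) (maskLaw a p) := by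
    simp_rw [hsq]
    exact integrable_finsetSum _ fun q _ => integrable_finsetSum _ fun r _ =>
      (integral_four_mask a q.1 q.2 r.1 r.2).1
  have hmeas : Measurable (pairCount (p := p) d) := by
    have : pairCount (p := p) d = fun z => ∑ q ∈ lagPairs p d, z q.1 * z q.2 := by
      funext z; exact pairCount_eq d z
    rw [this]; fun_prop
  refine ⟨(memLp_two_iff_integrable_sq hmeas.aestronglyMeasurable).2 hint2, ?_, ?_⟩
  · simp_rw [pairCount_eq]
    rw [integral_finsetSum _ fun q hq => (integral_two_mask a (hne q hq)).1,
      Finset.sum_congr rfl fun q hq => (integral_two_mask a (hne q hq)).2, Finset.sum_const,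
      nsmul_eq_mul]
  · simp_rw [hsq]
    rw [integral_finsetSum _ fun q _ => integrable_finsetSum _ fun r _ =>
      (integral_four_mask a q.1 q.2 r.1 r.2).1]
    rw [Finset.sum_congr rfl fun q _ => integral_finsetSum _ fun r _ =>
      (integral_four_mask a q.1 q.2 r.1 r.2).1]
    simp_rw [fun q r : Fin p × Fin p => (integral_four_mask a q.1 q.2 r.1 r.2).2]
    have ha0 : (0 : ℝ) ≤ a := a.2.1
    have ha1 : (a : ℝ) ≤ 1 := a.2.2
    -- at most three pairs `r` at distance `d` meet a given pair `q`
    have hterm : ∀ q ∈ lagPairs p d, ∀ r ∈ lagPairs p d,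
        (a : ℝ) ^ (({q.1, q.2, r.1, r.2} : Finset (Fin p)).card) ≤ (a : ℝ) ^ 4 +
          ((if r = q then (a : ℝ) ^ 2 else 0) + (if r.1 = q.2 then (a : ℝ) ^ 2 else 0) +
            (if r.2 = q.1 then (a : ℝ) ^ 2 else 0)) := by
      intro q hq r hr
      have hq' := (Finset.mem_filter.1 hq).2
      have hr' := (Finset.mem_filter.1 hr).2
      by_cases hc : r = q ∨ r.1 = q.2 ∨ r.2 = q.1
      · have h2 : 2 ≤ ({q.1, q.2, r.1, r.2} : Finset (Fin p)).card := by
          rw [← Finset.card_pair (hne q hq)]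
          exact Finset.card_le_card fun x hx => by
            simp only [Finset.mem_insert, Finset.mem_singleton] at hx ⊢; tauto
        have h3 := pow_le_pow_of_le_one ha0 ha1 h2
        have h4 : (0 : ℝ) ≤ (a : ℝ) ^ 4 := by positivity
        have h5 : (0 : ℝ) ≤ (a : ℝ) ^ 2 := by positivity
        rcases hc with h | h | h
        · rw [if_pos h]; split_ifs <;> linarith
        · rw [if_pos h]; split_ifs <;> linarith
        · rw [if_pos h]; split_ifs <;> linarith
      · simp only [not_or] at hc
        have h11 : r.1 ≠ q.1 := fun h => hc.1 (Prod.ext h (by ext; rw [h] at hr'; omega))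
        have h22 : r.2 ≠ q.2 := fun h => hc.1 (Prod.ext (by ext; rw [h] at hr'; omega) h)
        have h4 : ({q.1, q.2, r.1, r.2} : Finset (Fin p)).card = 4 := by
          rw [Finset.card_insert_of_notMem, Finset.card_insert_of_notMem,
            Finset.card_pair (hne r hr)]
          · simp only [Finset.mem_insert, Finset.mem_singleton, not_or]
            exact ⟨Ne.symm hc.2.1, h22.symm⟩
          · simp only [Finset.mem_insert, Finset.mem_singleton, not_or]
            exact ⟨hne q hq, h11.symm, Ne.symm hc.2.2⟩
        rw [if_neg hc.1, if_neg hc.2.1, if_neg hc.2.2, h4]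
        simp
    have hcount : ∀ (P : Fin p × Fin p → Prop) [DecidablePred P],
        (∀ r ∈ lagPairs p d, ∀ r' ∈ lagPairs p d, P r → P r' → r = r') →
        ∑ r ∈ lagPairs p d, (if P r then (a : ℝ) ^ 2 else 0) ≤ (a : ℝ) ^ 2 := by
      intro P _ hP
      rw [← Finset.sum_filter, Finset.sum_const, nsmul_eq_mul]
      have : ((lagPairs p d).filter P).card ≤ 1 := Finset.card_le_one.2 fun r hr r' hr' =>
        hP r (Finset.mem_filter.1 hr).1 r' (Finset.mem_filter.1 hr').1 (Finset.mem_filter.1 hr).2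
          (Finset.mem_filter.1 hr').2
      have h' : (((lagPairs p d).filter P).card : ℝ) ≤ 1 := by exact_mod_cast this
      exact mul_le_of_le_one_left (by positivity) h'
    calc _ ≤ ∑ q ∈ lagPairs p d, ((lagPairs p d).card * (a : ℝ) ^ 4 + 3 * (a : ℝ) ^ 2) := by
          refine Finset.sum_le_sum fun q hq => (Finset.sum_le_sum (hterm q hq)).trans ?_
          rw [Finset.sum_add_distrib, Finset.sum_const, nsmul_eq_mul, Finset.sum_add_distrib,
            Finset.sum_add_distrib]
          have e1 := hcount (fun r => r = q) fun r _ r' _ h h' => h.trans h'.symm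
          have e2 := hcount (fun r => r.1 = q.2) fun r hr r' hr' h h' => by
            have g := (Finset.mem_filter.1 hr).2
            have g' := (Finset.mem_filter.1 hr').2
            rw [h] at g; rw [h'] at g'
            exact Prod.ext (h.trans h'.symm) (by ext; omega)
          have e3 := hcount (fun r => r.2 = q.1) fun r hr r' hr' h h' => by
            have g := (Finset.mem_filter.1 hr).2
            have g' := (Finset.mem_filter.1 hr').2
            rw [h] at g; rw [h'] at g'
            exact Prod.ext (by ext; omega) (h.trans h'.symm)
          linarith
      _ ≤ _ := by
          rw [Finset.sum_const, nsmul_eq_mul]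
          have h1 : ((lagPairs p d).card : ℝ) ≤ p := by exact_mod_cast card_lagPairs_le p d
          have h2 : (0 : ℝ) ≤ (a : ℝ) ^ 2 := by positivity
          nlinarith [mul_le_mul_of_nonneg_right h1 h2]

/-- The number of pairs of observed coordinates at distance `d` in the whole sample. -/
noncomputable def totalCount {n : ℕ} (d : ℕ) (ε : Fin n → Fin p → ℝ) : ℝ :=
  ∑ k, pairCount d (ε k)

/-- Since the masks of different vectors are independent, the variances of their pair counts sum up. -/
theorem integral_totalCount_sq_le (n : ℕ) (a : unitInterval) {d : ℕ} (hd : 1 ≤ d) :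
    Integrable (fun ε : Fin n → Fin p → ℝ => totalCount d ε ^ 2) (masksLaw n p a) ∧
    ∫ ε, totalCount d ε ^ 2 ∂(masksLaw n p a) ≤
      ((a : ℝ) ^ 2 * n * p) ^ 2 + 3 * ((a : ℝ) ^ 2 * n * p) := by
  obtain ⟨hL, hmean, hsec⟩ := pairCount_moments (p := p) a hd
  have hmem : ∀ k : Fin n, MemLp (fun ε : Fin n → Fin p → ℝ => pairCount d (ε k)) 2
      (masksLaw n p a) := fun k =>
    hL.comp_measurePreserving (measurePreserving_eval (fun _ : Fin n => maskLaw a p) k)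
  have htot : MemLp (totalCount (p := p) (n := n) d) 2 (masksLaw n p a) := by
    have := memLp_finsetSum' Finset.univ fun k _ => hmem k
    convert this using 1
    funext ε; simp [totalCount]
  have hvar : Var[totalCount (p := p) (n := n) d; masksLaw n p a] =
      ∑ _k : Fin n, Var[pairCount (p := p) d; maskLaw a p] := by
    have := variance_sum_pi (μ := fun _ : Fin n => maskLaw a p)
      (X := fun _ => pairCount (p := p) d) fun _ => hL
    rw [← this]
    congr 1
    funext ε; simp [totalCount]
  have hv1 : Var[pairCount (p := p) d; maskLaw a p] ≤ 3 * p * (a : ℝ) ^ 2 := by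
    rw [variance_eq_sub hL]
    simp only [Pi.pow_apply]
    rw [hmean]; linarith
  have hm : ∫ ε, totalCount (p := p) (n := n) d ε ∂(masksLaw n p a) =
      n * ((lagPairs p d).card * (a : ℝ) ^ 2) := by
    unfold totalCount
    rw [integral_finsetSum _ fun k _ => (hmem k).integrable (by norm_num)]
    have : ∀ k : Fin n, ∫ ε : Fin n → Fin p → ℝ, pairCount d (ε k) ∂(masksLaw n p a) =
        (lagPairs p d).card * (a : ℝ) ^ 2 := fun k => by
      rw [← hmean]
      exact integral_comp_eval (μ := fun _ : Fin n => maskLaw a p) (i := k)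
        hL.aestronglyMeasurable
    rw [Finset.sum_congr rfl fun k _ => this k, Finset.sum_const, Finset.card_univ,
      Fintype.card_fin, nsmul_eq_mul]
  refine ⟨htot.integrable_sq, ?_⟩
  have hv := variance_eq_sub htot
  simp only [Pi.pow_apply] at hv
  rw [hvar, hm, Finset.sum_const, Finset.card_univ, Fintype.card_fin, nsmul_eq_mul] at hv
  have h1 : ((lagPairs p d).card : ℝ) ≤ p := by exact_mod_cast card_lagPairs_le p d
  have h2 : (n : ℝ) * ((lagPairs p d).card * (a : ℝ) ^ 2) ≤ (a : ℝ) ^ 2 * n * p := by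
    calc _ = (a : ℝ) ^ 2 * n * (lagPairs p d).card := by ring
      _ ≤ _ := mul_le_mul_of_nonneg_left h1 (by positivity)
  have h3 := pow_le_pow_left₀ (by positivity) h2 2
  have h4 := mul_le_mul_of_nonneg_left hv1 (Nat.cast_nonneg (α := ℝ) n)
  nlinarith

end PairCount

/-! ### The second moment of the mixture, given the masks -/

section Mixture

open Matrix

variable {m n p : ℕ}

/-- Given `v`, the products `u_i v_i` are independent signs, and
`cosh x ≤ exp (x² / 2)`. -/
theorem sum_exp_signs_le (c : Fin m → ℝ) :
    ∑ u : Fin m → ℤˣ, ∑ v : Fin m → ℤˣ,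
        Real.exp (∑ i, ((u i : ℤ) : ℝ) * ((v i : ℤ) : ℝ) * c i) ≤
      4 ^ m * Real.exp (∑ i, c i ^ 2 / 2) := by
  have hone : ∀ (x : ℝ), ∑ s : ℤˣ, Real.exp (((s : ℤ) : ℝ) * x) ≤ 2 * Real.exp (x ^ 2 / 2) := by
    intro x
    have : (Finset.univ : Finset ℤˣ) = {1, -1} := by decide
    rw [this, Finset.sum_pair (by decide)]
    have h := Real.cosh_le_exp_half_sq x
    rw [Real.cosh_eq] at h
    simp only [Units.val_one, Int.cast_one, one_mul, Units.val_neg, Int.cast_neg, neg_mul]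
    linarith
  have hinner : ∀ v : Fin m → ℤˣ, ∑ u : Fin m → ℤˣ,
      Real.exp (∑ i, ((u i : ℤ) : ℝ) * ((v i : ℤ) : ℝ) * c i) ≤
        2 ^ m * Real.exp (∑ i, c i ^ 2 / 2) := by
    intro v
    have hprod := Fintype.piFinset_univ (α := Fin m) (β := fun _ => ℤˣ)
    have h := Finset.prod_univ_sum (fun _ : Fin m => (Finset.univ : Finset ℤˣ))
      (fun i s => Real.exp (((s : ℤ) : ℝ) * (((v i : ℤ) : ℝ) * c i)))
    rw [hprod] at h
    calc _ = ∑ u : Fin m → ℤˣ, ∏ i, Real.exp (((u i : ℤ) : ℝ) * (((v i : ℤ) : ℝ) * c i)) :=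
          Finset.sum_congr rfl fun u _ => by
            rw [← Real.exp_sum]
            congr 1
            exact Finset.sum_congr rfl fun i _ => by ring
      _ = ∏ i, ∑ s : ℤˣ, Real.exp (((s : ℤ) : ℝ) * (((v i : ℤ) : ℝ) * c i)) := h.symm
      _ ≤ ∏ i, 2 * Real.exp (c i ^ 2 / 2) := by
          refine Finset.prod_le_prod (fun i _ => Finset.sum_nonneg fun _ _ => (Real.exp_pos _).le)
            fun i _ => (hone _).trans (le_of_eq ?_)
          rw [mul_pow, sign_sq, one_mul]
      _ = _ := by
          rw [Finset.prod_mul_distrib, Finset.prod_const, Finset.card_univ, Fintype.card_fin,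
            Real.exp_sum]
  rw [Finset.sum_comm]
  refine (Finset.sum_le_sum fun v _ => hinner v).trans (le_of_eq ?_)
  rw [Finset.sum_const, nsmul_eq_mul, ← mul_assoc]
  congr 1
  rw [Finset.card_univ, Fintype.card_fun, Fintype.card_fin, Fintype.card_units_int]
  push_cast
  rw [← mul_pow]; norm_num

/-- The main term of the exponent, as a linear form in the products of signs. -/
theorem sum_trace_maskMat (c : ℝ) (u v : Fin m → ℤˣ) {ε : Fin n → Fin p → ℝ}
    (hε : ∀ k i, ε k i = 0 ∨ ε k i = 1) :
    ∑ k, trace (maskMat (ε k) (signMat p c u) * maskMat (ε k) (signMat p c v)) / 2 =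
      ∑ i : Fin m, ((u i : ℤ) : ℝ) * ((v i : ℤ) : ℝ) * (c ^ 2 * totalCount (i + 1) ε) := by
  have hidem : ∀ k i, ε k i * ε k i = ε k i := fun k i => by
    rcases hε k i with h | h <;> simp [h]
  have h1 : ∀ k, trace (maskMat (ε k) (signMat p c u) * maskMat (ε k) (signMat p c v)) / 2 =
      ∑ i : Fin m, c ^ 2 * (((u i : ℤ) : ℝ) * ((v i : ℤ) : ℝ)) * pairCount (i + 1) (ε k) := by
    intro k
    have h := sum_mask_toeplitz (m := m) (f := fun j => c ^ 2 * (signSeq u j * signSeq v j))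
      (by simp [signSeq_zero]) (fun j hj => by simp [signSeq_of_lt u hj]) (ε k)
    simp only [signSeq_succ] at h
    rw [eq_comm, ← mul_right_inj' (two_ne_zero (α := ℝ)), ← h, mul_div_cancel₀ _ two_ne_zero]
    simp only [trace, diag, Matrix.mul_apply, maskMat, signMat, of_apply]
    refine Finset.sum_congr rfl fun i _ => Finset.sum_congr rfl fun j _ => ?_
    rw [show ((j : ℤ) - i).natAbs = ((i : ℤ) - j).natAbs by omega]
    rw [show ε k i * (c * signSeq u ((i : ℤ) - j).natAbs) * ε k j *
      (ε k j * (c * signSeq v ((i : ℤ) - j).natAbs) * ε k i) = (ε k i * ε k i) * (ε k j * ε k j) *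
        (c ^ 2 * (signSeq u ((i : ℤ) - j).natAbs * signSeq v ((i : ℤ) - j).natAbs)) by ring,
      hidem, hidem]
  rw [Finset.sum_congr rfl fun k _ => h1 k, Finset.sum_comm]
  refine Finset.sum_congr rfl fun i _ => ?_
  rw [← Finset.mul_sum, totalCount]; ring

theorem sum_frobSq_maskMat (c : ℝ) (v : Fin m → ℤˣ) {ε : Fin n → Fin p → ℝ}
    (hε : ∀ k i, ε k i = 0 ∨ ε k i = 1) :
    ∑ k, frobSq (maskMat (ε k) (signMat p c v)) =
      2 * ∑ i : Fin m, c ^ 2 * totalCount (i + 1) ε := by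
  have h := sum_trace_maskMat c v v hε
  simp only [← sq, sign_sq, one_mul] at h
  rw [← h, Finset.mul_sum]
  refine Finset.sum_congr rfl fun k _ => ?_
  rw [mul_div_cancel₀ _ two_ne_zero, sq,
    trace_mul_self_of_symm (maskMat_transpose (signMat_transpose _ _))]

/-- Given masks for which the pair counts are not too large, the second moment of the uniform
mixture over the good signs is close to `1`: the quadratic term of the exponent is linear in the
products `u_i v_i` of signs, and the remainder is controlled by the operator norms. -/
theorem sum_lintegral_maskedRatio_le (hm : 1 ≤ m) {l φ V : ℝ} (hl : 1 ≤ l)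
    (hD : 5 * φ ^ 2 * l * √m ≤ 1 / 64) {ε : Fin n → Fin p → ℝ}
    (hε : ∀ k i, ε k i = 0 ∨ ε k i = 1)
    (hV : ∑ i : Fin m, ((φ / √m) ^ 2 * totalCount (i + 1) ε) ^ 2 ≤ V) :
    ∑ u ∈ goodSigns m l, ∑ v ∈ goodSigns m l,
      ∫⁻ x, ENNReal.ofReal (maskedRatio (signMat p (φ / √m) u) ε x *
        maskedRatio (signMat p (φ / √m) v) ε x)
        ∂(Measure.pi fun _ : Fin n => stdGaussian (EuclideanSpace ℝ (Fin p))) ≤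
      ENNReal.ofReal (4 ^ m * Real.exp (45 * φ ^ 2 * l * √m * √(m * V) + V / 2)) := by
  set D : ℝ := 5 * φ ^ 2 * l * √m with hDdef
  have hD0 : 0 ≤ D := by positivity
  set c : Fin m → ℝ := fun i => (φ / √m) ^ 2 * totalCount (i + 1) ε with hc
  have hsum : ∑ i, c i ≤ √(m * V) := by
    refine Real.le_sqrt_of_sq_le ?_
    have h := sq_sum_le_card_mul_sum_sq (s := (Finset.univ : Finset (Fin m))) (f := c)
    rw [Finset.card_univ, Fintype.card_fin] at h
    exact h.trans (mul_le_mul_of_nonneg_left hV (Nat.cast_nonneg _))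
  have hterm : ∀ u ∈ goodSigns m l, ∀ v ∈ goodSigns m l,
      ∫⁻ x, ENNReal.ofReal (maskedRatio (signMat p (φ / √m) u) ε x *
        maskedRatio (signMat p (φ / √m) v) ε x)
        ∂(Measure.pi fun _ : Fin n => stdGaussian (EuclideanSpace ℝ (Fin p))) ≤
      ENNReal.ofReal (Real.exp (∑ i, ((u i : ℤ) : ℝ) * ((v i : ℤ) : ℝ) * c i) *
        Real.exp (9 * D * √(m * V))) := by
    intro u hu v hv
    refine (lintegral_maskedRatio_mul_le (signMat_transpose _ _) (signMat_transpose _ _)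
      (opSqBound_signMat_of_good hm hl hu φ) (opSqBound_signMat_of_good hm hl hv φ) hD0 hD
      hε).trans (ENNReal.ofReal_le_ofReal ?_)
    rw [← Real.exp_add, Finset.sum_add_distrib, sum_trace_maskMat _ u v hε, ← Finset.mul_sum,
      sum_frobSq_maskMat _ v hε]
    refine Real.exp_le_exp.2 (add_le_add le_rfl ?_)
    have := mul_le_mul_of_nonneg_left hsum (by positivity : 0 ≤ 9 * D)
    calc _ = 9 * D * ∑ i, c i := by ring
      _ ≤ _ := this
  refine (Finset.sum_le_sum fun u hu => Finset.sum_le_sum fun v hv => hterm u hu v hv).trans ?_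
  simp_rw [← ENNReal.ofReal_sum_of_nonneg fun (v : Fin m → ℤˣ) (_ : v ∈ goodSigns m l) =>
    mul_nonneg (Real.exp_pos _).le (Real.exp_pos (9 * D * √(m * V))).le]
  rw [← ENNReal.ofReal_sum_of_nonneg fun u _ => Finset.sum_nonneg fun v _ => by positivity]
  refine ENNReal.ofReal_le_ofReal ?_
  calc _ ≤ ∑ u : Fin m → ℤˣ, ∑ v : Fin m → ℤˣ,
        Real.exp (∑ i, ((u i : ℤ) : ℝ) * ((v i : ℤ) : ℝ) * c i) * Real.exp (9 * D * √(m * V)) := by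
        refine (Finset.sum_le_sum fun u _ => Finset.sum_le_sum_of_subset_of_nonneg
          (Finset.subset_univ _) fun v _ _ => by positivity).trans
          (Finset.sum_le_sum_of_subset_of_nonneg (Finset.subset_univ _) fun u _ _ =>
            Finset.sum_nonneg fun v _ => by positivity)
    _ ≤ 4 ^ m * Real.exp (∑ i, c i ^ 2 / 2) * Real.exp (9 * D * √(m * V)) := by
        simp_rw [← Finset.sum_mul]
        exact mul_le_mul_of_nonneg_right (sum_exp_signs_le c) (Real.exp_pos _).le
    _ ≤ _ := by
        rw [mul_assoc, ← Real.exp_add, ← Finset.sum_div]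
        refine mul_le_mul_of_nonneg_left (Real.exp_le_exp.2 ?_) (by positivity)
        have : 9 * D * √(m * V) = 45 * φ ^ 2 * l * √m * √(m * V) := by rw [hDdef]; ring
        linarith

end Mixture

/-! ### A lower bound for the total error -/

section TotalErrorBound

variable {m n p : ℕ}

theorem compl_test_eq (Δ : Sample n p → Fin 2) : {y | Δ y = 1}ᶜ = {y | Δ y = 0} := by
  ext y
  simp only [Set.mem_compl_iff, Set.mem_ofPred_eq]
  generalize Δ y = b
  revert b
  decide

/-- The total error of any test is at least its error against the uniform mixture over the good
signs, which is bounded from below on every mask for which the pair counts are not too large. -/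
theorem le_totalError {α φ l V η : ℝ} (a : unitInterval) (hα : 0 ≤ α) (hφ : 0 < φ) (hm : 1 ≤ m)
    (hl : 1 ≤ l) (hmφ : (m : ℝ) ^ α * φ ≤ 1) (hD : 5 * φ ^ 2 * l * √m ≤ 1 / 64)
    (hl48 : 0 < 1 - 48 / l ^ 2) (hη : 0 ≤ η)
    (hexp : Real.exp (45 * φ ^ 2 * l * √m * √(m * V) + V / 2) ≤
      (1 - 48 / l ^ 2) ^ 2 * (1 + η))
    {Δ : Sample n p → Fin 2} (hΔ : Measurable Δ) :
    ENNReal.ofReal (1 - √η) * masksLaw n p a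
      {ε | ∑ i : Fin m, ((φ / √m) ^ 2 * totalCount (i + 1) ε) ^ 2 ≤ V} ≤ totalError a α φ Δ := by
  set E := {ε : Fin n → Fin p → ℝ |
    ∑ i : Fin m, ((φ / √m) ^ 2 * totalCount (i + 1) ε) ^ 2 ≤ V} with hE
  set G := goodSigns m l with hG
  set W : Set (Sample n p) := {y | Δ y = 1} with hW
  have hWm : MeasurableSet W := hΔ (measurableSet_singleton 1)
  have hcard := card_goodSigns_ge hm (lt_of_lt_of_le one_pos hl)
  have hcpos : (0 : ℝ) < G.card := lt_of_lt_of_le (by positivity) hcard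
  have hGne : G.Nonempty := Finset.card_pos.1 (by exact_mod_cast hcpos)
  have hA : ∀ u ∈ G, OpSqBound (signMat p (φ / √m) u) (5 * φ ^ 2 * l * √m) := fun u hu =>
    opSqBound_signMat_of_good hm hl hu φ
  have hD0 : 0 ≤ 5 * φ ^ 2 * l * √(m : ℝ) := by positivity
  let P : Measure (Fin n → EuclideanSpace ℝ (Fin p)) :=
    Measure.pi fun _ : Fin n => stdGaussian (EuclideanSpace ℝ (Fin p))
  let Q : (Fin m → ℤˣ) → Measure (Fin n → EuclideanSpace ℝ (Fin p)) := fun u =>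
    Measure.pi fun _ : Fin n => multivariateGaussian 0 (1 + signMat p (φ / √m) u)
  let F : (Fin n → Fin p → ℝ) → ℝ≥0∞ := fun ε =>
    P {x | maskSample ε x ∈ W} + (G.card : ℝ≥0∞)⁻¹ * ∑ u ∈ G, Q u {x | maskSample ε x ∈ Wᶜ}
  have hEm : MeasurableSet E := by
    have : Measurable fun ε : Fin n → Fin p → ℝ =>
        ∑ i : Fin m, ((φ / √m) ^ 2 * totalCount ((i : ℕ) + 1) ε) ^ 2 := by
      refine Finset.measurable_sum _ fun i _ => Measurable.pow_const (Measurable.const_mul ?_ _) _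
      refine Finset.measurable_sum _ fun k _ => Finset.measurable_sum _ fun i _ =>
        Finset.measurable_sum _ fun j _ => ?_
      split_ifs <;> fun_prop
    exact this measurableSet_Iic
  have hQm : ∀ u, Measurable fun ε : Fin n → Fin p → ℝ => Q u {x | maskSample ε x ∈ Wᶜ} :=
    fun u => measurable_gaussian_section _ hWm.compl
  have hPm : Measurable fun ε : Fin n → Fin p → ℝ => P {x | maskSample ε x ∈ W} := by
    have := measurable_gaussian_section (n := n) (1 : Matrix (Fin p) (Fin p) ℝ) hWm
    rwa [multivariateGaussian_zero_one] at this
  -- the bound given the masks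
  have hcond : ∀ᵐ ε ∂(masksLaw n p a), E.indicator (fun _ => ENNReal.ofReal (1 - √η)) ε ≤ F ε := by
    filter_upwards [ae_masksLaw n p a] with ε hε
    by_cases hεE : ε ∈ E
    · rw [Set.indicator_of_mem hεE]
      have hsec : ∀ u ∈ G, ∀ U : Set (Sample n p), MeasurableSet U → Q u {x | maskSample ε x ∈ U} =
          ∫⁻ x in {x | maskSample ε x ∈ U},
            ENNReal.ofReal (maskedRatio (signMat p (φ / √m) u) ε x) ∂P := fun u hu U hU =>
        gaussian_section_eq (signMat_transpose _ _) (hA u hu) hD0 hD hε hU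
      have h := mixture_test_lower_bound P G hGne
        (fun u => maskedRatio (signMat p (φ / √m) u) ε) (fun u => measurable_maskedRatio _ _)
        (fun u x => maskedRatio_nonneg _ _ _) (fun u hu => ?_) hη
        ((sum_lintegral_maskedRatio_le hm hl hD hε hεE).trans (ENNReal.ofReal_le_ofReal ?_))
        (measurableSet_section ε hWm)
      · refine h.trans (le_of_eq ?_)
        simp only [F]
        rw [Finset.sum_congr rfl fun u hu => hsec u hu _ hWm.compl]
        rfl
      · have h1 := hsec u hu Set.univ MeasurableSet.univ
        simp only [Set.mem_univ, Set.ofPred_true, Measure.restrict_univ] at h1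
        rw [← h1]
        exact measure_univ
      -- `4 ^ m` is compared with the squared number of good signs
      · calc _ ≤ 4 ^ m * ((1 - 48 / l ^ 2) ^ 2 * (1 + η)) :=
              mul_le_mul_of_nonneg_left hexp (by positivity)
          _ = (2 ^ m * (1 - 48 / l ^ 2)) ^ 2 * (1 + η) := by
              rw [mul_pow, ← pow_mul, mul_comm m 2, pow_mul]; norm_num; ring
          _ ≤ _ := by
              refine mul_le_mul_of_nonneg_right ?_ (by linarith)
              exact pow_le_pow_left₀ (by positivity) hcard 2
    · rw [Set.indicator_of_notMem hεE]; exact zero_le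
  have hint : ∫⁻ ε, F ε ∂(masksLaw n p a) =
      sampleLaw n a (1 : Matrix (Fin p) (Fin p) ℝ) W + (G.card : ℝ≥0∞)⁻¹ *
        ∑ u ∈ G, sampleLaw n a (toeplitzSection (signSigma (φ / √m) u) p) Wᶜ := by
    simp only [F]
    rw [lintegral_add_left hPm, lintegral_const_mul _ (Finset.measurable_sum _ fun u _ => hQm u),
      lintegral_finsetSum _ fun u _ => hQm u, sampleLaw_apply a _ hWm,
      multivariateGaussian_zero_one]
    congr 2
    refine Finset.sum_congr rfl fun u _ => ?_
    rw [sampleLaw_apply a _ hWm.compl, toeplitzSection_signSigma]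
  have hsup : (G.card : ℝ≥0∞)⁻¹ *
      ∑ u ∈ G, sampleLaw n a (toeplitzSection (signSigma (φ / √m) u) p) Wᶜ ≤
      ⨆ σ ∈ toeplitzAlternative α φ, sampleLaw n a (toeplitzSection σ p) {y | Δ y = 0} := by
    set S := ⨆ σ ∈ toeplitzAlternative α φ, sampleLaw n a (toeplitzSection σ p) {y | Δ y = 0}
      with hS
    have hle : ∀ u ∈ G, sampleLaw n a (toeplitzSection (signSigma (φ / √m) u) p) Wᶜ ≤ S := by
      intro u hu
      rw [hW, compl_test_eq]
      exact le_iSup₂ (f := fun σ (_ : σ ∈ toeplitzAlternative α φ) =>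
        sampleLaw n a (toeplitzSection σ p) {y | Δ y = 0}) (signSigma (φ / √m) u)
        (signSigma_mem_alternative hα hφ hm hl hmφ hD hu)
    calc _ ≤ (G.card : ℝ≥0∞)⁻¹ * ∑ u ∈ G, S := by gcongr with u hu; exact hle u hu
      _ = S := by
        rw [Finset.sum_const, nsmul_eq_mul, ← mul_assoc, ENNReal.inv_mul_cancel
          (by simpa using hGne.ne_empty) (ENNReal.natCast_ne_top _), one_mul]
  calc _ = ∫⁻ ε, E.indicator (fun _ => ENNReal.ofReal (1 - √η)) ε ∂(masksLaw n p a) := by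
        rw [lintegral_indicator_const hEm]
    _ ≤ ∫⁻ ε, F ε ∂(masksLaw n p a) := lintegral_mono_ae hcond
    _ ≤ totalError a α φ Δ := by
        rw [hint]
        exact add_le_add le_rfl hsup

/-- Markov's inequality for the squared pair counts, whose means are at most of the order
`(a² n p)²`. -/
theorem masksLaw_counts_ge (a : unitInterval) (hm : 1 ≤ m) {φ y : ℝ} (hφ : 0 < φ) (hy : 0 < y)
    (hq : 1 ≤ (a : ℝ) ^ 2 * n * p)
    (hy' : 2 * φ ^ 2 * ((a : ℝ) ^ 2 * n * p) / √m ≤ y) :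
    ENNReal.ofReal (1 - y) ≤ masksLaw n p a
      {ε | ∑ i : Fin m, ((φ / √m) ^ 2 * totalCount (i + 1) ε) ^ 2 ≤ y} := by
  set q := (a : ℝ) ^ 2 * n * p with hqdef
  have hm' : (0 : ℝ) < m := by exact_mod_cast hm
  let f : (Fin n → Fin p → ℝ) → ℝ := fun ε =>
    ∑ i : Fin m, ((φ / √m) ^ 2 * totalCount ((i : ℕ) + 1) ε) ^ 2
  have hfi : ∀ i : Fin m, Integrable (fun ε : Fin n → Fin p → ℝ =>
      ((φ / √m) ^ 2 * totalCount ((i : ℕ) + 1) ε) ^ 2) (masksLaw n p a) := fun i => by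
    simp_rw [mul_pow]
    exact (integral_totalCount_sq_le n a (by omega)).1.const_mul _
  have hf : Integrable f (masksLaw n p a) := integrable_finsetSum _ fun i _ => hfi i
  have hf0 : ∀ ε, 0 ≤ f ε := fun ε => Finset.sum_nonneg fun i _ => sq_nonneg _
  have hmean : ∫ ε, f ε ∂(masksLaw n p a) ≤ y ^ 2 := by
    simp only [f]
    rw [integral_finsetSum _ fun i _ => hfi i]
    calc _ ≤ ∑ i : Fin m, (φ ^ 2 / m) ^ 2 * (4 * q ^ 2) := by
          refine Finset.sum_le_sum fun i _ => ?_
          simp_rw [mul_pow _ (totalCount _ _)]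
          rw [integral_const_mul, div_pow, Real.sq_sqrt hm'.le]
          refine mul_le_mul_of_nonneg_left
            ((integral_totalCount_sq_le n a (by omega)).2.trans ?_) (sq_nonneg _)
          rw [← hqdef]; nlinarith
      _ = (2 * φ ^ 2 * q / √m) ^ 2 := by
          rw [Finset.sum_const, Finset.card_univ, Fintype.card_fin, nsmul_eq_mul,
            div_pow _ (√(m : ℝ)), Real.sq_sqrt hm'.le]
          field_simp; norm_num
      _ ≤ y ^ 2 := pow_le_pow_left₀ (by positivity) hy' 2
  have hmarkov := mul_meas_ge_le_integral_of_nonneg (Eventually.of_forall hf0) hf y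
  have hbad : (masksLaw n p a).real {ε | y ≤ f ε} ≤ y := by
    have := hmarkov.trans hmean
    rw [sq] at this
    exact le_of_mul_le_mul_left this hy
  have hsum : 1 ≤ (masksLaw n p a).real {ε | y ≤ f ε} + (masksLaw n p a).real {ε | f ε ≤ y} := by
    have h1 := measureReal_union_le (μ := masksLaw n p a) {ε | y ≤ f ε} {ε | f ε ≤ y}
    have h2 : {ε | y ≤ f ε} ∪ {ε | f ε ≤ y} = Set.univ :=
      Set.eq_univ_of_forall fun ε => le_total y (f ε)
    rw [h2, probReal_univ] at h1
    exact h1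
  rw [← ofReal_measureReal (μ := masksLaw n p a)]
  exact ENNReal.ofReal_le_ofReal (by change 1 - y ≤ (masksLaw n p a).real {ε | f ε ≤ y}; linarith)

end TotalErrorBound

/-! ### The lower bound -/

theorem totalError_constant_one {n p : ℕ} (a : unitInterval) (α φ : ℝ) :
    totalError (n := n) (p := p) a α φ (fun _ => 1) ≤ 1 := by
  simp [totalError]

theorem minimaxError_le_one (n p : ℕ) (a : unitInterval) (α φ : ℝ) :
    minimaxError n p a α φ ≤ 1 :=
  (iInf₂_le (fun _ => 1) measurable_const).trans (totalError_constant_one a α φ)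

/-- The choice `m = ⌊φ^{-1/α}⌋` makes `m` as large as the condition `m^α φ ≤ 1` allows. -/
theorem floor_rpow_bounds {α φ : ℝ} (hα : 0 < α) (hφ : 0 < φ) (hφ1 : φ ≤ 1) :
    1 ≤ ⌊φ ^ (-(1 / α))⌋₊ ∧ ((⌊φ ^ (-(1 / α))⌋₊ : ℕ) : ℝ) ^ α * φ ≤ 1 ∧
    φ * √(⌊φ ^ (-(1 / α))⌋₊ : ℕ) ≤ φ ^ (1 - 1 / (2 * α)) ∧
    φ ^ 2 / √(⌊φ ^ (-(1 / α))⌋₊ : ℕ) ≤ 2 * φ ^ (2 + 1 / (2 * α)) := by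
  set x := φ ^ (-(1 / α)) with hx
  have hx1 : 1 ≤ x := Real.one_le_rpow_of_pos_of_le_one_of_nonpos hφ hφ1 (by
    rw [neg_nonpos]; positivity)
  have hm : 1 ≤ ⌊x⌋₊ := Nat.le_floor (by simpa using hx1)
  have hmx : ((⌊x⌋₊ : ℕ) : ℝ) ≤ x := Nat.floor_le (by linarith)
  have hm1 : (1 : ℝ) ≤ (⌊x⌋₊ : ℕ) := by exact_mod_cast hm
  have hxm : x / 4 ≤ (⌊x⌋₊ : ℕ) := by
    have := Nat.lt_floor_add_one x; linarith
  have hsx : √x = φ ^ (-(1 / (2 * α))) := by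
    rw [Real.sqrt_eq_rpow, hx, ← Real.rpow_mul hφ.le]; congr 1; ring
  refine ⟨hm, ?_, ?_, ?_⟩
  · calc _ ≤ x ^ α * φ := by gcongr
      _ = 1 := by
        rw [hx, ← Real.rpow_mul hφ.le, show -(1 / α) * α = -1 by field_simp, Real.rpow_neg_one,
          inv_mul_cancel₀ hφ.ne']
  · calc _ ≤ φ * √x := by gcongr
      _ = φ ^ (1 : ℝ) * φ ^ (-(1 / (2 * α))) := by rw [hsx, Real.rpow_one]
      _ = _ := by rw [← Real.rpow_add hφ]; rfl
  · have h2 : √x / 2 ≤ √(⌊x⌋₊ : ℕ) := by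
      have := Real.sqrt_le_sqrt hxm
      rwa [Real.sqrt_div' _ (by norm_num), show √(4 : ℝ) = 2 by
        rw [show (4 : ℝ) = 2 ^ 2 by norm_num]; exact Real.sqrt_sq (by norm_num)] at this
    have hsx0 : 0 < √x := Real.sqrt_pos.2 (by linarith)
    calc _ ≤ φ ^ 2 / (√x / 2) := by gcongr
      _ = 2 * (φ ^ 2 * (√x)⁻¹) := by field_simp
      _ = 2 * φ ^ (2 + 1 / (2 * α)) := by
        rw [hsx, ← Real.rpow_neg hφ.le, neg_neg, Real.rpow_add hφ]
        norm_cast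

theorem tendsto_zero_of_rpow {f : ℕ → ℝ} (hf : ∀ N, 0 < f N) {e : ℝ} (he : 0 < e)
    (h : Tendsto (fun N => f N ^ e) atTop (𝓝 0)) : Tendsto f atTop (𝓝 0) := by
  have := h.rpow_const (p := e⁻¹) (Or.inr (inv_pos.2 he).le)
  rw [Real.zero_rpow (inv_pos.2 he).ne'] at this
  refine this.congr fun N => ?_
  rw [← Real.rpow_mul (hf N).le, mul_inv_cancel₀ he.ne', Real.rpow_one]

/-- With `w = φ √m → 0` and `y ≍ a² n p φ^{2 + 1/(2α)} → 0`, the second moment of the mixture is at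
most `1 + η` for an explicit function `η` of `w` and `y` that vanishes at `0`. -/
theorem lower_bound {α : ℝ} (hα : 1 / 2 < α) {n p : ℕ → ℕ} {a : ℕ → unitInterval} {φ : ℕ → ℝ}
    (hφ : ∀ N, 0 < φ N)
    (hq : Tendsto (fun N => (a N : ℝ) ^ 2 * n N * p N) atTop atTop)
    (hx : Tendsto (fun N => (a N : ℝ) ^ 2 * n N * p N * φ N ^ (2 + 1 / (2 * α))) atTop (𝓝 0)) :
    Tendsto (fun N => minimaxError (n N) (p N) (a N) α (φ N)) atTop (𝓝 1) := by
  have hα0 : 0 < α := by linarith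
  have he : 0 < 2 + 1 / (2 * α) := by positivity
  have hφ0 : Tendsto φ atTop (𝓝 0) := by
    refine tendsto_zero_of_rpow hφ he ?_
    refine squeeze_zero' (Eventually.of_forall fun N => (Real.rpow_pos_of_pos (hφ N) _).le) ?_ hx
    filter_upwards [hq.eventually_ge_atTop 1] with N hN
    exact le_mul_of_one_le_left (Real.rpow_pos_of_pos (hφ N) _).le hN
  set q : ℕ → ℝ := fun N => (a N : ℝ) ^ 2 * n N * p N with hqdef
  set m : ℕ → ℕ := fun N => ⌊φ N ^ (-(1 / α))⌋₊ with hmdef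
  set w : ℕ → ℝ := fun N => φ N * √(m N : ℝ) with hw
  set y : ℕ → ℝ := fun N => 4 * (q N * φ N ^ (2 + 1 / (2 * α))) with hy
  have hφ1 : ∀ᶠ N in atTop, φ N ≤ 1 := hφ0.eventually (eventually_le_nhds (by norm_num))
  have hw0 : Tendsto w atTop (𝓝 0) := by
    have h1 : 0 < 1 - 1 / (2 * α) := by
      rw [sub_pos, div_lt_one (by linarith)]; linarith
    have h2 := hφ0.rpow_const (p := 1 - 1 / (2 * α)) (Or.inr h1.le)
    rw [Real.zero_rpow h1.ne'] at h2
    refine squeeze_zero' (Eventually.of_forall fun N => mul_nonneg (hφ N).le (Real.sqrt_nonneg _))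
      ?_ h2
    filter_upwards [hφ1] with N hN
    exact (floor_rpow_bounds hα0 (hφ N) hN).2.2.1
  have hy0 : Tendsto y atTop (𝓝 0) := by
    have := hx.const_mul 4
    rwa [mul_zero] at this
  set η : ℕ → ℝ := fun N =>
    Real.exp (45 * w N * √(y N) + y N / 2) / (1 - 48 * w N ^ 2) ^ 2 - 1 with hηdef
  have hη0 : Tendsto η atTop (𝓝 0) := by
    have h1 : Tendsto (fun N => 45 * w N * √(y N) + y N / 2) atTop (𝓝 (45 * 0 * √0 + 0 / 2)) :=
      ((hw0.const_mul 45).mul hy0.sqrt).add (hy0.div_const 2)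
    have h2 : Tendsto (fun N => (1 - 48 * w N ^ 2) ^ 2) atTop (𝓝 ((1 - 48 * 0 ^ 2) ^ 2)) :=
      (((hw0.pow 2).const_mul 48).const_sub 1).pow 2
    have h3 := (((Real.continuous_exp.tendsto _).comp h1).div h2 (by norm_num)).sub_const 1
    simpa using h3
  have hlow : Tendsto (fun N => ENNReal.ofReal (1 - √(η N)) * ENNReal.ofReal (1 - y N)) atTop
      (𝓝 1) := by
    have h1 : Tendsto (fun N => ENNReal.ofReal (1 - √(η N))) atTop (𝓝 1) := by
      have := ENNReal.tendsto_ofReal (hη0.sqrt.const_sub 1)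
      simpa using this
    have h2 : Tendsto (fun N => ENNReal.ofReal (1 - y N)) atTop (𝓝 1) := by
      have := ENNReal.tendsto_ofReal (hy0.const_sub 1)
      simpa using this
    simpa using ENNReal.Tendsto.mul h1 (by simp) h2 (by simp)
  refine tendsto_of_tendsto_of_tendsto_of_le_of_le' hlow tendsto_const_nhds ?_
    (Eventually.of_forall fun N => minimaxError_le_one _ _ _ _ _)
  have hw1 : ∀ᶠ N in atTop, w N < 1 / 10 := hw0.eventually (gt_mem_nhds (by norm_num))
  have hφ2 : ∀ᶠ N in atTop, φ N ≤ 1 / 320 := hφ0.eventually (eventually_le_nhds (by norm_num))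
  filter_upwards [hφ1, hw1, hφ2, hq.eventually_ge_atTop 1] with N hN hwN hφN hqN
  obtain ⟨hm, hmφ, -, hmy⟩ := floor_rpow_bounds hα0 (hφ N) hN
  have hm' : (0 : ℝ) < m N := by exact_mod_cast hm
  have hsm : 0 < √(m N : ℝ) := Real.sqrt_pos.2 hm'
  have hwpos : 0 < w N := mul_pos (hφ N) hsm
  have hypos : 0 < y N := mul_pos (by norm_num)
    (mul_pos (by linarith) (Real.rpow_pos_of_pos (hφ N) _))
  -- the choice `l = 1 / (φ √m)` makes the squared operator norms at most `5 φ`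
  have hl : 1 ≤ (w N)⁻¹ := (one_le_inv₀ hwpos).2 (by linarith)
  have hDeq : 5 * φ N ^ 2 * (w N)⁻¹ * √(m N : ℝ) = 5 * φ N := by
    simp only [hw]; field_simp
  have h48 : 48 / (w N)⁻¹ ^ 2 = 48 * w N ^ 2 := by rw [inv_pow, div_inv_eq_mul]
  have hden : 0 < 1 - 48 * w N ^ 2 := by nlinarith
  refine le_iInf₂ fun Δ hΔ => le_trans ?_ (le_totalError (V := y N) (η := η N) (a N) hα0.le (hφ N)
    hm hl hmφ ?_ ?_ ?_ ?_ hΔ)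
  · refine mul_le_mul_right (masksLaw_counts_ge (a N) hm (hφ N) hypos hqN ?_) _
    calc _ = 2 * q N * (φ N ^ 2 / √(m N : ℝ)) := by ring
      _ ≤ 2 * q N * (2 * φ N ^ (2 + 1 / (2 * α))) :=
        mul_le_mul_of_nonneg_left hmy (by linarith)
      _ = y N := by simp only [hy]; ring
  · rw [hDeq]; linarith
  · rw [h48]; exact hden
  · have h1 : (1 - 48 * w N ^ 2) ^ 2 ≤ 1 := pow_le_one₀ hden.le (by nlinarith)
    have h2 : 1 ≤ Real.exp (45 * w N * √(y N) + y N / 2) := Real.one_le_exp (by positivity)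
    rw [hηdef, sub_nonneg, one_le_div (by positivity)]
    linarith
  · rw [h48, show 45 * φ N ^ 2 * (w N)⁻¹ * √(m N : ℝ) = 9 * (5 * φ N) by rw [← hDeq]; ring,
      Real.sqrt_mul hm'.le]
    refine le_of_eq ?_
    rw [show 9 * (5 * φ N) * (√(m N : ℝ) * √(y N)) + y N / 2 = 45 * w N * √(y N) + y N / 2 by
      simp only [hw]; ring]
    simp only [hηdef]
    rw [add_sub_cancel, mul_div_cancel₀ _ (pow_pos hden 2).ne']

/-! ### The separation rate -/

theorem totalError_antitone {n p : ℕ} (a : unitInterval) (α : ℝ) {φ φ' : ℝ} (h0 : 0 ≤ φ')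
    (h : φ' ≤ φ) (Δ : Sample n p → Fin 2) : totalError a α φ Δ ≤ totalError a α φ' Δ :=
  add_le_add le_rfl (biSup_mono fun _ hσ => ⟨hσ.1, (pow_le_pow_left₀ h0 h 2).trans hσ.2⟩)

/-- The rate `ρ = q^{-2α/(4α+1)}` solves `q ρ^{2 + 1/(2α)} = 1`. -/
theorem mul_rpow_eq {α q φ : ℝ} (hα : 0 < α) (hq : 0 < q) (hφ : 0 < φ) :
    q * φ ^ (2 + 1 / (2 * α)) = (φ / q ^ (-(2 * α / (4 * α + 1)))) ^ (2 + 1 / (2 * α)) := by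
  have h4 : 0 < 4 * α + 1 := by positivity
  rw [Real.div_rpow hφ.le (Real.rpow_nonneg hq.le _), ← Real.rpow_mul hq.le,
    show -(2 * α / (4 * α + 1)) * (2 + 1 / (2 * α)) = -1 by field_simp; ring,
    Real.rpow_neg_one, div_inv_eq_mul, mul_comm]

theorem exists_consistent_test {α : ℝ} (hα : 1 / 2 < α) {n p : ℕ → ℕ} {a : ℕ → unitInterval}
    (ha : ∀ N, 0 < (a N : ℝ)) (hn : Tendsto n atTop atTop) (hp : Tendsto p atTop atTop)
    (hq : Tendsto (fun N => (a N : ℝ) ^ 2 * n N * p N) atTop atTop)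
    (hqp : Tendsto (fun N => ((a N : ℝ) ^ 2 * n N * p N) ^ (2 / (4 * α + 1)) / (p N : ℝ))
      atTop (𝓝 0)) {φ : ℕ → ℝ} (hφ : ∀ N, 0 < φ N)
    (hrate : Tendsto (fun N => φ N / ((a N : ℝ) ^ 2 * n N * p N) ^ (-(2 * α / (4 * α + 1))))
      atTop atTop) :
    ∃ Δ : (N : ℕ) → Sample (n N) (p N) → Fin 2, (∀ N, Measurable (Δ N)) ∧
      Tendsto (fun N => totalError (a N) α (φ N) (Δ N)) atTop (𝓝 0) := by
  have hα0 : 0 < α := by linarith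
  have h4 : 0 < 4 * α + 1 := by positivity
  have he : 0 < 2 + 1 / (2 * α) := by positivity
  set q : ℕ → ℝ := fun N => (a N : ℝ) ^ 2 * n N * p N with hqdef
  set ρ : ℕ → ℝ := fun N => q N ^ (-(2 * α / (4 * α + 1))) with hρdef
  have hρ0 : Tendsto ρ atTop (𝓝 0) :=
    (tendsto_rpow_neg_atTop (by positivity)).comp hq
  have hqpos : ∀ᶠ N in atTop, 0 < q N := hq.eventually_gt_atTop 0
  have hρpos : ∀ᶠ N in atTop, 0 < ρ N := hqpos.mono fun N h => Real.rpow_pos_of_pos h _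
  -- it suffices to detect the smaller separation `min φ √ρ`, which tends to `0`; where `ρ` vanishes,
  -- which happens for finitely many indices only, the minimum would not be positive
  set ψ : ℕ → ℝ := fun N => if 0 < ρ N then min (φ N) (√(ρ N)) else φ N with hψdef
  have hψpos : ∀ N, 0 < ψ N := fun N => by
    simp only [hψdef]
    split_ifs with h
    · exact lt_min (hφ N) (Real.sqrt_pos.2 h)
    · exact hφ N
  have hψφ : ∀ N, ψ N ≤ φ N := fun N => by
    simp only [hψdef]
    split_ifs with h
    · exact min_le_left _ _
    · exact le_rfl
  have hψeq : ∀ᶠ N in atTop, ψ N = min (φ N) (√(ρ N)) := hρpos.mono fun N h => if_pos h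
  have hψ0 : Tendsto ψ atTop (𝓝 0) := by
    have hs : Tendsto (fun N => √(ρ N)) atTop (𝓝 0) := by simpa using hρ0.sqrt
    refine squeeze_zero' (Eventually.of_forall fun N => (hψpos N).le) ?_ hs
    filter_upwards [hψeq] with N hN
    rw [hN]; exact min_le_right _ _
  have hψrate : Tendsto (fun N => ψ N / ρ N) atTop atTop := by
    have hs : Tendsto (fun N => (√(ρ N))⁻¹) atTop atTop := by
      have : Tendsto (fun N => √(ρ N)) atTop (𝓝[>] 0) := by
        refine tendsto_nhdsWithin_iff.2 ⟨by simpa using hρ0.sqrt, ?_⟩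
        filter_upwards [hρpos] with N hN
        exact Real.sqrt_pos.2 hN
      exact tendsto_inv_nhdsGT_zero.comp this
    rw [tendsto_atTop] at hrate hs ⊢
    intro b
    filter_upwards [hψeq, hρpos, hrate b, hs b] with N h1 h2 h3 h4
    rw [h1, le_div_iff₀ h2]
    refine le_min ((le_div_iff₀ h2).1 h3) ?_
    have hsp := Real.sqrt_pos.2 h2
    rw [← one_div, le_div_iff₀ hsp] at h4
    nlinarith [Real.mul_self_sqrt h2.le]
  have hψe : Tendsto (fun N => q N * ψ N ^ (2 + 1 / (2 * α))) atTop atTop := by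
    refine ((tendsto_rpow_atTop he).comp hψrate).congr' ?_
    filter_upwards [hqpos] with N hN
    exact (mul_rpow_eq hα0 hN (hψpos N)).symm
  set x : ℕ → ℝ := fun N => (2 / ψ N) ^ (1 / α) with hxdef
  set m : ℕ → ℕ := fun N => ⌈x N⌉₊ with hmdef
  have hψ1 : ∀ᶠ N in atTop, ψ N ≤ 1 := hψ0.eventually (eventually_le_nhds (by norm_num))
  have hxm : ∀ N, x N ≤ m N := fun N => Nat.le_ceil _
  have hx0 : ∀ N, 0 < x N := fun N => Real.rpow_pos_of_pos (div_pos two_pos (hψpos N)) _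
  have hmx : ∀ᶠ N in atTop, (m N : ℝ) ≤ 2 * x N := by
    filter_upwards [hψ1] with N hN
    have h1 : 1 ≤ x N := Real.one_le_rpow ((one_le_div (hψpos N)).2 (by linarith)) (by positivity)
    have := Nat.ceil_lt_add_one (hx0 N).le
    simp only [hmdef]; linarith
  have hxα : ∀ N, x N ^ α * ψ N = 2 := fun N => by
    simp only [hxdef]
    rw [← Real.rpow_mul (div_pos two_pos (hψpos N)).le, one_div_mul_cancel hα0.ne', Real.rpow_one,
      div_mul_cancel₀ _ (hψpos N).ne']
  have hxtop : Tendsto x atTop atTop := by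
    have h1 : Tendsto ψ atTop (𝓝[>] 0) :=
      tendsto_nhdsWithin_iff.2 ⟨hψ0, Eventually.of_forall hψpos⟩
    have h2 : Tendsto (fun N => 2 / ψ N) atTop atTop := by
      simp_rw [div_eq_mul_inv]
      exact (tendsto_inv_nhdsGT_zero.comp h1).const_mul_atTop two_pos
    exact (tendsto_rpow_atTop (by positivity)).comp h2
  have hm : Tendsto m atTop atTop := by
    rw [← tendsto_natCast_atTop_iff (R := ℝ)]
    exact tendsto_atTop_mono hxm hxtop
  have hmp : Tendsto (fun N => (m N : ℝ) / (p N : ℝ)) atTop (𝓝 0) := by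
    have hlim := hqp.const_mul (2 * (2 : ℝ) ^ (1 / α))
    rw [mul_zero] at hlim
    refine squeeze_zero' (Eventually.of_forall fun N => by positivity) ?_ hlim
    filter_upwards [hmx, hψrate.eventually_ge_atTop 1, hρpos, hqpos] with N h1 h2 h3 hqN
    rw [one_le_div h3] at h2
    have hx1 : x N ≤ 2 ^ (1 / α) * q N ^ (2 / (4 * α + 1)) := by
      calc x N ≤ (2 / ρ N) ^ (1 / α) := by
            refine Real.rpow_le_rpow (div_pos two_pos (hψpos N)).le ?_ (by positivity)
            gcongr
        _ = _ := by
            simp only [hρdef]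
            rw [Real.div_rpow two_pos.le (Real.rpow_nonneg hqN.le _), ← Real.rpow_mul hqN.le,
              div_eq_mul_inv, ← Real.rpow_neg hqN.le]
            congr 2
            field_simp
    rw [← mul_div_assoc]
    refine div_le_div_of_nonneg_right (h1.trans ?_) (Nat.cast_nonneg _)
    linarith
  -- `m` lies between `x` and `2 x`, where `x ^ α * ψ = 2`
  set K : ℝ := ((2 : ℝ) ^ (α + 1)) ^ (-(1 / (2 * α))) with hK
  have hKpos : 0 < K := by positivity
  have hKα : K ^ (-(2 * α)) = 2 ^ (α + 1) := by
    rw [hK, ← Real.rpow_mul (by positivity), show -(1 / (2 * α)) * -(2 * α) = 1 by field_simp,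
      Real.rpow_one]
  have hB : 0 < thresholdConst 2 K := by
    unfold thresholdConst
    exact mul_pos (by positivity) (by norm_num)
  -- any constant in `(0, B)` would do
  set κ : ℝ := thresholdConst 2 K / 2 with hκ
  have hκ0 : 0 < κ := half_pos hB
  have hmφ : ∀ᶠ N in atTop, 2 ≤ (m N : ℝ) ^ α * ψ N ∧ (m N : ℝ) ^ α * ψ N ≤ K ^ (-(2 * α)) := by
    filter_upwards [hmx] with N hN
    constructor
    · rw [← hxα N]
      exact mul_le_mul_of_nonneg_right (Real.rpow_le_rpow (hx0 N).le (hxm N) hα0.le) (hψpos N).le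
    · rw [hKα]
      calc _ ≤ (2 * x N) ^ α * ψ N := mul_le_mul_of_nonneg_right
            (Real.rpow_le_rpow (Nat.cast_nonneg _) hN hα0.le) (hψpos N).le
        _ = 2 ^ (α + 1) := by
            rw [Real.mul_rpow two_pos.le (hx0 N).le, mul_assoc, hxα,
              Real.rpow_add_one two_ne_zero]
  let t : ℕ → ℝ := fun N => κ * (a N : ℝ) ^ 4 * ψ N ^ (2 + 1 / (2 * α))
  refine ⟨fun N => toeplitzTest (m N) (t N), fun N => measurable_toeplitzTest _ _, ?_⟩
  have hup := upper_bound (α := α) (t := t) (by linarith) ha hn hp hψpos one_lt_two hKpos hm hmp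
    hmφ hψe (half_le_self hB.le) (fun _ => half_lt_self hB) (Eventually.of_forall fun N => le_rfl)
    (by
      refine (hψe.const_mul_atTop hκ0).congr fun N => ?_
      have := (ha N).ne'
      simp only [t, hqdef]
      field_simp)
  exact tendsto_of_tendsto_of_tendsto_of_le_of_le tendsto_const_nhds hup (fun N => zero_le)
    fun N => totalError_antitone _ _ (hψpos N).le (hψφ N) _

theorem isMinimaxSeparationRate {α : ℝ} (hα : 1 / 2 < α) {n p : ℕ → ℕ} {a : ℕ → unitInterval}
    (ha : ∀ N, 0 < (a N : ℝ)) (hn : Tendsto n atTop atTop) (hp : Tendsto p atTop atTop)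
    (hq : Tendsto (fun N => (a N : ℝ) ^ 2 * n N * p N) atTop atTop)
    (hqp : Tendsto (fun N => ((a N : ℝ) ^ 2 * n N * p N) ^ (2 / (4 * α + 1)) / (p N : ℝ))
      atTop (𝓝 0)) :
    IsMinimaxSeparationRate n p a α
      (fun N => ((a N : ℝ) ^ 2 * n N * p N) ^ (-(2 * α / (4 * α + 1)))) := by
  refine fun φ hφ => ⟨exists_consistent_test hα ha hn hp hq hqp hφ, fun hrate =>
    lower_bound hα hφ hq ?_⟩
  have he : 0 < 2 + 1 / (2 * α) := by positivity
  have h := hrate.rpow_const (p := 2 + 1 / (2 * α)) (Or.inr he.le)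
  rw [Real.zero_rpow he.ne'] at h
  refine h.congr' ?_
  filter_upwards [hq.eventually_gt_atTop 0] with N hN
  exact (mul_rpow_eq (by linarith) hN (hφ N)).symm

end MissingObs

theorem mainTheorem2 (α : ℝ) (n p : ℕ → ℕ) (a : ℕ → unitInterval)
    (ha : ∀ N, 0 < (a N : ℝ) ∧ (a N : ℝ) < 1)
    (hn : Tendsto n atTop atTop) (hp : Tendsto p atTop atTop) :
    -- upper bound
    (1 / 4 < α →
      ∀ (φ t : ℕ → ℝ) (m : ℕ → ℕ) (D K κ : ℝ),
        (∀ N, 0 < φ N) →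
        1 < D → 0 < K →
        Tendsto m atTop atTop →
        Tendsto (fun N => (m N : ℝ) / (p N : ℝ)) atTop (𝓝 0) →
        (∀ᶠ N in atTop, D ≤ (m N : ℝ) ^ α * φ N ∧ (m N : ℝ) ^ α * φ N ≤ K ^ (-(2 * α))) →
        Tendsto φ atTop (𝓝 0) →
        Tendsto (fun N => (a N : ℝ) ^ 2 * n N * p N * φ N ^ (2 + 1 / (2 * α))) atTop atTop →
        κ ≤ thresholdConst D K →
        (D = K ^ (-(2 * α)) → κ < thresholdConst D K) →
        (∀ᶠ N in atTop, t N ≤ κ * (a N : ℝ) ^ 4 * φ N ^ (2 + 1 / (2 * α))) →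
        Tendsto (fun N => (n N : ℝ) * p N * t N / (a N : ℝ) ^ 2) atTop atTop →
        Tendsto (fun N => totalError (a N) α (φ N)
          (toeplitzTest (n := n N) (p := p N) (m N) (t N))) atTop (𝓝 0)) ∧
    -- lower bound
    (1 / 2 < α →
      ∀ φ : ℕ → ℝ, (∀ N, 0 < φ N) →
        Tendsto (fun N => (a N : ℝ) ^ 2 * n N * p N) atTop atTop →
        Tendsto (fun N => (a N : ℝ) ^ 2 * n N * p N * φ N ^ (2 + 1 / (2 * α))) atTop (𝓝 0) →
        Tendsto (fun N => minimaxError (n N) (p N) (a N) α (φ N)) atTop (𝓝 1)) ∧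
    -- separation rate
    (1 / 2 < α →
      Tendsto (fun N => (a N : ℝ) ^ 2 * n N * p N) atTop atTop →
      Tendsto (fun N => ((a N : ℝ) ^ 2 * n N * p N) ^ (2 / (4 * α + 1)) / (p N : ℝ))
        atTop (𝓝 0) →
      IsMinimaxSeparationRate n p a α
        (fun N => ((a N : ℝ) ^ 2 * n N * p N) ^ (-(2 * α / (4 * α + 1))))) := by
  have ha0 : ∀ N, 0 < (a N : ℝ) := fun N => (ha N).1
  exact ⟨fun hα _ _ _ _ _ _ hφ hD hK hm hmp hmφ _ hq hκ hκ' ht hr =>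
      upper_bound hα ha0 hn hp hφ hD hK hm hmp hmφ hq hκ hκ' ht hr,
    fun hα _ hφ hq hx => lower_bound hα hφ hq hx,
    fun hα hq hqp => isMinimaxSeparationRate hα ha0 hn hp hq hqp⟩
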